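/- **Notation.** For $\tau\in\mathbb H=\{\operatorname{Im}\tau>0\}$ let $\Lambda_\tau=\mathbb Z+\mathbb Z\tau$, $E_\tau=\mathbb C/\Lambda_\tau$, $\omega_0=0,\ \omega_1=1,\ \omega_2=\tau,\ \omega_3=1+\tau$, $E_\tau[2]=\{\omega_k/2+\Lambda_\tau : k=0,1,2,3\}$, and let $\wp(z|\tau)$, $\zeta(z|\tau)$ be the Weierstrass functions of $\Lambda_\tau$. Let $V\subseteq\mathbb H$ be open (for example $V=\mathbb H$), let $n_0,\dots,n_3\in\mathbb C$ with $n_k\notin\frac12+\mathbb Z$, and let $p,A,B$ be holomorphic functions on $V$ with $p(\tau)\notin E_\tau[2]$ for all $\tau\in V$. Put $$I(z;\tau)=\sum_{k=0}^{3}n_k(n_k+1)\wp\!\left(z+\tfrac{\omega_k}{2}\Big|\tau\right)+\tfrac34\bigl(\wp(z+p|\tau)+\wp(z-p|\tau)\bigr)+A\bigl(\zeta(z+p|\tau)-\zeta(z-p|\tau)\bigr)+B,\qquad Q(z;\tau)=\begin{pmatrix}0&1\\ I(z;\tau)&0\end{pmatrix}.$$ Let $S_\tau=\{\pm p(\tau)\}\cup\{\omega_k/2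 : k=0,1,2,3\}$ modulo $\Lambda_\tau$ and $X=\{(z,\tau)\in\mathbb C\times V:\ z\bmod\Lambda_\tau\notin S_\tau\}$. "Single-valued on $\mathbb C\times V$" means: a holomorphic function on $X$. A prime denotes $\partial/\partial z$. The system $Y'=Q(z;\tau)Y$ on $E_\tau$ is called *monodromy preserving* in $\tau\in V$ if every $\tau_0\in V$ has an open neighbourhood $V_0\subseteq V$ for which there are a point $q$, a neighbourhood $U$ of $q$ with $U\times V_0\subseteq X$, and a fundamental solution $Y(z;\tau)$ of the system, holomorphic on $U\times V_0$, whose monodromy is independent of $\tau$: for every connected open $V_1\subseteq V_0$ and every family of loops $\ell_\tau$ in $E_\tau\setminus S_\tau$ based at $q$, depending continuously on $\tau\in V_1$, there is $\rho\in SL(2,\mathbb C)$ such that for all $\tau\in V_1$ the analytic continuation of $Y(\cdot\,;\tau)$ along $\ell_\tau$ is $Y(\cdot\,;\tau)\rho$ near $q$. A Pfaffian system $\partial_zY=QY$, $\partial_\tau Y=\Omega Y$ on $X$ is *completely integrable* if it has a holomorphic fundamental solution near every point of $X$. **Theorem.** 1. The system $Y'=Q(z;\tau)Y$ is monodromy preserving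 in $\tau\in V$ if and only if there is a single-valued solution $\Omega_{12}(z;\tau)$ of $$\Omega_{12}'''-4I\,\Omega_{12}'-2I'\,\Omega_{12}+2\,\partial_\tau I=0$$ on $\mathbb C\times V$ such that $\Omega_{12}(z+1;\tau)=\Omega_{12}(z;\tau)$ and $\Omega_{12}(z+\tau;\tau)=\Omega_{12}(z;\tau)-1$. 2. The system $Y'=Q(z;\tau)Y$ is monodromy preserving in $\tau\in V$ if and only if there is a single-valued $2\times2$ matrix function $\Omega(z;\tau)$ on $\mathbb C\times V$ with $\Omega(z+1;\tau)=\Omega(z;\tau)$ and $\Omega(z+\tau;\tau)=\Omega(z;\tau)-Q(z;\tau)$ such that the Pfaffian system $$\frac{\partial}{\partial z}Y=Q(z;\tau)Y,\qquad \frac{\partial}{\partial\tau}Y=\Omega(z;\tau)Y$$ is completely integrable. -/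

import Mathlib

noncomputable section

namespace GenLame

/-- The periods `1, τ` of the torus `E_τ = ℂ / (ℤ + ℤ τ)`, for `τ` in the upper half plane. -/
def periodPair (τ : UpperHalfPlane) : PeriodPair where
  ω₁ := 1
  ω₂ := (τ : ℂ)
  indep := by
    rw [LinearIndependent.pair_iff]
    intro s t h
    have him := congrArg Complex.im h
    have hre := congrArg Complex.re h
    simp only [Complex.add_im, Complex.add_re, Complex.real_smul, Complex.mul_im,
      Complex.mul_re, Complex.ofReal_re, Complex.ofReal_im,
      Complex.zero_re, Complex.zero_im, zero_mul, mul_one, add_zero, zero_add,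
      sub_zero] at him hre
    have ht : t = 0 := by
      rcases mul_eq_zero.mp him with h0 | h0
      · exact h0
      · exact absurd h0 τ.im_pos.ne'
    subst ht
    simpa using hre

/-- The period pair `(1, τ)` for a complex number `τ`; it is only used for `0 < Im τ`
(outside the upper half plane `UpperHalfPlane.ofComplex` takes a default value). -/
def periods (τ : ℂ) : PeriodPair := periodPair (UpperHalfPlane.ofComplex τ)

theorem periods_of_im_pos {τ : ℂ} (h : 0 < τ.im) :
    (periods τ).ω₁ = 1 ∧ (periods τ).ω₂ = τ := by
  refine ⟨rfl, ?_⟩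
  change ((UpperHalfPlane.ofComplex τ : UpperHalfPlane) : ℂ) = τ
  rw [UpperHalfPlane.ofComplex_apply_of_im_pos h]

/-- The Weierstrass function `℘(z|τ)`. -/
def wp (z τ : ℂ) : ℂ := (periods τ).weierstrassP z

/-- The Weierstrass zeta function
`ζ(z|τ) = 1/z + ∑_{ω ≠ 0} (1/(z - ω) + 1/ω + z/ω²)`; the summand of `ω = 0` below is `1/z`,
because division by zero gives zero. -/
def wzeta (z τ : ℂ) : ℂ :=
  ∑' l : (periods τ).lattice, (1 / (z - (l : ℂ)) + 1 / (l : ℂ) + z / (l : ℂ) ^ 2)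

/-- The numbers `ω₀ = 0`, `ω₁ = 1`, `ω₂ = τ`, `ω₃ = 1 + τ`. -/
def omega (k : Fin 4) (τ : ℂ) : ℂ := ![0, 1, τ, 1 + τ] k

/-- `z` represents a two-torsion point of `E_τ`. -/
def IsTwoTorsion (z τ : ℂ) : Prop :=
  ∃ k : Fin 4, z - omega k τ / 2 ∈ (periods τ).lattice

/-- The coefficients of a family of generalized Lamé equations, parametrized by `τ`. -/
structure LameData where
  /-- the exponent parameters `n₀, n₁, n₂, n₃` -/
  n : Fin 4 → ℂ
  /-- the moving singular point `p(τ)` -/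
  p : ℂ → ℂ
  /-- the coefficient `A(τ)` -/
  A : ℂ → ℂ
  /-- the coefficient `B(τ)` -/
  B : ℂ → ℂ

namespace LameData

variable (D : LameData)

/-- The potential `I(z;τ)` of the generalized Lamé equation `y'' = I(z;τ) y`. -/
def potential (z τ : ℂ) : ℂ :=
  (∑ k : Fin 4, D.n k * (D.n k + 1) * wp (z + omega k τ / 2) τ)
    + 3 / 4 * (wp (z + D.p τ) τ + wp (z - D.p τ) τ)
    + D.A τ * (wzeta (z + D.p τ) τ - wzeta (z - D.p τ) τ)
    + D.B τ

/-- The matrix `Q(z;τ)` of the first order system `Y' = Q Y`. -/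
def Q (z τ : ℂ) : Matrix (Fin 2) (Fin 2) ℂ := !![0, 1; D.potential z τ, 0]

/-- `z` is a lift to `ℂ` of one of the points `± p(τ)`, `ω_k / 2` of `E_τ`. -/
def IsSingular (z τ : ℂ) : Prop :=
  IsTwoTorsion z τ ∨ z - D.p τ ∈ (periods τ).lattice ∨ z + D.p τ ∈ (periods τ).lattice

/-- The part of `ℂ × V` away from the singular points. -/
def regularSet (V : Set ℂ) : Set (ℂ × ℂ) := {x | x.2 ∈ V ∧ ¬ D.IsSingular x.1 x.2}

end LameData

/-- A single-valued holomorphic matrix function of `(z, τ)` on `X` (entrywise). -/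
def MatHolOn (F : ℂ → ℂ → Matrix (Fin 2) (Fin 2) ℂ) (X : Set (ℂ × ℂ)) : Prop :=
  ∀ i j, DifferentiableOn ℂ (fun x : ℂ × ℂ => F x.1 x.2 i j) X

/-- The germ of `g` at the end of the path `γ` is the analytic continuation along `γ` of the germ
of `f` at the start of `γ`: there are analytic germs `F s` at all `γ s` that are locally restrictions
of one another, from `f` to `g`. -/
def IsAnalyticContinuation (γ : unitInterval → ℂ) (f g : ℂ → Matrix (Fin 2) (Fin 2) ℂ) : Prop :=
  ∃ F : unitInterval → ℂ → Matrix (Fin 2) (Fin 2) ℂ,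
    (∀ s i j, AnalyticAt ℂ (fun z => F s z i j) (γ s)) ∧
    (∀ s, ∀ᶠ s' in nhds s, F s' =ᶠ[nhds (γ s')] F s) ∧
    F 0 =ᶠ[nhds (γ 0)] f ∧
    F 1 =ᶠ[nhds (γ 1)] g

namespace LameData

variable (D : LameData)

/-- A continuous family, over `τ ∈ V`, of loops in `E_τ ∖ {± p(τ), ω_k / 2}` with base point `q`,
given by their lifts to `ℂ`: paths from `q` to `q + m + n τ` that avoid the singular points. -/
def IsLoopFamily (V : Set ℂ) (q : ℂ) (m n : ℤ) (γ : ℂ → unitInterval → ℂ) : Prop :=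
  ContinuousOn (fun x : ℂ × unitInterval => γ x.1 x.2) (V ×ˢ Set.univ) ∧
  ∀ τ ∈ V, γ τ 0 = q ∧ γ τ 1 = q + m + n * τ ∧ ∀ s, ¬ D.IsSingular (γ τ s) τ

/-- `Y` is a fundamental system of solutions of `Y' = Q(z;τ) Y` on `U`, holomorphic in
`(z, τ) ∈ U × V`. -/
def IsFundamentalSolution (Y : ℂ → ℂ → Matrix (Fin 2) (Fin 2) ℂ) (U V : Set ℂ) : Prop :=
  MatHolOn Y (U ×ˢ V) ∧
  ∀ z ∈ U, ∀ τ ∈ V, (Y z τ).det ≠ 0 ∧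
    ∀ i j, HasDerivAt (fun w => Y w τ i j) ((D.Q z τ * Y z τ) i j) z

/-- `Y`, given near the base point `q` and for `τ ∈ V`, is `M`-invariant: its monodromy along loops
of `E_τ` minus the singular points does not depend on `τ`. Loops for different `τ` are identified by
deforming them continuously with `τ`; analytic continuation along a loop that lifts to a path from
`q` to `q + m + n τ` turns `Y` into a germ at `q + m + n τ`, which is a germ at `q` on the torus. -/
def IsMInvariant (Y : ℂ → ℂ → Matrix (Fin 2) (Fin 2) ℂ) (q : ℂ) (V : Set ℂ) : Prop :=
  ∀ V₁ : Set ℂ, IsOpen V₁ → IsPreconnected V₁ → V₁ ⊆ V →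
    ∀ (m n : ℤ) (γ : ℂ → unitInterval → ℂ), D.IsLoopFamily V₁ q m n γ →
      ∃ ρ : Matrix.SpecialLinearGroup (Fin 2) ℂ, ∀ τ ∈ V₁,
        IsAnalyticContinuation (γ τ) (fun z => Y z τ)
          (fun z => Y (z - (m + n * τ)) τ * (ρ : Matrix (Fin 2) (Fin 2) ℂ))

/-- The system `Y' = Q(z;τ) Y` is monodromy preserving as `τ` deforms in `V`: near every `τ₀ ∈ V`
it has an `M`-invariant fundamental solution. -/
def IsMonodromyPreserving (V : Set ℂ) : Prop :=
  ∀ τ₀ ∈ V, ∃ V₀ : Set ℂ, IsOpen V₀ ∧ τ₀ ∈ V₀ ∧ V₀ ⊆ V ∧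
    ∃ (q : ℂ) (U : Set ℂ), IsOpen U ∧ q ∈ U ∧ U ×ˢ V₀ ⊆ D.regularSet V ∧
      ∃ Y : ℂ → ℂ → Matrix (Fin 2) (Fin 2) ℂ,
        D.IsFundamentalSolution Y U V₀ ∧ D.IsMInvariant Y q V₀

/-- The Pfaffian system `∂Y/∂z = Q Y`, `∂Y/∂τ = Ω Y` is completely integrable on `X`: it has a
fundamental solution near every point of `X`. -/
def IsCompletelyIntegrable (Ω : ℂ → ℂ → Matrix (Fin 2) (Fin 2) ℂ) (X : Set (ℂ × ℂ)) : Prop :=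
  ∀ x₀ ∈ X, ∃ W : Set (ℂ × ℂ), IsOpen W ∧ x₀ ∈ W ∧ W ⊆ X ∧
    ∃ Y : ℂ → ℂ → Matrix (Fin 2) (Fin 2) ℂ, MatHolOn Y W ∧
      ∀ z τ : ℂ, (z, τ) ∈ W → (Y z τ).det ≠ 0 ∧
        (∀ i j, HasDerivAt (fun w => Y w τ i j) ((D.Q z τ * Y z τ) i j) z) ∧
        (∀ i j, HasDerivAt (fun t => Y z t i j) ((Ω z τ * Y z τ) i j) τ)

/-- `f` solves `f''' - 4 I f' - 2 I' f + 2 ∂I/∂τ = 0` on `X`, where `'` is `∂/∂z`. -/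
def SolvesDeformationEquation (f : ℂ → ℂ → ℂ) (X : Set (ℂ × ℂ)) : Prop :=
  ∀ z τ : ℂ, (z, τ) ∈ X →
    iteratedDeriv 3 (fun w => f w τ) z
      - 4 * D.potential z τ * deriv (fun w => f w τ) z
      - 2 * deriv (fun w => D.potential w τ) z * f z τ
      + 2 * deriv (fun t => D.potential z t) τ = 0

end LameData

end GenLame

end

/-! The proof runs in a cycle: constant monodromy gives a function `Ω₁₂`, which gives an integrable
Pfaffian system, which gives constant monodromy. Both equivalences are read off from it.

Constant monodromy to `Ω₁₂`. If `Y` is M-invariant, two branches of `Y` over the same point of the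
torus differ by a matrix independent of `τ`, so `Ω = ∂_τY · Y⁻¹` is single-valued. The period `τ`
itself moves, and the chain rule turns this motion into the quasi-period `-Q`
(`IsBranch.tauCoeff_add`). Equality of mixed partials is the zero-curvature equation `∂_zΩ = ∂_τQ +
QΩ - ΩQ`; eliminating the other entries leaves the third order equation for `Ω₁₂`.

This works only near each `τ₀`, and `Ω` depends on the choice of `Y`, so the local solutions have to
be glued. The potential `I` is even in `z`, hence the odd part of `Ω₁₂` is again a solution with the
same quasi-periods. Two odd local solutions differ by an odd elliptic solution of the symmetric
square equation `f''' = 4 I f' + 2 I' f`, and such an `f` is zero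
(`eq_zero_of_odd_elliptic_solution`). Indeed its exponents at `ω_k/2` are `1`, `-2n_k`, `2n_k + 2`;
the order there is odd, so `n_k ∉ 1/2 + ℤ` leaves only a zero of order one (or `f = 0`). At `±p` the
exponents are `-1, 1, 3`. Therefore `g = f · (℘ - ℘(p))` has at most simple poles, only at periods,
and vanishes at the other two-torsion points. The product `g(z) g(z + 1/2)` is then elliptic without
poles, hence constant, and it vanishes at `τ/2`.

`Ω₁₂` to a Pfaffian system. Zero curvature and trace zero dictate the remaining entries of `Ω` in
terms of `f = Ω₁₂`, and the one remaining condition is the deformation equation. Zero curvature then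
yields local fundamental solutions (`exists_pfaffian_solution`).

Pfaffian system to constant monodromy. Continue a local solution `Y` along a loop ending at `q + m +
nτ`. The continuation and the translate of `Y` to the endpoint solve the same Pfaffian system, since
the quasi-period `-nQ` of `Ω` compensates the motion of the endpoint. They differ by a matrix that
is locally constant in `τ`, hence constant on connected parameter sets (`exists_local_monodromy`).
-/

section

open Set Filter Topology Metric
open GenLame (MatHolOn periods wp wzeta omega IsTwoTorsion LameData)

/-! ### Holomorphic functions of two complex variables. -/

/-- A holomorphic function of two complex variables, in curried form. -/
abbrev HolOn₂ (f : ℂ → ℂ → ℂ) (W : Set (ℂ × ℂ)) : Prop :=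
  DifferentiableOn ℂ (fun x : ℂ × ℂ => f x.1 x.2) W

namespace HolOn₂

variable {f g : ℂ → ℂ → ℂ} {W : Set (ℂ × ℂ)} {a b : ℂ}

theorem swap (hf : HolOn₂ f W) : HolOn₂ (fun s t => f t s) (Prod.swap ⁻¹' W) :=
  DifferentiableOn.comp (g := fun x : ℂ × ℂ => f x.1 x.2) hf
    (f := fun x : ℂ × ℂ => (x.2, x.1)) (by fun_prop) (fun _ hx => hx)

theorem differentiableAt_fst (hf : HolOn₂ f W) (hW : IsOpen W) (h : (a, b) ∈ W) :
    DifferentiableAt ℂ (fun w => f w b) a := by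
  have h1 : DifferentiableAt ℂ (fun x : ℂ × ℂ => f x.1 x.2) (a, b) :=
    hf.differentiableAt (hW.mem_nhds h)
  exact DifferentiableAt.comp (g := fun x : ℂ × ℂ => f x.1 x.2) a h1
    (f := fun w => (w, b)) (by fun_prop)

theorem differentiableAt_snd (hf : HolOn₂ f W) (hW : IsOpen W) (h : (a, b) ∈ W) :
    DifferentiableAt ℂ (fun t => f a t) b := by
  have h1 : DifferentiableAt ℂ (fun x : ℂ × ℂ => f x.1 x.2) (a, b) :=
    hf.differentiableAt (hW.mem_nhds h)
  exact DifferentiableAt.comp (g := fun x : ℂ × ℂ => f x.1 x.2) b h1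
    (f := fun w => (a, w)) (by fun_prop)

end HolOn₂

theorem exists_ball_prod_subset {W : Set (ℂ × ℂ)} (hW : IsOpen W) {a b : ℂ} (h : (a, b) ∈ W) :
    ∃ r > 0, ball a r ×ˢ ball b r ⊆ W := by
  obtain ⟨r, hr, h1⟩ := Metric.isOpen_iff.1 hW _ h
  exact ⟨r, hr, by rwa [ball_prod_same]⟩

/-- This turns joint continuity into the locally uniform convergence of slices that Weierstrass's
convergence theorem needs. -/
theorem tendstoLocallyUniformlyOn_slice {f : ℂ → ℂ → ℂ} {W : Set (ℂ × ℂ)} (hW : IsOpen W)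
    (hf : ContinuousOn (fun x : ℂ × ℂ => f x.1 x.2) W) {a : ℂ} {S : Set ℂ}
    (hS : ∀ t ∈ S, (a, t) ∈ W) :
    TendstoLocallyUniformlyOn (fun w t => f w t) (fun t => f a t) (𝓝 a) S := by
  rw [Metric.tendstoLocallyUniformlyOn_iff]
  intro ε hε t ht
  have hc : ContinuousAt (fun x : ℂ × ℂ => f x.1 x.2) (a, t) :=
    hf.continuousAt (hW.mem_nhds (hS t ht))
  have h1 := Metric.tendsto_nhds.1 hc (ε / 2) (half_pos hε)
  rw [nhds_prod_eq] at h1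
  obtain ⟨p, hp, q, hq, hpq⟩ := eventually_prod_iff.1 h1
  refine ⟨{y | q y}, mem_nhdsWithin_of_mem_nhds hq, ?_⟩
  filter_upwards [hp] with w hw y hy
  have e1 := hpq hw hy
  have e2 := hpq hp.self_of_nhds hy
  simp only at e1 e2
  rw [dist_comm] at e1
  calc dist (f a y) (f w y) ≤ dist (f a y) (f a t) + dist (f a t) (f w y) := dist_triangle _ _ _
    _ < ε := by linarith

/-- The derivative in the second variable is jointly continuous. -/
theorem continuousOn_deriv_snd_of_separately {f : ℂ → ℂ → ℂ} {W : Set (ℂ × ℂ)} (hW : IsOpen W)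
    (hc : ContinuousOn (fun x : ℂ × ℂ => f x.1 x.2) W)
    (h2 : ∀ a b, (a, b) ∈ W → DifferentiableAt ℂ (fun t => f a t) b) :
    ContinuousOn (fun x : ℂ × ℂ => deriv (fun t => f x.1 t) x.2) W := by
  rintro ⟨a, b⟩ hab
  refine ContinuousAt.continuousWithinAt ?_
  obtain ⟨r, hr, hrW⟩ := exists_ball_prod_subset hW hab
  have h3 := tendstoLocallyUniformlyOn_slice hW hc (a := a) (S := ball b r)
    (fun t ht => hrW ⟨mem_ball_self hr, ht⟩)
  have h4 : ∀ᶠ w in 𝓝 a, DifferentiableOn ℂ (fun t => f w t) (ball b r) := by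
    filter_upwards [ball_mem_nhds a hr] with w hw t ht
    exact (h2 w t (hrW ⟨hw, ht⟩)).differentiableWithinAt
  -- Weierstrass: for holomorphic slices, locally uniform convergence passes to the derivatives.
  have h5 := h3.deriv h4 isOpen_ball
  have h6 : DifferentiableOn ℂ (fun t => f a t) (ball b r) := h4.self_of_nhds
  have h7 : ContinuousAt (deriv fun t => f a t) b :=
    ((h6.deriv isOpen_ball).continuousOn).continuousAt (isOpen_ball.mem_nhds (mem_ball_self hr))
  rw [Metric.tendstoLocallyUniformlyOn_iff] at h5
  rw [ContinuousAt, Metric.tendsto_nhds]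
  intro ε hε
  obtain ⟨t, ht, ht'⟩ := h5 (ε / 2) (half_pos hε) b (mem_ball_self hr)
  rw [nhdsWithin_eq_nhds.2 (isOpen_ball.mem_nhds (mem_ball_self hr))] at ht
  have h8 := Metric.tendsto_nhds.1 h7 (ε / 2) (half_pos hε)
  rw [nhds_prod_eq]
  refine (ht'.prod_mk (h8.and ht)).mono ?_
  rintro ⟨w, s⟩ ⟨e1, e2, e3⟩
  have e4 := e1 s e3
  simp only [Function.comp] at e4 e2 ⊢
  rw [dist_comm] at e4
  calc _ ≤ dist (deriv (fun t => f w t) s) (deriv (fun t => f a t) s) +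
        dist (deriv (fun t => f a t) s) (deriv (fun t => f a t) b) := dist_triangle _ _ _
    _ < ε := by linarith

theorem continuousOn_deriv_fst_of_separately {f : ℂ → ℂ → ℂ} {W : Set (ℂ × ℂ)} (hW : IsOpen W)
    (hc : ContinuousOn (fun x : ℂ × ℂ => f x.1 x.2) W)
    (h1 : ∀ a b, (a, b) ∈ W → DifferentiableAt ℂ (fun w => f w b) a) :
    ContinuousOn (fun x : ℂ × ℂ => deriv (fun w => f w x.2) x.1) W := by
  have h := continuousOn_deriv_snd_of_separately (f := fun s t => f t s)
    (W := Prod.swap ⁻¹' W) (hW.preimage continuous_swap)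
    (hc.comp (f := fun x : ℂ × ℂ => (x.2, x.1)) (by fun_prop) (fun _ hx => hx))
    (fun a b hab => h1 b a hab)
  exact h.comp (f := fun x : ℂ × ℂ => (x.2, x.1)) (by fun_prop) (fun _ hx => hx)

/-- **Osgood's lemma** in two variables. -/
theorem HolOn₂.of_separately {f : ℂ → ℂ → ℂ} {W : Set (ℂ × ℂ)} (hW : IsOpen W)
    (hc : ContinuousOn (fun x : ℂ × ℂ => f x.1 x.2) W)
    (h1 : ∀ a b, (a, b) ∈ W → DifferentiableAt ℂ (fun w => f w b) a)
    (h2 : ∀ a b, (a, b) ∈ W → DifferentiableAt ℂ (fun t => f a t) b) : HolOn₂ f W := by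
  rintro ⟨a, b⟩ hab
  refine DifferentiableAt.differentiableWithinAt ?_
  have hn : W ∈ 𝓝 (a, b) := hW.mem_nhds hab
  -- Both partial derivatives exist and are jointly continuous, which suffices for strict
  -- differentiability.
  refine (hasStrictFDerivAt_uncurry_coprod (u := (a, b)) (f := f)
    (f₁ := fun s t => ContinuousLinearMap.toSpanSingleton ℂ (deriv (fun w => f w t) s))
    (f₂ := fun s t => ContinuousLinearMap.toSpanSingleton ℂ (deriv (fun w => f s w) t))
    ?_ ?_ ?_ ?_).hasFDerivAt.differentiableAt
  · filter_upwards [hn] with v hv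
    exact (h1 v.1 v.2 hv).hasDerivAt.hasFDerivAt
  · filter_upwards [hn] with v hv
    exact (h2 v.1 v.2 hv).hasDerivAt.hasFDerivAt
  · exact (ContinuousLinearMap.toSpanSingletonCLE (𝕜 := ℂ) (E := ℂ)).continuous.continuousAt.comp
      ((continuousOn_deriv_fst_of_separately hW hc h1).continuousAt hn)
  · exact (ContinuousLinearMap.toSpanSingletonCLE (𝕜 := ℂ) (E := ℂ)).continuous.continuousAt.comp
      ((continuousOn_deriv_snd_of_separately hW hc h2).continuousAt hn)

/-- The difference quotients in the first variable converge locally uniformly in the second. -/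
theorem HolOn₂.tendstoLocallyUniformlyOn_slope {f : ℂ → ℂ → ℂ} {W : Set (ℂ × ℂ)} (hW : IsOpen W)
    (hf : HolOn₂ f W) {a : ℂ} {S : Set ℂ} (hS : ∀ t ∈ S, (a, t) ∈ W) :
    TendstoLocallyUniformlyOn (fun w t => (w - a)⁻¹ * (f w t - f a t))
      (fun t => deriv (fun w => f w t) a) (𝓝[≠] a) S := by
  have hc := continuousOn_deriv_fst_of_separately hW hf.continuousOn
    (fun a b h => hf.differentiableAt_fst hW h)
  rw [Metric.tendstoLocallyUniformlyOn_iff]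
  intro ε hε t ht
  have hc' : ContinuousAt (fun x : ℂ × ℂ => deriv (fun w => f w x.2) x.1) (a, t) :=
    hc.continuousAt (hW.mem_nhds (hS t ht))
  have h1 := (Metric.tendsto_nhds.1 hc' (ε / 4) (by positivity)).and (hW.mem_nhds (hS t ht))
  obtain ⟨r, hr, h2⟩ := Metric.eventually_nhds_iff_ball.1 h1
  rw [← ball_prod_same] at h2
  refine ⟨ball t r, mem_nhdsWithin_of_mem_nhds (ball_mem_nhds t hr), ?_⟩
  filter_upwards [mem_nhdsWithin_of_mem_nhds (ball_mem_nhds a hr), self_mem_nhdsWithin]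
    with w hw hwa y hy
  have hwa' : w - a ≠ 0 := sub_ne_zero.2 hwa
  have hb : ∀ x ∈ ball a r, ‖deriv (fun w => f w y) x - deriv (fun w => f w y) a‖ ≤ ε / 2 := by
    intro x hx
    have e1 := (h2 (x, y) ⟨hx, hy⟩).1
    have e2 := (h2 (a, y) ⟨mem_ball_self hr, hy⟩).1
    rw [dist_eq_norm] at e1 e2
    calc _ = ‖(deriv (fun w => f w y) x - deriv (fun w => f w t) a) -
          (deriv (fun w => f w y) a - deriv (fun w => f w t) a)‖ := by congr 1; ring
      _ ≤ _ := norm_sub_le _ _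
      _ ≤ ε / 2 := by simp only at e1 e2; linarith
  -- Mean value inequality for the remainder of the linear approximation at `a`; its derivative is
  -- at most `ε / 2`, uniformly in `y`.
  have hmv := (convex_ball a r).norm_image_sub_le_of_norm_hasDerivWithin_le
    (f := fun w => f w y - deriv (fun w => f w y) a * w)
    (f' := fun x => deriv (fun w => f w y) x - deriv (fun w => f w y) a)
    (C := ε / 2) (fun x hx => by
      refine HasDerivAt.hasDerivWithinAt ?_
      have e := (hf.differentiableAt_fst hW (h2 (x, y) ⟨hx, hy⟩).2).hasDerivAt
      simpa using e.fun_sub ((hasDerivAt_id' x).const_mul (deriv (fun w => f w y) a)))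
    hb (mem_ball_self hr) hw
  rw [dist_comm, dist_eq_norm]
  have e3 : (w - a)⁻¹ * (f w y - f a y) - deriv (fun w => f w y) a
      = (w - a)⁻¹ * (f w y - deriv (fun w => f w y) a * w -
        (f a y - deriv (fun w => f w y) a * a)) := by field_simp; ring
  rw [e3, norm_mul, norm_inv]
  have hpos : 0 < ‖w - a‖ := norm_pos_iff.2 hwa'
  calc _ ≤ ‖w - a‖⁻¹ * (ε / 2 * ‖w - a‖) := by gcongr
    _ = ε / 2 := by field_simp
    _ < ε := by linarith

namespace HolOn₂

variable {f g : ℂ → ℂ → ℂ} {W : Set (ℂ × ℂ)} {a b : ℂ}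

/-- The difference quotients in the first variable are holomorphic in the second and converge
locally uniformly. Hence their limit is holomorphic, and differentiation in the second variable
commutes with the limit. -/
theorem slope_aux (hW : IsOpen W) (hf : HolOn₂ f W) (h : (a, b) ∈ W) :
    ∃ r > 0, ball a r ×ˢ ball b r ⊆ W ∧
    TendstoLocallyUniformlyOn (fun w t => (w - a)⁻¹ * (f w t - f a t))
      (fun t => deriv (fun w => f w t) a) (𝓝[≠] a) (ball b r) ∧
    ∀ᶠ w in 𝓝[≠] a, DifferentiableOn ℂ (fun t => (w - a)⁻¹ * (f w t - f a t)) (ball b r) := by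
  obtain ⟨r, hr, hrW⟩ := exists_ball_prod_subset hW h
  refine ⟨r, hr, hrW, hf.tendstoLocallyUniformlyOn_slope hW
    (fun t ht => hrW ⟨mem_ball_self hr, ht⟩), ?_⟩
  filter_upwards [mem_nhdsWithin_of_mem_nhds (ball_mem_nhds a hr)] with w hw t ht
  have e1 := hf.differentiableAt_snd hW (hrW ⟨hw, ht⟩ : (w, t) ∈ W)
  have e2 := hf.differentiableAt_snd hW (hrW ⟨mem_ball_self hr, ht⟩ : (a, t) ∈ W)
  exact ((e1.sub e2).const_mul _).differentiableWithinAt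

/-- A partial derivative of a holomorphic function is holomorphic. -/
theorem deriv_fst (hf : HolOn₂ f W) (hW : IsOpen W) :
    HolOn₂ (fun z τ => deriv (fun w => f w τ) z) W := by
  refine HolOn₂.of_separately hW (continuousOn_deriv_fst_of_separately hW hf.continuousOn
    (fun a b h => hf.differentiableAt_fst hW h)) (fun a b h => ?_) (fun a b h => ?_)
  · obtain ⟨r, hr, hrW⟩ := exists_ball_prod_subset hW h
    have : DifferentiableOn ℂ (fun w => f w b) (ball a r) := fun w hw =>
      (hf.differentiableAt_fst hW (hrW ⟨hw, mem_ball_self hr⟩)).differentiableWithinAt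
    exact (this.deriv isOpen_ball).differentiableAt (ball_mem_nhds a hr)
  · obtain ⟨r, hr, -, h1, h2⟩ := slope_aux hW hf h
    exact (h1.differentiableOn h2 isOpen_ball).differentiableAt (ball_mem_nhds b hr)

theorem deriv_snd (hf : HolOn₂ f W) (hW : IsOpen W) :
    HolOn₂ (fun z τ => deriv (fun t => f z t) τ) W :=
  (hf.swap.deriv_fst (hW.preimage continuous_swap)).swap

/-- The partial derivatives commute. -/
theorem hasDerivAt_fst_deriv_snd (hf : HolOn₂ f W) (hW : IsOpen W) (h : (a, b) ∈ W) :
    HasDerivAt (fun w => deriv (fun t => f w t) b)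
      (deriv (fun t => deriv (fun w => f w t) a) b) a := by
  obtain ⟨r, hr, hrW, h1, h2⟩ := slope_aux hW hf h
  -- The second-variable derivative of a difference quotient is the difference quotient of that
  -- derivative, so this limit is the mixed partial.
  have h3 := (h1.deriv h2 isOpen_ball).tendsto_at (mem_ball_self hr)
  rw [hasDerivAt_iff_tendsto_slope]
  refine h3.congr' ?_
  filter_upwards [mem_nhdsWithin_of_mem_nhds (ball_mem_nhds a hr)] with w hw
  have e1 := hf.differentiableAt_snd hW (hrW ⟨hw, mem_ball_self hr⟩ : (w, b) ∈ W)
  have e2 := hf.differentiableAt_snd hW h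
  simp only [Function.comp, slope, vsub_eq_sub, smul_eq_mul]
  rw [deriv_const_mul _ (e1.fun_sub e2), deriv_fun_sub e1 e2]

theorem mul (hf : HolOn₂ f W) (hg : HolOn₂ g W) : HolOn₂ (fun z τ => f z τ * g z τ) W :=
  DifferentiableOn.mul hf hg

theorem add (hf : HolOn₂ f W) (hg : HolOn₂ g W) : HolOn₂ (fun z τ => f z τ + g z τ) W :=
  DifferentiableOn.add hf hg

/-- Locally uniformly convergent series of holomorphic functions are holomorphic. -/
theorem tsum {ι : Type*} {F : ι → ℂ → ℂ → ℂ} (hW : IsOpen W) (hF : ∀ i, HolOn₂ (F i) W)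
    {u : ι → ℝ} (hu : Summable u) (hb : ∀ i a b, (a, b) ∈ W → ‖F i a b‖ ≤ u i) :
    HolOn₂ (fun z τ => ∑' i, F i z τ) W := by
  refine HolOn₂.of_separately hW
    (continuousOn_tsum (fun i => (hF i).continuousOn) hu (fun i x hx => hb i _ _ hx))
    (fun a b h => ?_) (fun a b h => ?_)
  · obtain ⟨r, hr, hrW⟩ := exists_ball_prod_subset hW h
    refine (Complex.differentiableOn_tsum_of_summable_norm hu (U := ball a r)
      (F := fun i w => F i w b) (fun i w hw => ?_) isOpen_ball (fun i w hw => ?_)).differentiableAt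
      (ball_mem_nhds a hr)
    · exact ((hF i).differentiableAt_fst hW (hrW ⟨hw, mem_ball_self hr⟩)).differentiableWithinAt
    · exact hb i w b (hrW ⟨hw, mem_ball_self hr⟩)
  · obtain ⟨r, hr, hrW⟩ := exists_ball_prod_subset hW h
    refine (Complex.differentiableOn_tsum_of_summable_norm hu (U := ball b r)
      (F := fun i w => F i a w) (fun i w hw => ?_) isOpen_ball (fun i w hw => ?_)).differentiableAt
      (ball_mem_nhds b hr)
    · exact ((hF i).differentiableAt_snd hW (hrW ⟨mem_ball_self hr, hw⟩)).differentiableWithinAt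
    · exact hb i a w (hrW ⟨mem_ball_self hr, hw⟩)

/-- Primitives in the first variable, normalized at a base point, are holomorphic. -/
theorem of_hasDerivAt_fst {G : ℂ → ℂ → ℂ} {z₀ : ℂ} {R : ℝ} {N : Set ℂ} (hN : IsOpen N)
    (hg : HolOn₂ g (ball z₀ R ×ˢ N))
    (hG : ∀ z ∈ ball z₀ R, ∀ τ ∈ N, HasDerivAt (fun w => G w τ) (g z τ) z)
    (h0 : ∀ τ ∈ N, G z₀ τ = 0) : HolOn₂ G (ball z₀ R ×ˢ N) := by
  have hW : IsOpen (ball z₀ R ×ˢ N) := isOpen_ball.prod hN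
  have hR : ∀ z ∈ ball z₀ R, z₀ ∈ ball z₀ R := fun z hz =>
    mem_ball_self (dist_nonneg.trans_lt hz)
  -- A function vanishing at `z₀` is controlled by its derivative. This is used for the continuity
  -- of `G` in `τ` and again for its difference quotients in `τ`.
  have key : ∀ z ∈ ball z₀ R, ∀ (φ ψ : ℂ → ℂ) (C : ℝ),
      (∀ w ∈ closedBall z₀ (dist z z₀), HasDerivAt φ (ψ w) w) →
      (∀ w ∈ closedBall z₀ (dist z z₀), ‖ψ w‖ ≤ C) → φ z₀ = 0 → ‖φ z‖ ≤ C * ‖z - z₀‖ := by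
    intro z hz φ ψ C h1 h2 h3
    simpa [h3] using (convex_closedBall z₀ (dist z z₀)).norm_image_sub_le_of_norm_hasDerivWithin_le
      (fun x hx => (h1 x hx).hasDerivWithinAt) h2
      (mem_closedBall_self dist_nonneg) (mem_closedBall.2 le_rfl)
  have hsub : ∀ z ∈ ball z₀ R, closedBall z₀ (dist z z₀) ⊆ ball z₀ R := fun z hz =>
    closedBall_subset_ball hz
  refine HolOn₂.of_separately hW ?_ (fun a b h => (hG a h.1 b h.2).differentiableAt) ?_
  · rintro ⟨a, b⟩ ⟨ha, hb⟩
    simp only at ha hb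
    refine ContinuousAt.continuousWithinAt ?_
    have hd : ContinuousAt (fun w => G w b) a := (hG a ha b hb).continuousAt
    obtain ⟨R', hR1, hR2⟩ := exists_between (mem_ball.1 ha)
    have hR0 : 0 ≤ R' := dist_nonneg.trans hR1.le
    have hu := tendstoLocallyUniformlyOn_slice (f := fun s t => g t s)
      (W := Prod.swap ⁻¹' (ball z₀ R ×ˢ N)) (hW.preimage continuous_swap) hg.swap.continuousOn
      (a := b) (S := ball z₀ R) (fun t ht => ⟨ht, hb⟩)
    have hu' := (tendstoLocallyUniformlyOn_iff_forall_isCompact isOpen_ball).1 hu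
      (closedBall z₀ R') (closedBall_subset_ball hR2) (isCompact_closedBall _ _)
    rw [Metric.tendstoUniformlyOn_iff] at hu'
    rw [ContinuousAt, Metric.tendsto_nhds]
    intro ε hε
    have e1 := Metric.tendsto_nhds.1 hd (ε / 2) (half_pos hε)
    have e2 := hu' (ε / (2 * (R' + 1))) (by positivity)
    have e3 : ∀ᶠ w in 𝓝 a, w ∈ ball z₀ R' := isOpen_ball.mem_nhds hR1
    rw [nhds_prod_eq]
    refine ((e1.and e3).prod_mk (e2.and (hN.mem_nhds hb))).mono ?_
    rintro ⟨w, t⟩ ⟨⟨k1, k2⟩, k3, k4⟩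
    simp only at k1 k2 k3 k4 ⊢
    have hw : w ∈ ball z₀ R := ball_subset_ball hR2.le k2
    have k5 := key w hw (fun x => G x t - G x b) (fun x => g x t - g x b) (ε / (2 * (R' + 1)))
      (fun x hx => (hG x (hsub w hw hx) t k4).sub (hG x (hsub w hw hx) b hb))
      (fun x hx => by
        have := k3 x (closedBall_subset_closedBall (mem_ball.1 k2).le hx)
        rw [dist_comm, dist_eq_norm] at this
        exact this.le) (by simp [h0 t k4, h0 b hb])
    have k6 : ‖w - z₀‖ ≤ R' := by rw [← dist_eq_norm]; exact (mem_ball.1 k2).le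
    have k7 : ε / (2 * (R' + 1)) * ‖w - z₀‖ ≤ ε / 2 := by
      calc _ ≤ ε / (2 * (R' + 1)) * R' := by gcongr
        _ ≤ ε / (2 * (R' + 1)) * (R' + 1) := by gcongr; linarith
        _ = ε / 2 := by field_simp
    calc _ ≤ dist (G w t) (G w b) + dist (G w b) (G a b) := dist_triangle _ _ _
      _ < ε / 2 + ε / 2 := by
        rw [dist_eq_norm]; exact add_lt_add_of_le_of_lt (k5.trans k7) k1
      _ = ε := by ring
  · rintro a b ⟨ha, hb⟩
    simp only at ha hb
    -- `K` is a primitive of `∂_τ g`; differentiation under the integral sign predicts `∂_τ G(a, b)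
    -- = K a - K z₀`.
    obtain ⟨K, hK⟩ := DifferentiableOn.isExactOn_ball
      (f := fun z => deriv (fun t => g z t) b) (c := z₀) (r := R)
      (fun z hz => ((hg.deriv_snd hW).differentiableAt_fst hW
        (⟨hz, hb⟩ : (z, b) ∈ ball z₀ R ×ˢ N)).differentiableWithinAt)
    have hu := hg.swap.tendstoLocallyUniformlyOn_slope (hW.preimage continuous_swap)
      (a := b) (S := ball z₀ R) (fun t ht => ⟨ht, hb⟩)
    have hu' := (tendstoLocallyUniformlyOn_iff_forall_isCompact isOpen_ball).1 hu
      (closedBall z₀ (dist a z₀)) (hsub a ha) (isCompact_closedBall _ _)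
    rw [Metric.tendstoUniformlyOn_iff] at hu'
    have hd : HasDerivAt (fun t => G a t) (K a - K z₀) b := by
      rw [hasDerivAt_iff_tendsto_slope, Metric.tendsto_nhds]
      intro ε hε
      have e1 := hu' (ε / (dist a z₀ + 1)) (by positivity)
      filter_upwards [e1, mem_nhdsWithin_of_mem_nhds (hN.mem_nhds hb)] with t k1 k2
      have k5 := key a ha (fun x => (t - b)⁻¹ * (G x t - G x b) - (K x - K z₀))
        (fun x => (t - b)⁻¹ * (g x t - g x b) - deriv (fun t => g x t) b) (ε / (dist a z₀ + 1))
        (fun x hx => (((hG x (hsub a ha hx) t k2).sub (hG x (hsub a ha hx) b hb)).const_mul _).sub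
          ((hK x (hsub a ha hx)).sub_const _))
        (fun x hx => by
          have := k1 x hx
          rw [dist_comm, dist_eq_norm] at this
          exact this.le) (by simp [h0 t k2, h0 b hb])
      simp only [slope, vsub_eq_sub, smul_eq_mul, dist_eq_norm] at k5 ⊢
      refine k5.trans_lt ?_
      rw [div_mul_eq_mul_div, div_lt_iff₀ (by positivity)]
      nlinarith
    exact hd.differentiableAt

/-- Existence of holomorphic primitives in the first variable. -/
theorem exists_primitive_fst {z₀ : ℂ} {R : ℝ} {N : Set ℂ} (hN : IsOpen N)
    (hg : HolOn₂ g (ball z₀ R ×ˢ N)) :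
    ∃ G : ℂ → ℂ → ℂ, HolOn₂ G (ball z₀ R ×ˢ N) ∧ (∀ τ ∈ N, G z₀ τ = 0) ∧
      ∀ z ∈ ball z₀ R, ∀ τ ∈ N, HasDerivAt (fun w => G w τ) (g z τ) z := by
  have hW : IsOpen (ball z₀ R ×ˢ N) := isOpen_ball.prod hN
  have h1 : ∀ τ, ∃ φ : ℂ → ℂ, τ ∈ N → φ z₀ = 0 ∧ ∀ z ∈ ball z₀ R, HasDerivAt φ (g z τ) z := by
    intro τ
    by_cases hτ : τ ∈ N
    · obtain ⟨φ, h1, h2⟩ := (DifferentiableOn.isExactOn_ball (f := fun z => g z τ) (c := z₀) (r := R)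
        (fun z hz => (hg.differentiableAt_fst hW
          (⟨hz, hτ⟩ : (z, τ) ∈ ball z₀ R ×ˢ N)).differentiableWithinAt)).with_val_at z₀ 0
      exact ⟨φ, fun _ => ⟨h1, h2⟩⟩
    · exact ⟨0, fun h => absurd h hτ⟩
  choose φ hφ using h1
  have h2 : ∀ z ∈ ball z₀ R, ∀ τ ∈ N, HasDerivAt (fun w => φ τ w) (g z τ) z :=
    fun z hz τ hτ => (hφ τ hτ).2 z hz
  -- The primitives are chosen separately for each `τ`; the normalization at `z₀` alone makes them
  -- holomorphic in `τ`.
  exact ⟨fun z τ => φ τ z, of_hasDerivAt_fst hN hg h2 (fun τ hτ => (hφ τ hτ).1),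
    fun τ hτ => (hφ τ hτ).1, h2⟩

end HolOn₂

theorem eq_of_hasDerivAt_zero_on_ball {f : ℂ → ℂ} {c : ℂ} {r : ℝ}
    (h : ∀ z ∈ ball c r, HasDerivAt f 0 z) {z w : ℂ} (hz : z ∈ ball c r) (hw : w ∈ ball c r) :
    f z = f w := by
  have := (convex_ball c r).norm_image_sub_le_of_norm_hasDerivWithin_le
    (f := f) (f' := fun _ => 0) (C := 0) (fun x hx => (h x hx).hasDerivWithinAt)
    (fun x _ => by simp) hw hz
  rw [zero_mul, norm_le_zero_iff, sub_eq_zero] at this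
  exact this

/-! ### Linear systems depending holomorphically on a parameter. -/

/-- Local solutions of linear systems with holomorphic parameter. -/
theorem exists_linear_solution {M : Fin 2 → Fin 2 → ℂ → ℂ → ℂ} {W : Set (ℂ × ℂ)}
    (hW : IsOpen W) (hM : ∀ i j, HolOn₂ (M i j) W) {z₀ τ₀ : ℂ} (h0 : (z₀, τ₀) ∈ W) :
    ∃ r > 0, ball z₀ r ×ˢ ball τ₀ r ⊆ W ∧ ∀ c : Fin 2 → ℂ, ∃ u : Fin 2 → ℂ → ℂ → ℂ,
      (∀ i, HolOn₂ (u i) (ball z₀ r ×ˢ ball τ₀ r)) ∧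
      (∀ i, ∀ τ ∈ ball τ₀ r, u i z₀ τ = c i) ∧
      ∀ i, ∀ z ∈ ball z₀ r, ∀ τ ∈ ball τ₀ r,
        HasDerivAt (fun w => u i w τ) (∑ j, M i j z τ * u j z τ) z := by
  obtain ⟨K, hK⟩ : ∃ K : ℝ, ∀ i j, ‖M i j z₀ τ₀‖ < K := by
    refine ⟨∑ i, ∑ j, ‖M i j z₀ τ₀‖ + 1, fun i j => ?_⟩
    have h1 : ‖M i j z₀ τ₀‖ ≤ ∑ j, ‖M i j z₀ τ₀‖ :=
      Finset.single_le_sum (f := fun j => ‖M i j z₀ τ₀‖) (fun _ _ => norm_nonneg _)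
        (Finset.mem_univ j)
    have h2 : ∑ j, ‖M i j z₀ τ₀‖ ≤ ∑ i, ∑ j, ‖M i j z₀ τ₀‖ :=
      Finset.single_le_sum (f := fun i => ∑ j, ‖M i j z₀ τ₀‖)
        (fun _ _ => Finset.sum_nonneg fun _ _ => norm_nonneg _) (Finset.mem_univ i)
    linarith
  have hK0 : 0 < K := (norm_nonneg _).trans_lt (hK 0 0)
  have hev : ∀ᶠ x in 𝓝 (z₀, τ₀), x ∈ W ∧ ∀ i j, ‖M i j x.1 x.2‖ < K := by
    have hWn : ∀ᶠ x in 𝓝 (z₀, τ₀), x ∈ W := hW.mem_nhds h0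
    refine hWn.and ?_
    rw [eventually_all]; intro i
    rw [eventually_all]; intro j
    exact ((hM i j).continuousOn.continuousAt (hW.mem_nhds h0)).norm.eventually_lt_const (hK i j)
  obtain ⟨r₁, hr₁, hb⟩ := Metric.eventually_nhds_iff_ball.1 hev
  -- Integrating two terms with coefficients below `K` over a length at most `1 / (4K)` costs a
  -- factor `1/2` per Picard step.
  set r := min r₁ (1 / (4 * K)) with hr
  have hr0 : 0 < r := lt_min hr₁ (by positivity)
  set B := ball z₀ r ×ˢ ball τ₀ r with hB
  have hBo : IsOpen B := isOpen_ball.prod isOpen_ball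
  have hB1 : ∀ x ∈ B, x ∈ W ∧ ∀ i j, ‖M i j x.1 x.2‖ < K := fun x hx => hb x (by
    rw [← ball_prod_same]
    exact ⟨ball_subset_ball (min_le_left _ _) hx.1, ball_subset_ball (min_le_left _ _) hx.2⟩)
  have hMB : ∀ i j, HolOn₂ (M i j) B := fun i j => (hM i j).mono fun x hx => (hB1 x hx).1
  have hz₀ : z₀ ∈ ball z₀ r := mem_ball_self hr0
  refine ⟨r, hr0, fun x hx => (hB1 x hx).1, fun c => ?_⟩
  have step : ∀ u : {u : Fin 2 → ℂ → ℂ → ℂ // ∀ i, HolOn₂ (u i) B},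
      ∃ v : {u : Fin 2 → ℂ → ℂ → ℂ // ∀ i, HolOn₂ (u i) B},
        (∀ i, ∀ τ ∈ ball τ₀ r, v.1 i z₀ τ = 0) ∧ ∀ i, ∀ z ∈ ball z₀ r, ∀ τ ∈ ball τ₀ r,
          HasDerivAt (fun w => v.1 i w τ) (∑ j, M i j z τ * u.1 j z τ) z := by
    rintro ⟨u, hu⟩
    have h1 : ∀ i, HolOn₂ (fun z τ => ∑ j, M i j z τ * u j z τ) B := by
      intro i
      simp only [Fin.sum_univ_two]
      exact ((hMB i 0).mul (hu 0)).add ((hMB i 1).mul (hu 1))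
    choose G hG1 hG2 hG3 using fun i => HolOn₂.exists_primitive_fst isOpen_ball (h1 i)
    exact ⟨⟨G, hG1⟩, hG2, hG3⟩
  choose S hS1 hS2 using step
  -- `D n` is the increment of the Picard iteration: `D 0` is the initial value, and each `D (n +
  -- 1)` integrates `M · D n` from `z₀`. The solution is the sum of the increments.
  let D : ℕ → {u : Fin 2 → ℂ → ℂ → ℂ // ∀ i, HolOn₂ (u i) B} := fun n =>
    Nat.rec ⟨fun i _ _ => c i, fun i => differentiableOn_const _⟩ (fun _ u => S u) n
  have hD0 : ∀ i z τ, (D 0).1 i z τ = c i := fun i z τ => rfl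
  have hDs : ∀ n, D (n + 1) = S (D n) := fun n => rfl
  set C := ‖c‖
  have hbd : ∀ n i, ∀ z ∈ ball z₀ r, ∀ τ ∈ ball τ₀ r, ‖(D n).1 i z τ‖ ≤ C * (1 / 2) ^ n := by
    intro n
    induction n with
    | zero => intro i z _ τ _; simpa [hD0] using norm_le_pi_norm c i
    | succ n ih =>
      intro i z hz τ hτ
      have hmv := (convex_ball z₀ r).norm_image_sub_le_of_norm_hasDerivWithin_le
        (f := fun w => (D (n + 1)).1 i w τ) (f' := fun z => ∑ j, M i j z τ * (D n).1 j z τ)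
        (C := 2 * K * (C * (1 / 2) ^ n))
        (fun x hx => (hS2 (D n) i x hx τ hτ).hasDerivWithinAt) (fun x hx => by
          rw [Fin.sum_univ_two]
          refine (norm_add_le _ _).trans ?_
          rw [norm_mul, norm_mul]
          have a1 := (hB1 (x, τ) ⟨hx, hτ⟩).2
          have a2 : ‖M i 0 x τ‖ * ‖(D n).1 0 x τ‖ ≤ K * (C * (1 / 2) ^ n) :=
            mul_le_mul (a1 i 0).le (ih 0 x hx τ hτ) (norm_nonneg _) hK0.le
          have a3 : ‖M i 1 x τ‖ * ‖(D n).1 1 x τ‖ ≤ K * (C * (1 / 2) ^ n) :=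
            mul_le_mul (a1 i 1).le (ih 1 x hx τ hτ) (norm_nonneg _) hK0.le
          linarith) hz₀ hz
      have e0 : (D (n + 1)).1 i z₀ τ = 0 := hS1 (D n) i τ hτ
      rw [e0, sub_zero] at hmv
      refine hmv.trans ?_
      have hzr : ‖z - z₀‖ ≤ 1 / (4 * K) := by
        rw [← dist_eq_norm]; exact (mem_ball.1 hz).le.trans (min_le_right _ _)
      calc _ ≤ 2 * K * (C * (1 / 2) ^ n) * (1 / (4 * K)) := by gcongr
        _ = C * (1 / 2) ^ (n + 1) := by field_simp; ring
  have hsum : Summable fun n : ℕ => C * (1 / 2 : ℝ) ^ n :=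
    (summable_geometric_of_lt_one (by norm_num) (by norm_num)).mul_left _
  have hDsum : ∀ i, ∀ z ∈ ball z₀ r, ∀ τ ∈ ball τ₀ r, Summable fun n => (D n).1 i z τ :=
    fun i z hz τ hτ => Summable.of_norm_bounded hsum (fun n => hbd n i z hz τ hτ)
  refine ⟨fun i z τ => ∑' n, (D n).1 i z τ, fun i => ?_, fun i τ hτ => ?_, fun i z hz τ hτ => ?_⟩
  · exact HolOn₂.tsum hBo (fun n => (D n).2 i) hsum (fun n a b h => hbd n i a h.1 b h.2)
  · change ∑' n, (D n).1 i z₀ τ = c i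
    rw [tsum_eq_single 0]
    · rfl
    · intro n hn
      obtain ⟨m, rfl⟩ := Nat.exists_eq_succ_of_ne_zero hn
      exact hS1 (D m) i τ hτ
  -- The termwise derivatives: zero for the constant term, then shifted by one index. Summing the
  -- shift gives back `M` times the solution.
  · let g' : ℕ → ℂ → ℂ := fun n x =>
      Nat.casesOn n 0 (fun m => ∑ j, M i j x τ * (D m).1 j x τ)
    have hg'b : ∀ n, ∀ x ∈ ball z₀ r, ‖g' n x‖ ≤ 4 * K * (C * (1 / 2) ^ n) := by
      intro n x hx
      cases n with
      | zero => simp [g']; positivity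
      | succ n =>
        simp only [g', Fin.sum_univ_two]
        refine (norm_add_le _ _).trans ?_
        rw [norm_mul, norm_mul]
        have a1 := (hB1 (x, τ) ⟨hx, hτ⟩).2
        have a2 : ‖M i 0 x τ‖ * ‖(D n).1 0 x τ‖ ≤ K * (C * (1 / 2) ^ n) :=
          mul_le_mul (a1 i 0).le (hbd n 0 x hx τ hτ) (norm_nonneg _) hK0.le
        have a3 : ‖M i 1 x τ‖ * ‖(D n).1 1 x τ‖ ≤ K * (C * (1 / 2) ^ n) :=
          mul_le_mul (a1 i 1).le (hbd n 1 x hx τ hτ) (norm_nonneg _) hK0.le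
        rw [pow_succ]; linarith
    have hd := hasDerivAt_tsum_of_isPreconnected (hsum.mul_left (4 * K)) isOpen_ball
      (convex_ball z₀ r).isPreconnected (g := fun n w => (D n).1 i w τ) (g' := g')
      (fun n x hx => by
        cases n with
        | zero => exact hasDerivAt_const x (c i)
        | succ n => exact hS2 (D n) i x hx τ hτ) hg'b hz₀ (hDsum i z₀ hz₀ τ hτ) hz
    refine hd.congr_deriv ?_
    have hg's : Summable fun n => g' n z :=
      Summable.of_norm_bounded (hsum.mul_left (4 * K)) (fun n => hg'b n z hz)
    rw [hg's.tsum_eq_zero_add]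
    simp only [g', Fin.sum_univ_two]
    rw [Summable.tsum_add ((hDsum 0 z hz τ hτ).mul_left _) ((hDsum 1 z hz τ hτ).mul_left _),
      tsum_mul_left, tsum_mul_left]
    change (0 : ℂ) + _ = _
    rw [zero_add]

namespace GenLame.MatHolOn

variable {F G : ℂ → ℂ → Matrix (Fin 2) (Fin 2) ℂ} {X : Set (ℂ × ℂ)}

theorem mul (hF : MatHolOn F X) (hG : MatHolOn G X) : MatHolOn (fun z τ => F z τ * G z τ) X := by
  intro i j
  simp only [Matrix.mul_apply, Fin.sum_univ_two]
  exact ((hF i 0).mul (hG 0 j)).add ((hF i 1).mul (hG 1 j))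

theorem det (hF : MatHolOn F X) : HolOn₂ (fun z τ => (F z τ).det) X := by
  simp only [Matrix.det_fin_two]
  exact ((hF 0 0).mul (hF 1 1)).sub ((hF 0 1).mul (hF 1 0))

theorem inv (hF : MatHolOn F X) (h : ∀ x ∈ X, (F x.1 x.2).det ≠ 0) :
    MatHolOn (fun z τ => (F z τ)⁻¹) X := by
  intro i j
  have hd : DifferentiableOn ℂ (fun x : ℂ × ℂ => ((F x.1 x.2).det)⁻¹) X := hF.det.inv h
  simp only [Matrix.inv_def, Ring.inverse_eq_inv', Matrix.adjugate_fin_two, Matrix.smul_apply,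
    smul_eq_mul]
  refine hd.mul ?_
  fin_cases i <;> fin_cases j <;> simp
  · exact hF 1 1
  · exact hF 0 1
  · exact hF 1 0
  · exact hF 0 0

theorem mono {X' : Set (ℂ × ℂ)} (hF : MatHolOn F X) (h : X' ⊆ X) : MatHolOn F X' :=
  fun i j => (hF i j).mono h

end GenLame.MatHolOn

theorem hasDerivAt_matrix_mul_const {Y : ℂ → Matrix (Fin 2) (Fin 2) ℂ}
    {Y' : Matrix (Fin 2) (Fin 2) ℂ} {t : ℂ} (hY : ∀ i j, HasDerivAt (fun s => Y s i j) (Y' i j) t)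
    (C : Matrix (Fin 2) (Fin 2) ℂ) (i j : Fin 2) :
    HasDerivAt (fun s => (Y s * C) i j) ((Y' * C) i j) t := by
  simp only [Matrix.mul_apply, Fin.sum_univ_two]
  exact ((hY i 0).mul_const _).add ((hY i 1).mul_const _)

/-- Two solutions of the same linear system differ by a constant matrix. -/
theorem hasDerivAt_inv_mul {Y F : ℂ → Matrix (Fin 2) (Fin 2) ℂ} {N : Matrix (Fin 2) (Fin 2) ℂ}
    {t : ℂ} (hY : ∀ i j, HasDerivAt (fun s => Y s i j) ((N * Y t) i j) t)
    (hF : ∀ i j, HasDerivAt (fun s => F s i j) ((N * F t) i j) t) (hd : (Y t).det ≠ 0)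
    (i j : Fin 2) : HasDerivAt (fun s => ((Y s)⁻¹ * F s) i j) 0 t := by
  have hdet := ((hY 0 0).fun_mul (hY 1 1)).fun_sub ((hY 0 1).fun_mul (hY 1 0))
  have hd' : Y t 0 0 * Y t 1 1 - Y t 0 1 * Y t 1 0 ≠ 0 := by rwa [← Matrix.det_fin_two]
  have hi := hdet.fun_inv hd'
  simp only [Matrix.mul_apply, Fin.sum_univ_two] at hY hF hi
  simp only [Matrix.inv_def, Ring.inverse_eq_inv', Matrix.adjugate_fin_two, Matrix.mul_apply,
    Fin.sum_univ_two, Matrix.det_fin_two, Matrix.smul_apply, smul_eq_mul]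
  fin_cases i <;> simp
  · refine (((hi.fun_mul (hY 1 1)).fun_mul (hF 0 j)).fun_add
      ((hi.fun_mul (hY 0 1)).fun_mul (hF 1 j)).fun_neg).congr_deriv ?_
    field_simp
    ring
  · refine ((((hi.fun_mul (hY 1 0)).fun_mul (hF 0 j))).fun_neg.fun_add
      ((hi.fun_mul (hY 0 0)).fun_mul (hF 1 j))).congr_deriv ?_
    field_simp
    ring

/-- Local fundamental solutions of linear systems with holomorphic parameter. -/
theorem exists_fundamental {M : ℂ → ℂ → Matrix (Fin 2) (Fin 2) ℂ} {W : Set (ℂ × ℂ)}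
    (hW : IsOpen W) (hM : MatHolOn M W) {z₀ τ₀ : ℂ} (h0 : (z₀, τ₀) ∈ W) :
    ∃ r > 0, ball z₀ r ×ˢ ball τ₀ r ⊆ W ∧ ∃ Φ : ℂ → ℂ → Matrix (Fin 2) (Fin 2) ℂ,
      MatHolOn Φ (ball z₀ r ×ˢ ball τ₀ r) ∧ (∀ τ ∈ ball τ₀ r, Φ z₀ τ = 1) ∧
      ∀ z ∈ ball z₀ r, ∀ τ ∈ ball τ₀ r, (Φ z τ).det ≠ 0 ∧
        ∀ i j, HasDerivAt (fun w => Φ w τ i j) ((M z τ * Φ z τ) i j) z := by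
  obtain ⟨r, hr, hrW, hsol⟩ := exists_linear_solution hW (M := fun i j z τ => M z τ i j) hM h0
  choose u hu1 hu2 hu3 using fun j : Fin 2 => hsol (fun i => (1 : Matrix (Fin 2) (Fin 2) ℂ) i j)
  set Φ : ℂ → ℂ → Matrix (Fin 2) (Fin 2) ℂ := fun z τ => Matrix.of fun i j => u j i z τ with hΦ
  have h1 : MatHolOn Φ (ball z₀ r ×ˢ ball τ₀ r) := fun i j => hu1 j i
  have h2 : ∀ τ ∈ ball τ₀ r, Φ z₀ τ = 1 := by
    intro τ hτ
    ext i j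
    exact hu2 j i τ hτ
  have hmem : (z₀, τ₀) ∈ ball z₀ r ×ˢ ball τ₀ r := ⟨mem_ball_self hr, mem_ball_self hr⟩
  -- The determinant is `1` at the centre, hence nonzero on a smaller bidisc.
  have h3 : ∀ᶠ x in 𝓝 (z₀, τ₀), (Φ x.1 x.2).det ≠ 0 := by
    have hc : ContinuousAt (fun x : ℂ × ℂ => (Φ x.1 x.2).det) (z₀, τ₀) :=
      h1.det.continuousOn.continuousAt ((isOpen_ball.prod isOpen_ball).mem_nhds hmem)
    refine hc.eventually_ne ?_
    simp [h2 τ₀ (mem_ball_self hr)]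
  obtain ⟨s, hs, hsb⟩ := Metric.eventually_nhds_iff_ball.1 h3
  rw [← ball_prod_same] at hsb
  have hle : ball z₀ (min r s) ×ˢ ball τ₀ (min r s) ⊆ ball z₀ r ×ˢ ball τ₀ r :=
    prod_mono (ball_subset_ball (min_le_left _ _)) (ball_subset_ball (min_le_left _ _))
  refine ⟨min r s, lt_min hr hs, hle.trans hrW, Φ, h1.mono hle,
    fun τ hτ => h2 τ (ball_subset_ball (min_le_left _ _) hτ), fun z hz τ hτ => ⟨?_, fun i j => ?_⟩⟩
  · exact hsb (z, τ) ⟨ball_subset_ball (min_le_right _ _) hz,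
      ball_subset_ball (min_le_right _ _) hτ⟩
  · have := hu3 j i z (ball_subset_ball (min_le_left _ _) hz) τ
      (ball_subset_ball (min_le_left _ _) hτ)
    simpa [Matrix.mul_apply, hΦ] using this

/-! ### The Weierstrass functions jointly in `z` and `τ`. -/

/-- The period `m + n τ`. -/
noncomputable def latticePoint (p : ℤ × ℤ) (τ : ℂ) : ℂ := p.1 + p.2 * τ

theorem mem_lattice_iff {z τ : ℂ} (hτ : 0 < τ.im) :
    z ∈ (periods τ).lattice ↔ ∃ p : ℤ × ℤ, latticePoint p τ = z := by
  rw [PeriodPair.mem_lattice, (GenLame.periods_of_im_pos hτ).1, (GenLame.periods_of_im_pos hτ).2]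
  simp [latticePoint, Prod.exists]

theorem coe_latticeEquivProd_symm {τ : ℂ} (hτ : 0 < τ.im) (p : ℤ × ℤ) :
    (((periods τ).latticeEquivProd.symm p : (periods τ).lattice) : ℂ) = latticePoint p τ := by
  rw [PeriodPair.latticeEquiv_symm_apply, (GenLame.periods_of_im_pos hτ).1,
    (GenLame.periods_of_im_pos hτ).2, mul_one, latticePoint]

theorem latticePoint_ne_zero {p : ℤ × ℤ} (hp : p ≠ 0) {τ : ℂ} (hτ : 0 < τ.im) :
    latticePoint p τ ≠ 0 := by
  intro h
  have him := congrArg Complex.im h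
  have hre := congrArg Complex.re h
  simp [latticePoint] at him hre
  rcases him with h0 | h0
  · rw [h0] at hre
    simp at hre
    exact hp (Prod.ext hre h0)
  · exact hτ.ne' h0

/-- The summand of the Weierstrass zeta function. -/
noncomputable def zetaTerm (p : ℤ × ℤ) (z τ : ℂ) : ℂ :=
  1 / (z - latticePoint p τ) + 1 / latticePoint p τ + z / latticePoint p τ ^ 2

theorem wzeta_eq_tsum {τ : ℂ} (hτ : 0 < τ.im) (z : ℂ) : wzeta z τ = ∑' p, zetaTerm p z τ := by
  rw [wzeta, ← (periods τ).latticeEquivProd.symm.toEquiv.tsum_eq]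
  refine tsum_congr fun p => ?_
  have h : (((periods τ).latticeEquivProd.symm.toEquiv p : (periods τ).lattice) : ℂ) =
    latticePoint p τ := coe_latticeEquivProd_symm hτ p
  rw [h, zetaTerm]

theorem zetaTerm_differentiableAt {p : ℤ × ℤ} {x : ℂ × ℂ} (h0 : 0 < x.2.im)
    (h : x.1 ≠ latticePoint p x.2) :
    DifferentiableAt ℂ (fun x : ℂ × ℂ => zetaTerm p x.1 x.2) x := by
  have hl : DifferentiableAt ℂ (fun x : ℂ × ℂ => latticePoint p x.2) x := by
    unfold latticePoint; fun_prop
  have h2 : DifferentiableAt ℂ (fun x : ℂ × ℂ => x.1 - latticePoint p x.2) x :=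
    differentiableAt_fst.fun_sub hl
  have h1 : DifferentiableAt ℂ (fun x : ℂ × ℂ => (x.1 - latticePoint p x.2)⁻¹) x :=
    h2.fun_inv (sub_ne_zero.2 h)
  unfold zetaTerm
  simp only [div_eq_mul_inv, one_mul]
  by_cases hp : p = 0
  · subst hp
    simpa [latticePoint] using h1
  · have hne := latticePoint_ne_zero hp h0
    exact (h1.fun_add (hl.fun_inv hne)).fun_add
      (differentiableAt_fst.fun_mul ((hl.fun_pow 2).fun_inv (pow_ne_zero 2 hne)))

/-- With `l` the lattice point, the three fractions combine to `z² / (l² (z - l))`, which decays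
like the cube of `l`. -/
theorem norm_zetaTerm_le {p : ℤ × ℤ} {z τ : ℂ} {R : ℝ} (hz : ‖z‖ < R)
    (h : 2 * R ≤ ‖latticePoint p τ‖) : ‖zetaTerm p z τ‖ ≤ 2 * R ^ 2 / ‖latticePoint p τ‖ ^ 3 := by
  unfold zetaTerm
  set l := latticePoint p τ
  have hR : 0 < R := (norm_nonneg z).trans_lt hz
  have hl0 : 0 < ‖l‖ := by linarith
  have hl : l ≠ 0 := norm_pos_iff.1 hl0
  have h1 : ‖l‖ / 2 ≤ ‖z - l‖ := by
    rw [norm_sub_rev]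
    have := norm_sub_norm_le l z
    linarith
  have hzl : z - l ≠ 0 := norm_pos_iff.1 (by linarith)
  have e : 1 / (z - l) + 1 / l + z / l ^ 2 = z ^ 2 / (l ^ 2 * (z - l)) := by
    field_simp; ring
  rw [e, norm_div, norm_mul, norm_pow, norm_pow]
  calc ‖z‖ ^ 2 / (‖l‖ ^ 2 * ‖z - l‖) ≤ R ^ 2 / (‖l‖ ^ 2 * (‖l‖ / 2)) := by gcongr
    _ = 2 * R ^ 2 / ‖l‖ ^ 3 := by field_simp

/-- Since `|n| Im τ ≤ |m + nτ|`, changing `τ` by less than `Im τ` alters a lattice point by at most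
its own size. One majorant at `τ₀` therefore serves all nearby `τ`. -/
theorem norm_latticePoint_le {p : ℤ × ℤ} {τ₀ τ : ℂ} (h0 : 0 < τ₀.im)
    (h : ‖τ - τ₀‖ < τ₀.im / 2) : ‖latticePoint p τ₀‖ ≤ 2 * ‖latticePoint p τ‖ := by
  have him : τ₀.im / 2 ≤ τ.im := by
    have h1 := (Complex.abs_im_le_norm (τ - τ₀)).trans h.le
    rw [Complex.sub_im, abs_le] at h1
    linarith [h1.1]
  have h2 : |(p.2 : ℝ)| * τ.im ≤ ‖latticePoint p τ‖ := by
    have := Complex.abs_im_le_norm (latticePoint p τ)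
    have e : (latticePoint p τ).im = p.2 * τ.im := by simp [latticePoint]
    rwa [e, abs_mul, abs_of_pos (a := τ.im) (by linarith)] at this
  have e : latticePoint p τ₀ = latticePoint p τ - p.2 * (τ - τ₀) := by simp [latticePoint]; ring
  rw [e]
  refine (norm_sub_le _ _).trans ?_
  have h3 : ‖(p.2 : ℂ) * (τ - τ₀)‖ ≤ |(p.2 : ℝ)| * τ.im := by
    rw [norm_mul, Complex.norm_intCast]
    gcongr
    linarith
  linarith

theorem summable_norm_latticePoint {τ₀ : ℂ} (h0 : 0 < τ₀.im) :
    Summable fun p : ℤ × ℤ => (‖latticePoint p τ₀‖ ^ 3)⁻¹ := by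
  have h1 := ZLattice.summable_norm_zpow (periods τ₀).lattice (-3) (by simp)
  rw [← (periods τ₀).latticeEquivProd.symm.toEquiv.summable_iff] at h1
  refine h1.congr fun p => ?_
  have h : (((periods τ₀).latticeEquivProd.symm.toEquiv p : (periods τ₀).lattice) : ℂ) =
    latticePoint p τ₀ := coe_latticeEquivProd_symm h0 p
  simp only [Function.comp, Submodule.coe_norm, h]
  rw [zpow_neg]; norm_cast

theorem finite_norm_latticePoint_lt {τ₀ : ℂ} (h0 : 0 < τ₀.im) (R : ℝ) :
    {p : ℤ × ℤ | ‖latticePoint p τ₀‖ < R}.Finite := by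
  have h1 := (isCompact_closedBall (0 : (periods τ₀).lattice) R).finite_of_discrete
  refine (h1.preimage ((periods τ₀).latticeEquivProd.symm.injective.injOn)).subset ?_
  intro p hp
  simp only [mem_preimage, mem_closedBall, dist_zero_right, Submodule.coe_norm,
    coe_latticeEquivProd_symm h0]
  exact le_of_lt hp

/-- Near a point that avoids all periods outside `T`, the zeta summands outside `T` are
holomorphic and uniformly summable. -/
theorem exists_zetaTerm_bound {T : Set (ℤ × ℤ)} {z₀ τ₀ : ℂ} (h0 : 0 < τ₀.im)
    (hT : ∀ p ∉ T, z₀ ≠ latticePoint p τ₀) :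
    ∃ r > 0, ∃ u : ℤ × ℤ → ℝ, Summable u ∧ (∀ p, 0 ≤ u p) ∧
      ∀ z ∈ ball z₀ r, ∀ τ ∈ ball τ₀ r, 0 < τ.im ∧
        ∀ p ∉ T, z ≠ latticePoint p τ ∧ ‖zetaTerm p z τ‖ ≤ u p := by
  set R := ‖z₀‖ + 1
  have hR : 0 < R := by positivity
  -- Outside this finite set, lattice points for nearby `τ` have size at least `2R`, as the cubic
  -- estimate requires; inside it, continuity of the single summands suffices.
  set P := {p : ℤ × ℤ | ‖latticePoint p τ₀‖ < 4 * R}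
  have hP : P.Finite := finite_norm_latticePoint_lt h0 _
  have h1 : ∀ᶠ x in 𝓝 (z₀, τ₀), ∀ p ∈ P, p ∉ T → x.1 ≠ latticePoint p x.2 ∧
      ‖zetaTerm p x.1 x.2‖ ≤ ‖zetaTerm p z₀ τ₀‖ + 1 := by
    rw [hP.eventually_all]
    intro p _
    by_cases hpT : p ∈ T
    · simp [hpT]
    · have hc := (zetaTerm_differentiableAt (p := p) (x := (z₀, τ₀)) h0 (hT p hpT)).continuousAt
      have h2 : ∀ᶠ x : ℂ × ℂ in 𝓝 (z₀, τ₀), x.1 ≠ latticePoint p x.2 := by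
        have : ContinuousAt (fun x : ℂ × ℂ => x.1 - latticePoint p x.2) (z₀, τ₀) := by
          unfold latticePoint; fun_prop
        filter_upwards [this.eventually_ne (sub_ne_zero.2 (hT p hpT))] with x hx
        exact sub_ne_zero.1 hx
      filter_upwards [h2, hc.norm.eventually_lt_const (lt_add_one _)] with x k1 k2 _
      exact ⟨k1, k2.le⟩
  have h2 : ∀ᶠ x : ℂ × ℂ in 𝓝 (z₀, τ₀), ‖x.1‖ < R := by
    have : ContinuousAt (fun x : ℂ × ℂ => ‖x.1‖) (z₀, τ₀) := by fun_prop
    exact this.eventually_lt_const (lt_add_one _)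
  have h3 : ∀ᶠ x : ℂ × ℂ in 𝓝 (z₀, τ₀), ‖x.2 - τ₀‖ < τ₀.im / 2 := by
    have : ContinuousAt (fun x : ℂ × ℂ => ‖x.2 - τ₀‖) (z₀, τ₀) := by fun_prop
    exact this.eventually_lt_const (by simpa using h0)
  obtain ⟨r, hr, hb⟩ := Metric.eventually_nhds_iff_ball.1 (h1.and (h2.and h3))
  rw [← ball_prod_same] at hb
  classical
  -- The constant is `16 = 2 · 2³`: the cubic estimate has the factor `2`, and halving the lattice
  -- point costs `2³`.
  refine ⟨r, hr, fun p => 16 * R ^ 2 * (‖latticePoint p τ₀‖ ^ 3)⁻¹ +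
    (if p ∈ P then ‖zetaTerm p z₀ τ₀‖ + 1 else 0), ?_, ?_, ?_⟩
  · refine ((summable_norm_latticePoint h0).mul_left _).add (summable_of_hasFiniteSupport ?_)
    refine hP.subset fun p hp => ?_
    by_contra h
    simp [h] at hp
  · intro p
    dsimp only
    split_ifs <;> positivity
  · intro z hz τ hτ
    obtain ⟨k1, k2, k3⟩ := hb (z, τ) ⟨hz, hτ⟩
    simp only at k1 k2 k3
    refine ⟨?_, fun p hp => ?_⟩
    · have h1 := (Complex.abs_im_le_norm (τ - τ₀)).trans k3.le
      rw [Complex.sub_im, abs_le] at h1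
      linarith [h1.1]
    · by_cases hpP : p ∈ P
      · refine ⟨(k1 p hpP hp).1, (k1 p hpP hp).2.trans ?_⟩
        dsimp only
        rw [if_pos hpP]
        have : 0 ≤ 16 * R ^ 2 * (‖latticePoint p τ₀‖ ^ 3)⁻¹ := by positivity
        linarith
      · have e1 : 4 * R ≤ ‖latticePoint p τ₀‖ := not_lt.1 hpP
        have e2 := norm_latticePoint_le (p := p) h0 k3
        have e3 : 2 * R ≤ ‖latticePoint p τ‖ := by linarith
        have e4 : 0 < ‖latticePoint p τ₀‖ := by linarith
        refine ⟨?_, ?_⟩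
        · rintro rfl
          linarith
        · dsimp only
          rw [if_neg hpP, add_zero]
          refine (norm_zetaTerm_le k2 e3).trans ?_
          calc 2 * R ^ 2 / ‖latticePoint p τ‖ ^ 3
              ≤ 2 * R ^ 2 / (‖latticePoint p τ₀‖ / 2) ^ 3 := by gcongr; linarith
            _ = _ := by field_simp; ring

/-- The pairs `(z, τ)` where `z` is not a period of `E_τ`. -/
def offLattice : Set (ℂ × ℂ) := {x | 0 < x.2.im ∧ x.1 ∉ (periods x.2).lattice}

theorem mem_offLattice_iff {z τ : ℂ} :
    (z, τ) ∈ offLattice ↔ 0 < τ.im ∧ ∀ p, z ≠ latticePoint p τ := by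
  refine and_congr_right fun h => ?_
  simp only [mem_lattice_iff h]
  push Not
  simp only [ne_comm]

theorem isOpen_offLattice : IsOpen offLattice := by
  rw [isOpen_iff_mem_nhds]
  rintro ⟨z, τ⟩ hx
  rw [mem_offLattice_iff] at hx
  obtain ⟨r, hr, u, -, -, h⟩ := exists_zetaTerm_bound (T := ∅) hx.1 (fun p _ => hx.2 p)
  refine mem_of_superset (ball_mem_nhds (z, τ) hr) ?_
  rw [← ball_prod_same]
  rintro ⟨w, t⟩ ⟨hw, ht⟩
  rw [mem_offLattice_iff]
  exact ⟨(h w hw t ht).1, fun p => ((h w hw t ht).2 p (by simp)).1⟩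

theorem holOn₂_wzeta : HolOn₂ wzeta offLattice := by
  rintro ⟨z, τ⟩ hx
  rw [mem_offLattice_iff] at hx
  obtain ⟨r, hr, u, hu, -, h⟩ := exists_zetaTerm_bound (T := ∅) hx.1 (fun p _ => hx.2 p)
  have h1 : HolOn₂ (fun z τ => ∑' p, zetaTerm p z τ) (ball z r ×ˢ ball τ r) := by
    refine HolOn₂.tsum (isOpen_ball.prod isOpen_ball) (fun p x hx => ?_) hu
      (fun p a b hab => ((h a hab.1 b hab.2).2 p (by simp)).2)
    exact (zetaTerm_differentiableAt (h x.1 hx.1 x.2 hx.2).1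
      ((h x.1 hx.1 x.2 hx.2).2 p (by simp)).1).differentiableWithinAt
  have hmem : ball z r ×ˢ ball τ r ∈ 𝓝 (z, τ) :=
    (isOpen_ball.prod isOpen_ball).mem_nhds ⟨mem_ball_self hr, mem_ball_self hr⟩
  refine DifferentiableAt.differentiableWithinAt ?_
  refine (h1.differentiableAt hmem).congr_of_eventuallyEq ?_
  filter_upwards [hmem] with x hx
  exact wzeta_eq_tsum (h x.1 hx.1 x.2 hx.2).1 _

theorem hasDerivAt_wzeta {z τ : ℂ} (hx : (z, τ) ∈ offLattice) :
    HasDerivAt (fun w => wzeta w τ) (-wp z τ) z := by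
  have hd := (holOn₂_wzeta.differentiableAt_fst isOpen_offLattice hx).hasDerivAt
  rw [mem_offLattice_iff] at hx
  obtain ⟨r, hr, u, hu, -, h⟩ := exists_zetaTerm_bound (T := ∅) hx.1 (fun p _ => hx.2 p)
  have hτ := mem_ball_self (x := τ) hr
  have hdt : ∀ p, ∀ w ∈ ball z r, HasDerivAt (fun w => zetaTerm p w τ)
      (-(1 / (w - latticePoint p τ) ^ 2 - 1 / latticePoint p τ ^ 2)) w := by
    intro p w hw
    have hne : w - latticePoint p τ ≠ 0 := sub_ne_zero.2 ((h w hw τ hτ).2 p (by simp)).1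
    have := ((((hasDerivAt_id' w).sub_const (latticePoint p τ)).fun_inv hne).add_const
      (1 / latticePoint p τ)).fun_add ((hasDerivAt_id' w).div_const (latticePoint p τ ^ 2))
    simp only [zetaTerm, one_div] at this ⊢
    refine this.congr_deriv ?_
    rw [neg_div, one_div]
    ring
  have h1 := Complex.hasSum_deriv_of_summable_norm hu (U := ball z r) (z := z)
    (F := fun p w => zetaTerm p w τ)
    (fun p w hw => (hdt p w hw).differentiableAt.differentiableWithinAt) isOpen_ball
    (fun p w hw => ((h w hw τ hτ).2 p (by simp)).2) (mem_ball_self hr)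
  have h2 := ((periods τ).hasSum_weierstrassP z).neg
  rw [← (periods τ).latticeEquivProd.symm.toEquiv.hasSum_iff] at h2
  have h3 : deriv (fun w => ∑' p, zetaTerm p w τ) z = -wp z τ := by
    refine h1.unique (h2.congr_fun ?_)
    intro p
    have h : (((periods τ).latticeEquivProd.symm.toEquiv p : (periods τ).lattice) : ℂ) =
      latticePoint p τ := coe_latticeEquivProd_symm hx.1 p
    simp only [Function.comp, h]
    exact (hdt p z (mem_ball_self hr)).deriv
  have h4 : (fun w => wzeta w τ) = fun w => ∑' p, zetaTerm p w τ :=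
    funext fun w => wzeta_eq_tsum hx.1 w
  rw [← h3, ← h4]
  exact hd

/-- Joint holomorphy is inherited from `ζ` through `℘ = -∂ζ/∂z`, so no second convergence argument
is needed. -/
theorem holOn₂_wp : HolOn₂ wp offLattice := by
  have h := holOn₂_wzeta.deriv_fst isOpen_offLattice
  have h1 : HolOn₂ (fun z τ => -deriv (fun w => wzeta w τ) z) offLattice := h.neg
  refine DifferentiableOn.congr h1 fun x hx => ?_
  simp only [(hasDerivAt_wzeta hx).deriv, neg_neg]

theorem wzeta_neg (z τ : ℂ) : wzeta (-z) τ = -wzeta z τ := by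
  rw [wzeta, wzeta, ← tsum_neg, ← (Equiv.neg (periods τ).lattice).tsum_eq]
  refine tsum_congr fun l => ?_
  simp only [Equiv.neg_apply, NegMemClass.coe_neg, sub_neg_eq_add]
  rw [show -z + (l : ℂ) = -(z - l) by ring]
  simp only [one_div, inv_neg, neg_sq]
  ring

theorem countable_lattice (τ : ℂ) : ((periods τ).lattice : Set ℂ).Countable :=
  countable_of_Lindelof_of_discrete (X := (periods τ).lattice)

/-- The difference `ζ(z + l) - ζ(z)` has derivative zero because `℘` is periodic, and the complement
of the countable lattice is connected. -/
theorem exists_wzeta_add_eq {τ : ℂ} (hτ : 0 < τ.im) {l : ℂ} (hl : l ∈ (periods τ).lattice) :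
    ∃ η : ℂ, ∀ z ∉ (periods τ).lattice, wzeta (z + l) τ = wzeta z τ + η := by
  have hoff : ∀ z ∉ (periods τ).lattice, (z, τ) ∈ offLattice ∧ (z + l, τ) ∈ offLattice := by
    intro z hz
    refine ⟨⟨hτ, hz⟩, hτ, fun h => hz ?_⟩
    simpa using sub_mem h hl
  have hd : ∀ z ∉ (periods τ).lattice,
      HasDerivAt (fun z => wzeta (z + l) τ - wzeta z τ) 0 z := by
    intro z hz
    have h1 := (hasDerivAt_wzeta (hoff z hz).2).comp_add_const z l
    refine (h1.fun_sub (hasDerivAt_wzeta (hoff z hz).1)).congr_deriv ?_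
    have : wp (z + l) τ = wp z τ := (periods τ).weierstrassP_add_coe z ⟨l, hl⟩
    rw [this]; ring
  have hpre : IsPreconnected ((periods τ).lattice : Set ℂ)ᶜ :=
    ((countable_lattice τ).isConnected_compl_of_one_lt_rank (by simp)).2
  have hz0 : (periods τ).ω₁ / 2 ∉ (periods τ).lattice := (periods τ).ω₁_div_two_notMem_lattice
  refine ⟨wzeta ((periods τ).ω₁ / 2 + l) τ - wzeta ((periods τ).ω₁ / 2) τ, fun z hz => ?_⟩
  have h := (periods τ).isClosed_lattice.isOpen_compl.eqOn_of_deriv_eq hpre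
    (f := fun z => wzeta (z + l) τ - wzeta z τ)
    (g := fun _ => wzeta ((periods τ).ω₁ / 2 + l) τ - wzeta ((periods τ).ω₁ / 2) τ)
    (fun z hz => (hd z hz).differentiableAt.differentiableWithinAt) (by fun_prop)
    (fun z hz => by rw [(hd z hz).deriv, deriv_const]) (x := (periods τ).ω₁ / 2) hz0 rfl hz
  simp only at h
  rw [← h]; ring

/-- The zeta function has a simple pole with residue one at every period. -/
theorem exists_wzeta_eq_near {τ : ℂ} (hτ : 0 < τ.im) {l : ℂ} (hl : l ∈ (periods τ).lattice) :
    ∃ R : ℂ → ℂ, AnalyticAt ℂ R l ∧ ∀ z, wzeta z τ = 1 / (z - l) + R z := by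
  obtain ⟨p₀, rfl⟩ := (mem_lattice_iff hτ).1 hl
  obtain ⟨r, hr, u, hu, hu0, h⟩ := exists_zetaTerm_bound (T := {p₀}) (z₀ := latticePoint p₀ τ) hτ
    (fun p hp h => by
      refine latticePoint_ne_zero (p := p₀ - p) (sub_ne_zero.2 (Ne.symm hp)) hτ ?_
      simp only [latticePoint, Prod.fst_sub, Prod.snd_sub] at h ⊢
      push_cast
      linear_combination h)
  classical
  have hτ' := mem_ball_self (x := τ) hr
  have hb : ∀ p, ∀ w ∈ ball (latticePoint p₀ τ) r,
      ‖(if p = p₀ then 0 else zetaTerm p w τ : ℂ)‖ ≤ u p := by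
    intro p w hw
    split_ifs with hp
    · simpa using hu0 p
    · exact ((h w hw τ hτ').2 p hp).2
  have h1 : DifferentiableOn ℂ (fun w => ∑' p, if p = p₀ then 0 else zetaTerm p w τ)
      (ball (latticePoint p₀ τ) r) := by
    refine Complex.differentiableOn_tsum_of_summable_norm hu (fun p w hw => ?_) isOpen_ball hb
    split_ifs with hp
    · exact differentiableWithinAt_const _
    · have h2 := zetaTerm_differentiableAt (x := (w, τ)) hτ ((h w hw τ hτ').2 p hp).1
      exact (DifferentiableAt.comp (g := fun x : ℂ × ℂ => zetaTerm p x.1 x.2) w h2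
        (f := fun w => (w, τ)) (by fun_prop)).differentiableWithinAt
  have h2 : AnalyticAt ℂ (fun w => (∑' p, if p = p₀ then 0 else zetaTerm p w τ) +
      (1 / latticePoint p₀ τ + w / latticePoint p₀ τ ^ 2)) (latticePoint p₀ τ) := by
    refine (h1.analyticAt (ball_mem_nhds _ hr)).add ?_
    fun_prop
  -- The singular quotient also appears in `wzeta`, with value zero at the pole in both places. The
  -- regular part therefore agrees with the analytic series on a full neighbourhood, pole included.
  refine ⟨fun w => wzeta w τ - 1 / (w - latticePoint p₀ τ), h2.congr ?_, fun z => by ring⟩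
  filter_upwards [ball_mem_nhds (latticePoint p₀ τ) hr] with w hw
  have hs : Summable fun p => (if p = p₀ then 0 else zetaTerm p w τ : ℂ) :=
    Summable.of_norm_bounded hu (fun p => hb p w hw)
  have hs' : Summable fun p => (if p = p₀ then zetaTerm p w τ else 0 : ℂ) :=
    summable_of_hasFiniteSupport ((finite_singleton p₀).subset fun p hp => by
      by_contra hne
      simp only [mem_singleton_iff] at hne
      simp [hne] at hp)
  have e : ∑' p, zetaTerm p w τ = (∑' p, if p = p₀ then 0 else zetaTerm p w τ) +
      zetaTerm p₀ w τ := by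
    rw [← tsum_ite_eq p₀ (fun p => zetaTerm p w τ), ← hs.tsum_add hs']
    refine tsum_congr fun p => ?_
    split_ifs <;> simp
  rw [wzeta_eq_tsum hτ, e, zetaTerm]
  ring

/-- The Weierstrass `℘` function has a double pole at every period. -/
theorem exists_wp_eq_near {τ l : ℂ} (hl : l ∈ (periods τ).lattice) :
    ∃ R : ℂ → ℂ, AnalyticAt ℂ R l ∧ ∀ z, wp z τ = 1 / (z - l) ^ 2 + R z := by
  refine ⟨fun z => (periods τ).weierstrassPExcept l z - 1 / l ^ 2,
    ((periods τ).analyticAt_weierstrassPExcept l).sub analyticAt_const, fun z => ?_⟩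
  rw [wp, ← (periods τ).weierstrassPExcept_add ⟨l, hl⟩ z]
  ring

theorem omega_mem_lattice (k : Fin 4) {τ : ℂ} (hτ : 0 < τ.im) :
    omega k τ ∈ (periods τ).lattice := by
  rw [mem_lattice_iff hτ]
  refine ⟨(![0, 1, 0, 1] k, ![0, 0, 1, 1] k), ?_⟩
  fin_cases k <;> simp [latticePoint, omega]

theorem latticePoint_injective {τ : ℂ} (hτ : 0 < τ.im) :
    Function.Injective fun p => latticePoint p τ := by
  intro p q h
  by_contra hne
  refine latticePoint_ne_zero (p := p - q) (sub_ne_zero.2 hne) hτ ?_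
  simp only [latticePoint, Prod.fst_sub, Prod.snd_sub] at h ⊢
  push_cast
  linear_combination h

/-- After doubling, the coordinates of `omega j` and `omega k` agree modulo two, and these parities
separate the four indices. -/
theorem eq_of_sub_half_mem_lattice {j k : Fin 4} {τ : ℂ} (hτ : 0 < τ.im)
    (h : omega j τ / 2 - omega k τ / 2 ∈ (periods τ).lattice) : j = k := by
  obtain ⟨p, hp⟩ := (mem_lattice_iff hτ).1 h
  have e : latticePoint (2 * p.1, 2 * p.2) τ = latticePoint
      (![0, 1, 0, 1] j - ![0, 1, 0, 1] k, ![0, 0, 1, 1] j - ![0, 0, 1, 1] k) τ := by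
    have h1 : ∀ k, omega k τ = latticePoint (![0, 1, 0, 1] k, ![0, 0, 1, 1] k) τ := by
      intro k
      fin_cases k <;> simp [latticePoint, omega]
    rw [h1, h1] at hp
    simp only [latticePoint] at hp ⊢
    push_cast
    linear_combination 2 * hp
  have e2 := latticePoint_injective hτ e
  simp only [Prod.mk.injEq] at e2
  fin_cases j <;> fin_cases k <;> simp at e2 ⊢ <;> omega

theorem HolOn₂.comp_add {f : ℂ → ℂ → ℂ} {W X : Set (ℂ × ℂ)} {V : Set ℂ} {g : ℂ → ℂ}
    (hf : HolOn₂ f W) (hg : DifferentiableOn ℂ g V) (hV : ∀ x ∈ X, x.2 ∈ V)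
    (hX : ∀ x ∈ X, (x.1 + g x.2, x.2) ∈ W) : HolOn₂ (fun z τ => f (z + g τ) τ) X := by
  refine DifferentiableOn.comp (g := fun x : ℂ × ℂ => f x.1 x.2) hf
    (f := fun x : ℂ × ℂ => (x.1 + g x.2, x.2)) ?_ hX
  have : DifferentiableOn ℂ (fun x : ℂ × ℂ => g x.2) X := hg.comp differentiableOn_snd hV
  exact (differentiableOn_fst.add this).prodMk differentiableOn_snd

theorem differentiableOn_omega (k : Fin 4) {V : Set ℂ} :
    DifferentiableOn ℂ (fun τ => omega k τ / 2) V := by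
  fin_cases k <;> simp [omega] <;> fun_prop

theorem wp_analyticAt {τ c : ℂ} (h : c ∉ (periods τ).lattice) :
    AnalyticAt ℂ (fun z => wp z τ) c :=
  (periods τ).analyticOnNhd_weierstrassP c h

theorem wzeta_analyticAt {τ c : ℂ} (hτ : 0 < τ.im) (h : c ∉ (periods τ).lattice) :
    AnalyticAt ℂ (fun z => wzeta z τ) c := by
  refine DifferentiableOn.analyticAt (s := ((periods τ).lattice : Set ℂ)ᶜ)
    (fun z hz => ?_) ((periods τ).isClosed_lattice.isOpen_compl.mem_nhds h)
  exact (hasDerivAt_wzeta (⟨hτ, hz⟩ : (z, τ) ∈ offLattice)).differentiableAt.differentiableWithinAt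

/-! ### The singular points and the local form of the potential. -/

namespace GenLame.LameData

variable (D : LameData) {V : Set ℂ} {z τ : ℂ}

theorem isTwoTorsion_iff (hτ : 0 < τ.im) :
    IsTwoTorsion z τ ↔ ∃ k, z + omega k τ / 2 ∈ (periods τ).lattice := by
  refine exists_congr fun k => ?_
  have e : z + omega k τ / 2 = z - omega k τ / 2 + omega k τ := by ring
  rw [e, Submodule.add_mem_iff_left _ (omega_mem_lattice k hτ)]

theorem isTwoTorsion_of_two_mul_mem (hτ : 0 < τ.im) (h : 2 * z ∈ (periods τ).lattice) :
    IsTwoTorsion z τ := by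
  obtain ⟨⟨m, n⟩, hp⟩ := (mem_lattice_iff hτ).1 h
  have key : ∀ (k : Fin 4) (a b : ℤ), z - omega k τ / 2 = a + b * τ → IsTwoTorsion z τ :=
    fun k a b e => ⟨k, by rw [e]; exact (mem_lattice_iff hτ).2 ⟨(a, b), rfl⟩⟩
  simp only [latticePoint] at hp
  obtain ⟨a, rfl | rfl⟩ := Int.even_or_odd' m <;> obtain ⟨b, rfl | rfl⟩ := Int.even_or_odd' n <;>
    push_cast at hp
  · exact key 0 a b (by simp [omega]; linear_combination -hp / 2)
  · exact key 2 a b (by simp [omega]; linear_combination -hp / 2)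
  · exact key 1 a b (by simp [omega]; linear_combination -hp / 2)
  · exact key 3 a b (by simp [omega]; linear_combination -hp / 2)

theorem not_isSingular_iff (hτ : 0 < τ.im) : ¬ D.IsSingular z τ ↔
    (∀ k, (z + omega k τ / 2, τ) ∈ offLattice) ∧ (z + D.p τ, τ) ∈ offLattice ∧
      (z + -D.p τ, τ) ∈ offLattice := by
  simp only [IsSingular, isTwoTorsion_iff hτ, offLattice, mem_ofPred_eq, hτ, true_and,
    ← sub_eq_add_neg]
  push Not
  tauto

theorem isSingular_add_iff {l : ℂ} (hl : l ∈ (periods τ).lattice) :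
    D.IsSingular (z + l) τ ↔ D.IsSingular z τ := by
  have h : ∀ a, z + l - a ∈ (periods τ).lattice ↔ z - a ∈ (periods τ).lattice := fun a => by
    rw [show z + l - a = z - a + l by ring, Submodule.add_mem_iff_left _ hl]
  have h2 := h (-D.p τ)
  simp only [sub_neg_eq_add] at h2
  simp only [IsSingular, IsTwoTorsion, h, h2]

theorem isTwoTorsion_neg (hτ : 0 < τ.im) : IsTwoTorsion (-z) τ ↔ IsTwoTorsion z τ := by
  rw [isTwoTorsion_iff hτ]
  refine exists_congr fun k => ?_
  rw [← Submodule.neg_mem_iff, show -(-z + omega k τ / 2) = z - omega k τ / 2 by ring]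

theorem isSingular_neg_iff (hτ : 0 < τ.im) : D.IsSingular (-z) τ ↔ D.IsSingular z τ := by
  simp only [IsSingular, isTwoTorsion_neg hτ]
  rw [← Submodule.neg_mem_iff _ (x := -z - D.p τ), ← Submodule.neg_mem_iff _ (x := -z + D.p τ),
    show -(-z - D.p τ) = z + D.p τ by ring, show -(-z + D.p τ) = z - D.p τ by ring,
    or_comm (a := z + D.p τ ∈ _)]

theorem one_mem_lattice (τ : ℂ) : (1 : ℂ) ∈ (periods τ).lattice :=
  (periods τ).ω₁_mem_lattice

theorem self_mem_lattice (hτ : 0 < τ.im) : τ ∈ (periods τ).lattice := by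
  have := (periods τ).ω₂_mem_lattice
  rwa [(periods_of_im_pos hτ).2] at this

theorem int_add_int_mul_mem_lattice (hτ : 0 < τ.im) (m n : ℤ) :
    (m : ℂ) + n * τ ∈ (periods τ).lattice :=
  (mem_lattice_iff hτ).2 ⟨(m, n), rfl⟩

theorem wp_add {l : ℂ} (hl : l ∈ (periods τ).lattice) (z : ℂ) : wp (z + l) τ = wp z τ :=
  (periods τ).weierstrassP_add_coe z ⟨l, hl⟩

theorem wp_neg (z τ : ℂ) : wp (-z) τ = wp z τ := (periods τ).weierstrassP_neg z

/-- Each `ω_k` is a period, so each of the four shifted `℘` terms is even; the two `p` terms are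
interchanged, and since `ζ` is odd its difference is even as well. -/
theorem potential_neg (hτ : 0 < τ.im) (z : ℂ) : D.potential (-z) τ = D.potential z τ := by
  have h1 : ∀ k, wp (-z + omega k τ / 2) τ = wp (z + omega k τ / 2) τ := fun k => by
    rw [← wp_neg (z + _), ← wp_add (omega_mem_lattice k hτ) (-(z + _))]
    congr 1; ring
  have h2 : wp (-z + D.p τ) τ = wp (z - D.p τ) τ := by rw [← wp_neg]; congr 1; ring
  have h3 : wp (-z - D.p τ) τ = wp (z + D.p τ) τ := by rw [← wp_neg]; congr 1; ring
  have h4 : wzeta (-z + D.p τ) τ = -wzeta (z - D.p τ) τ := by rw [← wzeta_neg]; congr 1; ring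
  have h5 : wzeta (-z - D.p τ) τ = -wzeta (z + D.p τ) τ := by rw [← wzeta_neg]; congr 1; ring
  simp only [potential, h1, h2, h3, h4, h5]
  ring

/-- The quasi-period of `ζ` cancels in the difference `ζ(z + p) - ζ(z - p)`. -/
theorem potential_add {l : ℂ} (hτ : 0 < τ.im) (hl : l ∈ (periods τ).lattice)
    (hz : ¬ D.IsSingular z τ) : D.potential (z + l) τ = D.potential z τ := by
  rw [not_isSingular_iff D hτ] at hz
  obtain ⟨η, hη⟩ := exists_wzeta_add_eq hτ hl
  have h1 : ∀ a, wp (z + l + a) τ = wp (z + a) τ := fun a => by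
    rw [← wp_add hl (z + a)]; congr 1; ring
  have h2 : wzeta (z + l + D.p τ) τ = wzeta (z + D.p τ) τ + η := by
    rw [← hη _ hz.2.1.2]; congr 1; ring
  have h3 : wzeta (z + l - D.p τ) τ = wzeta (z - D.p τ) τ + η := by
    rw [sub_eq_add_neg z, ← hη _ hz.2.2.2]; congr 1; ring
  have h4 : wp (z + l - D.p τ) τ = wp (z - D.p τ) τ := by
    rw [sub_eq_add_neg, h1, ← sub_eq_add_neg]
  simp only [potential, h1, h2, h3, h4]
  ring

theorem mem_regularSet (hV : ∀ τ ∈ V, 0 < τ.im) : (z, τ) ∈ D.regularSet V ↔ τ ∈ V ∧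
    (∀ k, (z + omega k τ / 2, τ) ∈ offLattice) ∧ (z + D.p τ, τ) ∈ offLattice ∧
      (z + -D.p τ, τ) ∈ offLattice := by
  refine and_congr_right fun h => ?_
  exact not_isSingular_iff D (hV τ h)

theorem isOpen_regularSet (hV : IsOpen V) (hVH : ∀ τ ∈ V, 0 < τ.im)
    (hp : DifferentiableOn ℂ D.p V) : IsOpen (D.regularSet V) := by
  have key : ∀ g : ℂ → ℂ, DifferentiableOn ℂ g V → ∀ x : ℂ × ℂ, x.2 ∈ V →
      (x.1 + g x.2, x.2) ∈ offLattice → ∀ᶠ y : ℂ × ℂ in 𝓝 x, (y.1 + g y.2, y.2) ∈ offLattice := by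
    intro g hg x hx h
    have h1 : ContinuousAt (fun y : ℂ × ℂ => g y.2) x :=
      ContinuousAt.comp (g := g) (f := fun y : ℂ × ℂ => y.2)
        (hg.differentiableAt (hV.mem_nhds hx)).continuousAt continuousAt_snd
    have h2 : ContinuousAt (fun y : ℂ × ℂ => (y.1 + g y.2, y.2)) x :=
      (continuousAt_fst.add h1).prodMk continuousAt_snd
    exact h2.eventually (isOpen_offLattice.mem_nhds h)
  rw [isOpen_iff_mem_nhds]
  rintro ⟨z, τ⟩ hx
  rw [mem_regularSet D hVH] at hx
  have h1 : ∀ᶠ y : ℂ × ℂ in 𝓝 (z, τ), y.2 ∈ V :=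
    continuousAt_snd.eventually (hV.mem_nhds hx.1)
  have h2 : ∀ᶠ y : ℂ × ℂ in 𝓝 (z, τ), ∀ k, (y.1 + omega k y.2 / 2, y.2) ∈ offLattice :=
    eventually_all.2 fun k => key _ (differentiableOn_omega k) (z, τ) hx.1 (hx.2.1 k)
  filter_upwards [h1, h2, key _ hp (z, τ) hx.1 hx.2.2.1,
    key _ hp.neg (z, τ) hx.1 hx.2.2.2] with y k1 k2 k3 k4
  exact (mem_regularSet D hVH).2 ⟨k1, k2, k3, k4⟩

theorem holOn₂_potential (hVH : ∀ τ ∈ V, 0 < τ.im)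
    (hp : DifferentiableOn ℂ D.p V) (hA : DifferentiableOn ℂ D.A V)
    (hB : DifferentiableOn ℂ D.B V) : HolOn₂ D.potential (D.regularSet V) := by
  have hX : ∀ x ∈ D.regularSet V, x.2 ∈ V := fun x hx => hx.1
  have hm : ∀ x ∈ D.regularSet V, _ := fun x hx => ((mem_regularSet D hVH).1 hx).2
  have h1 : ∀ k, HolOn₂ (fun z τ => wp (z + omega k τ / 2) τ) (D.regularSet V) := fun k =>
    holOn₂_wp.comp_add (g := fun τ => omega k τ / 2) (differentiableOn_omega k) hX
      fun x hx => (hm x hx).1 k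
  have h2 := holOn₂_wp.comp_add hp hX fun x hx => (hm x hx).2.1
  have h3 := holOn₂_wp.comp_add hp.neg hX fun x hx => (hm x hx).2.2
  have h4 := holOn₂_wzeta.comp_add hp hX fun x hx => (hm x hx).2.1
  have h5 := holOn₂_wzeta.comp_add hp.neg hX fun x hx => (hm x hx).2.2
  have hA' : DifferentiableOn ℂ (fun x : ℂ × ℂ => D.A x.2) (D.regularSet V) :=
    hA.comp differentiableOn_snd hX
  have hB' : DifferentiableOn ℂ (fun x : ℂ × ℂ => D.B x.2) (D.regularSet V) :=
    hB.comp differentiableOn_snd hX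
  simp only [Pi.neg_apply, ← sub_eq_add_neg] at h3 h5
  have h6 : DifferentiableOn ℂ (fun x : ℂ × ℂ => ∑ k : Fin 4, D.n k * (D.n k + 1) *
      wp (x.1 + omega k x.2 / 2) x.2) (D.regularSet V) :=
    DifferentiableOn.fun_sum fun k _ => (h1 k).const_mul _
  exact ((h6.fun_add ((h2.fun_add h3).const_mul _)).fun_add
    (hA'.fun_mul (h4.fun_sub h5))).fun_add hB'

theorem holOn_Q (hVH : ∀ τ ∈ V, 0 < τ.im)
    (hp : DifferentiableOn ℂ D.p V) (hA : DifferentiableOn ℂ D.A V)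
    (hB : DifferentiableOn ℂ D.B V) : MatHolOn D.Q (D.regularSet V) := by
  intro i j
  fin_cases i <;> fin_cases j <;> simp [Q]
  exact holOn₂_potential D hVH hp hA hB

theorem countable_isSingular (τ : ℂ) : {z | D.IsSingular z τ}.Countable := by
  have h : ∀ a : ℂ, {z | z - a ∈ (periods τ).lattice}.Countable := fun a =>
    (countable_lattice τ).preimage (sub_left_injective (b := a))
  have h2 : {z | z + D.p τ ∈ (periods τ).lattice}.Countable := by
    simpa using h (-D.p τ)
  have e : {z | D.IsSingular z τ} = (⋃ k, {z | z - omega k τ / 2 ∈ (periods τ).lattice}) ∪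
      ({z | z - D.p τ ∈ (periods τ).lattice} ∪ {z | z + D.p τ ∈ (periods τ).lattice}) := by
    ext z
    simp [IsSingular, IsTwoTorsion]
  rw [e]
  exact (countable_iUnion fun k => h _).union ((h _).union h2)

/-- Local expansion of the potential at its poles. -/
theorem exists_potential_eq_near (hτ : 0 < τ.im) (hp2 : ¬ IsTwoTorsion (D.p τ) τ) {c : ℂ}
    (hc : D.IsSingular c τ) : ∃ (α β : ℂ) (R : ℂ → ℂ), AnalyticAt ℂ R c ∧
      (∀ z, D.potential z τ = α / (z - c) ^ 2 + β / (z - c) + R z) ∧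
      (IsTwoTorsion c τ → ∃ k, α = D.n k * (D.n k + 1)) ∧ (¬ IsTwoTorsion c τ → α = 3 / 4) := by
  have hw : ∀ a, c + a ∉ (periods τ).lattice → AnalyticAt ℂ (fun z => wp (z + a) τ) c :=
    fun a h => AnalyticAt.fun_comp (g := fun z => wp z τ) (wp_analyticAt h) (by fun_prop)
  have hz : ∀ a, c + a ∉ (periods τ).lattice → AnalyticAt ℂ (fun z => wzeta (z + a) τ) c :=
    fun a h => AnalyticAt.fun_comp (g := fun z => wzeta z τ) (wzeta_analyticAt hτ h) (by fun_prop)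
  have hw' : ∀ a, c + a ∈ (periods τ).lattice → ∃ R : ℂ → ℂ, AnalyticAt ℂ R c ∧
      ∀ z, wp (z + a) τ = 1 / (z - c) ^ 2 + R z := fun a h => by
    obtain ⟨R, hR, hR'⟩ := exists_wp_eq_near h
    refine ⟨fun z => R (z + a), AnalyticAt.fun_comp (g := R) hR (by fun_prop), fun z => ?_⟩
    rw [hR', show z + a - (c + a) = z - c by ring]
  have hz' : ∀ a, c + a ∈ (periods τ).lattice → ∃ R : ℂ → ℂ, AnalyticAt ℂ R c ∧
      ∀ z, wzeta (z + a) τ = 1 / (z - c) + R z := fun a h => by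
    obtain ⟨R, hR, hR'⟩ := exists_wzeta_eq_near hτ h
    refine ⟨fun z => R (z + a), AnalyticAt.fun_comp (g := R) hR (by fun_prop), fun z => ?_⟩
    rw [hR', show z + a - (c + a) = z - c by ring]
  have hpot : ∀ z, D.potential z τ = (∑ k : Fin 4, D.n k * (D.n k + 1) * wp (z + omega k τ / 2) τ)
    + 3 / 4 * (wp (z + D.p τ) τ + wp (z + -D.p τ) τ)
    + D.A τ * (wzeta (z + D.p τ) τ - wzeta (z + -D.p τ) τ) + D.B τ := fun z => by
    simp only [potential, ← sub_eq_add_neg]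
  -- The points `p` and `-p` are distinct on the torus because `2p` is not a period, so at most one
  -- of the two poles sits at `c`.
  have h2p : ¬ (c + D.p τ ∈ (periods τ).lattice ∧ c + -D.p τ ∈ (periods τ).lattice) := by
    rintro ⟨h1, h2⟩
    refine hp2 (isTwoTorsion_of_two_mul_mem hτ ?_)
    rw [show 2 * D.p τ = c + D.p τ - (c + -D.p τ) by ring]
    exact sub_mem h1 h2
  by_cases hct : IsTwoTorsion c τ
  · obtain ⟨k, hk⟩ := (isTwoTorsion_iff hτ).1 hct
    have hj : ∀ j, j ≠ k → c + omega j τ / 2 ∉ (periods τ).lattice := fun j hj h => hj <|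
      eq_of_sub_half_mem_lattice hτ (by
        rw [show omega j τ / 2 - omega k τ / 2 = c + omega j τ / 2 - (c + omega k τ / 2) by ring]
        exact sub_mem h hk)
    have hp1 : c + D.p τ ∉ (periods τ).lattice := fun h => hp2 <| by
      refine ⟨k, ?_⟩
      rw [show D.p τ - omega k τ / 2 = c + D.p τ - (c + omega k τ / 2) by ring]
      exact sub_mem h hk
    have hp1' : c + -D.p τ ∉ (periods τ).lattice := fun h => hp2 <| by
      refine (isTwoTorsion_iff hτ).2 ⟨k, ?_⟩
      rw [show D.p τ + omega k τ / 2 = (c + omega k τ / 2) - (c + -D.p τ) by ring]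
      exact sub_mem hk h
    obtain ⟨R, hR, hR'⟩ := hw' _ hk
    -- Only the `k`-th summand is singular here, and `℘` has no residue.
    refine ⟨D.n k * (D.n k + 1), 0, fun z => D.n k * (D.n k + 1) * R z +
      (∑ j ∈ Finset.univ.erase k, D.n j * (D.n j + 1) * wp (z + omega j τ / 2) τ)
      + 3 / 4 * (wp (z + D.p τ) τ + wp (z + -D.p τ) τ)
      + D.A τ * (wzeta (z + D.p τ) τ - wzeta (z + -D.p τ) τ) + D.B τ, ?_, fun z => ?_,
      fun _ => ⟨k, rfl⟩, fun h => absurd hct h⟩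
    · have hs : AnalyticAt ℂ (fun z => ∑ j ∈ Finset.univ.erase k,
          D.n j * (D.n j + 1) * wp (z + omega j τ / 2) τ) c :=
        Finset.analyticAt_fun_sum _ fun j hj' =>
          analyticAt_const.fun_mul (hw _ (hj j (Finset.ne_of_mem_erase hj')))
      exact ((((analyticAt_const.fun_mul hR).fun_add hs).fun_add
        (analyticAt_const.fun_mul ((hw _ hp1).fun_add (hw _ hp1')))).fun_add
        (analyticAt_const.fun_mul ((hz _ hp1).fun_sub (hz _ hp1')))).fun_add analyticAt_const
    · rw [hpot, ← Finset.add_sum_erase _ _ (Finset.mem_univ k), hR']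
      ring
  · have hk : ∀ k, c + omega k τ / 2 ∉ (periods τ).lattice := fun k hk =>
      hct ((isTwoTorsion_iff hτ).2 ⟨k, hk⟩)
    have hs : AnalyticAt ℂ (fun z => ∑ j : Fin 4,
        D.n j * (D.n j + 1) * wp (z + omega j τ / 2) τ) c :=
      Finset.analyticAt_fun_sum _ fun j _ => analyticAt_const.fun_mul (hw _ (hk j))
    rcases hc.resolve_left hct with h | h
    · rw [sub_eq_add_neg] at h
      have h' : c + D.p τ ∉ (periods τ).lattice := fun h' => h2p ⟨h', h⟩
      obtain ⟨R, hR, hR'⟩ := hw' _ h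
      obtain ⟨S, hS, hS'⟩ := hz' _ h
      -- At `c ≡ p` the singular zeta term is the subtracted one, hence the residue `-A`; at `c ≡
      -- -p` it is `A`.
      refine ⟨3 / 4, -D.A τ, fun z => (∑ j : Fin 4, D.n j * (D.n j + 1) * wp (z + omega j τ / 2) τ)
        + 3 / 4 * (wp (z + D.p τ) τ + R z) + D.A τ * (wzeta (z + D.p τ) τ - S z) + D.B τ,
        ?_, fun z => ?_, fun h => absurd h hct, fun _ => rfl⟩
      · exact ((hs.fun_add (analyticAt_const.fun_mul ((hw _ h').fun_add hR))).fun_add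
          (analyticAt_const.fun_mul ((hz _ h').fun_sub hS))).fun_add analyticAt_const
      · rw [hpot, hR', hS']; ring
    · have h' : c + -D.p τ ∉ (periods τ).lattice := fun h' => h2p ⟨h, h'⟩
      obtain ⟨R, hR, hR'⟩ := hw' _ h
      obtain ⟨S, hS, hS'⟩ := hz' _ h
      refine ⟨3 / 4, D.A τ, fun z => (∑ j : Fin 4, D.n j * (D.n j + 1) * wp (z + omega j τ / 2) τ)
        + 3 / 4 * (R z + wp (z + -D.p τ) τ) + D.A τ * (S z - wzeta (z + -D.p τ) τ) + D.B τ,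
        ?_, fun z => ?_, fun h => absurd h hct, fun _ => rfl⟩
      · exact ((hs.fun_add (analyticAt_const.fun_mul (hR.fun_add (hw _ h')))).fun_add
          (analyticAt_const.fun_mul (hS.fun_sub (hz _ h')))).fun_add analyticAt_const
      · rw [hpot, hR', hS']; ring

end GenLame.LameData

/-! ### Regular singular points of third order equations. -/

/-- Solutions of a third order equation with a regular singular point are bounded by a power of
the distance to the singular point along every ray. -/
theorem norm_pow_mul_le_of_fuchsian {f f₁ f₂ f₃ J L : ℂ → ℂ} {c : ℂ} {ρ K : ℝ} (hρ : 0 < ρ)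
    (h0 : ∀ z ∈ ball c ρ \ {c}, HasDerivAt f (f₁ z) z)
    (h1 : ∀ z ∈ ball c ρ \ {c}, HasDerivAt f₁ (f₂ z) z)
    (h2 : ∀ z ∈ ball c ρ \ {c}, HasDerivAt f₂ (f₃ z) z)
    (hJ : ∀ z ∈ ball c ρ \ {c}, ‖J z‖ ≤ K) (hL : ∀ z ∈ ball c ρ \ {c}, ‖L z‖ ≤ K)
    (heq : ∀ z ∈ ball c ρ \ {c}, (z - c) ^ 3 * f₃ z = J z * ((z - c) * f₁ z) + L z * f z) :
    ∃ (N : ℕ) (C : ℝ), ∀ z ∈ ball c (ρ / 2) \ {c}, ‖(z - c) ^ N * f z‖ ≤ C := by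
  set r := ρ / 2
  have hr : 0 < r := half_pos hρ
  have hrρ : r < ρ := half_lt_self hρ
  have hK : 0 ≤ K := (norm_nonneg _).trans (hJ (c + r) ⟨by simp [abs_of_pos hr, hrρ], by simp [hr.ne']⟩)
  have hsph : ∀ z ∈ sphere c r, z ∈ ball c ρ \ {c} := fun z hz => by
    refine ⟨sphere_subset_closedBall.trans (closedBall_subset_ball hrρ) hz, ?_⟩
    rintro rfl
    simp [hr.ne] at hz
  have hcont : ContinuousOn (fun z => ((f z, (z - c) * f₁ z, (z - c) ^ 2 * f₂ z) : ℂ × ℂ × ℂ))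
      (sphere c r) := fun z hz =>
    ((h0 z (hsph z hz)).continuousAt.prodMk
      (((continuousAt_id.sub continuousAt_const).mul (h1 z (hsph z hz)).continuousAt).prodMk
      (((continuousAt_id.sub continuousAt_const).pow 2).mul
        (h2 z (hsph z hz)).continuousAt))).continuousWithinAt
  obtain ⟨B, hB⟩ := (isCompact_sphere c r).exists_bound_of_continuousOn hcont
  set M := 2 + K + K
  obtain ⟨N, hN⟩ := exists_nat_ge M
  refine ⟨N, B * r ^ N, fun z hz => ?_⟩
  have hw : 0 < ‖z - c‖ := norm_pos_iff.2 (sub_ne_zero.2 hz.2)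
  have hwr : ‖z - c‖ < r := by rw [← dist_eq_norm]; exact hz.1
  set a : ℂ := (z - c) * (r / ‖z - c‖ : ℝ) with ha
  have hna : ‖a‖ = r := by
    rw [ha, norm_mul, Complex.norm_real, Real.norm_of_nonneg (by positivity)]
    field_simp
  set T := Real.log (r / ‖z - c‖) with hT
  have hT0 : 0 ≤ T := Real.log_nonneg (by rw [le_div_iff₀ hw]; linarith)
  have hexpT : Real.exp T = r / ‖z - c‖ := Real.exp_log (by positivity)
  -- The ray from the circle of radius `r` towards `c`, parametrized by logarithmic distance; it
  -- passes through `z` at time `T`.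
  set w : ℂ → ℂ := fun s => a * Complex.exp (-s) with hwdef
  have hwd : ∀ s, HasDerivAt (fun s => c + w s) (-w s) s := fun s => by
    have := (((hasDerivAt_id' s).fun_neg).cexp.const_mul a).const_add c
    refine this.congr_deriv ?_
    simp [hwdef]
  have hwn : ∀ t : ℝ, ‖w t‖ = r * Real.exp (-t) := fun t => by
    simp [hwdef, hna, Complex.norm_exp]
  have hmem : ∀ t : ℝ, 0 ≤ t → c + w t ∈ ball c ρ \ {c} := fun t ht => by
    have e : ‖w t‖ ≤ r := by
      rw [hwn]
      have : Real.exp (-t) ≤ 1 := Real.exp_le_one_iff.2 (by linarith)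
      nlinarith
    refine ⟨by rw [mem_ball, dist_eq_norm, add_sub_cancel_left]; linarith, ?_⟩
    have : 0 < ‖w t‖ := by rw [hwn]; positivity
    simpa using norm_pos_iff.1 this
  set v : ℝ → ℂ × ℂ × ℂ := fun t =>
    (f (c + w t), w t * f₁ (c + w t), w t ^ 2 * f₂ (c + w t)) with hv
  set v' : ℝ → ℂ × ℂ × ℂ := fun t =>
    (-(w t * f₁ (c + w t)), -(w t * f₁ (c + w t) + w t ^ 2 * f₂ (c + w t)),
      -(2 * (w t ^ 2 * f₂ (c + w t)) + w t ^ 3 * f₃ (c + w t))) with hv'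
  have hwd' : ∀ s, HasDerivAt w (-w s) s := fun s => by simpa using (hwd s).sub_const c
  have hvd : ∀ t : ℝ, 0 ≤ t → HasDerivAt v (v' t) t := by
    intro t ht
    have hm := hmem t ht
    have e0 := ((h0 _ hm).comp (t : ℂ) (hwd t)).comp_ofReal
    have e1 := ((hwd' t).fun_mul ((h1 _ hm).comp (t : ℂ) (hwd t))).comp_ofReal
    have e2 := (((hwd' t).fun_pow 2).fun_mul ((h2 _ hm).comp (t : ℂ) (hwd t))).comp_ofReal
    refine (e0.prodMk (e1.prodMk e2)).congr_deriv ?_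
    simp only [hv', Function.comp, Prod.mk.injEq]
    refine ⟨by ring, by ring, by push_cast; ring⟩
  have hbound : ∀ t ∈ Ico 0 T, ‖v' t‖ ≤ M * ‖v t‖ + 0 := by
    intro t ht
    have hm := hmem t ht.1
    have k1 : ‖f (c + w t)‖ ≤ ‖v t‖ := norm_fst_le (v t)
    have k2 : ‖w t * f₁ (c + w t)‖ ≤ ‖v t‖ := (norm_fst_le (v t).2).trans (norm_snd_le (v t))
    have k3 : ‖w t ^ 2 * f₂ (c + w t)‖ ≤ ‖v t‖ := (norm_snd_le (v t).2).trans (norm_snd_le (v t))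
    have k4 := heq _ hm
    rw [add_sub_cancel_left] at k4
    have hvn : 0 ≤ ‖v t‖ := norm_nonneg _
    rw [add_zero, norm_prod_le_iff, norm_prod_le_iff]
    refine ⟨?_, ?_, ?_⟩
    · simp only [hv', norm_neg]
      nlinarith
    · simp only [hv', norm_neg]
      refine (norm_add_le _ _).trans ?_
      nlinarith
    · simp only [hv', norm_neg]
      rw [k4]
      refine (norm_add_le _ _).trans ?_
      have j1 : ‖2 * (w t ^ 2 * f₂ (c + w t))‖ ≤ 2 * ‖v t‖ := by
        rw [norm_mul]; simpa using k3
      have j2 : ‖J (c + w t) * (w t * f₁ (c + w t))‖ ≤ K * ‖v t‖ := by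
        rw [norm_mul]; exact mul_le_mul (hJ _ hm) k2 (norm_nonneg _) hK
      have j3 : ‖L (c + w t) * f (c + w t)‖ ≤ K * ‖v t‖ := by
        rw [norm_mul]; exact mul_le_mul (hL _ hm) k1 (norm_nonneg _) hK
      have j4 := norm_add_le (J (c + w t) * (w t * f₁ (c + w t))) (L (c + w t) * f (c + w t))
      simp only [M]
      linarith
  have hv0 : ‖v 0‖ ≤ B := by
    have hs : c + w 0 ∈ sphere c r := by simp [hwdef, hna]
    have := hB _ hs
    rw [add_sub_cancel_left] at this
    simpa [hv] using this
  -- Grönwall gives growth at most `exp(M T)`, while `|z - c|` is `r exp(-T)`; a power `N ≥ M`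
  -- therefore absorbs the growth.
  have hG := norm_le_gronwallBound_of_norm_deriv_right_le (a := 0) (b := T)
    (fun t ht => (hvd t ht.1).continuousAt.continuousWithinAt)
    (fun t ht => (hvd t ht.1).hasDerivWithinAt) hv0 hbound T ⟨hT0, le_rfl⟩
  rw [gronwallBound_ε0, sub_zero] at hG
  have hzT : c + w T = z := by
    have : (Complex.exp (-T : ℂ)) = ((‖z - c‖ / r : ℝ) : ℂ) := by
      rw [← Complex.ofReal_neg, ← Complex.ofReal_exp, Real.exp_neg, hexpT, inv_div]
    simp only [hwdef, this, ha]
    rw [mul_assoc, ← Complex.ofReal_mul]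
    have : r / ‖z - c‖ * (‖z - c‖ / r) = 1 := by field_simp
    rw [this]; simp
  have hfz : ‖f z‖ ≤ B * Real.exp (M * T) := by
    refine le_trans ?_ hG
    simp [hv, hzT]
  have hB0 : 0 ≤ B := (norm_nonneg _).trans hv0
  have hnz : ‖z - c‖ = r * Real.exp (-T) := by
    rw [Real.exp_neg, hexpT]; field_simp
  rw [norm_mul, norm_pow, hnz, mul_pow, ← Real.exp_nat_mul]
  calc r ^ N * Real.exp (N * -T) * ‖f z‖
      ≤ r ^ N * Real.exp (N * -T) * (B * Real.exp (M * T)) := by gcongr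
    _ = B * r ^ N * Real.exp ((M - N) * T) := by
        rw [show (M - N) * T = N * -T + M * T by ring, Real.exp_add]; ring
    _ ≤ B * r ^ N * 1 := by
        gcongr
        exact Real.exp_le_one_iff.2 (mul_nonpos_of_nonpos_of_nonneg (by linarith) hT0)
    _ = B * r ^ N := mul_one _

theorem eventually_nhds_of_eventually_nhdsNE {c : ℂ} {P : ℂ → Prop} (h : ∀ᶠ z in 𝓝[≠] c, P z) :
    ∀ᶠ y in 𝓝[≠] c, ∀ᶠ z in 𝓝 y, P z := by
  filter_upwards [eventually_eventually_nhdsWithin.2 h, self_mem_nhdsWithin] with y hy hyc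
  rwa [(isOpen_compl_singleton).nhdsWithin_eq hyc] at hy

/-- A solution of a third order equation on a punctured neighbourhood of a regular singular point
is meromorphic there. -/
theorem meromorphicAt_of_fuchsian {f J L : ℂ → ℂ} {c : ℂ}
    (hf : ∀ᶠ z in 𝓝[≠] c, DifferentiableAt ℂ f z) (hJ : ContinuousAt J c) (hL : ContinuousAt L c)
    (heq : ∀ᶠ z in 𝓝[≠] c,
      (z - c) ^ 3 * iteratedDeriv 3 f z = J z * ((z - c) * deriv f z) + L z * f z) :
    MeromorphicAt f c := by
  have hK1 : ∀ᶠ z in 𝓝 c, ‖J z‖ ≤ max (‖J c‖ + 1) (‖L c‖ + 1) := by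
    filter_upwards [hJ.norm.eventually_lt_const (lt_add_one _)] with z hz
    exact hz.le.trans (le_max_left _ _)
  have hK2 : ∀ᶠ z in 𝓝 c, ‖L z‖ ≤ max (‖J c‖ + 1) (‖L c‖ + 1) := by
    filter_upwards [hL.norm.eventually_lt_const (lt_add_one _)] with z hz
    exact hz.le.trans (le_max_right _ _)
  have hall := (hf.and heq).and ((hK1.and hK2).filter_mono nhdsWithin_le_nhds)
  rw [eventually_nhdsWithin_iff, Metric.eventually_nhds_iff_ball] at hall
  obtain ⟨ρ, hρ, hall⟩ := hall
  have hopen : IsOpen (ball c ρ \ {c}) := isOpen_ball.sdiff isClosed_singleton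
  have hd0 : DifferentiableOn ℂ f (ball c ρ \ {c}) := fun z hz =>
    (hall z hz.1 hz.2).1.1.differentiableWithinAt
  have hd1 := hd0.deriv hopen
  have hd2 := hd1.deriv hopen
  have e3 : iteratedDeriv 3 f = deriv (deriv (deriv f)) := by
    rw [iteratedDeriv_succ, iteratedDeriv_succ, iteratedDeriv_one]
  obtain ⟨N, C, hNC⟩ := norm_pow_mul_le_of_fuchsian hρ
    (fun z hz => (hd0.differentiableAt (hopen.mem_nhds hz)).hasDerivAt)
    (fun z hz => (hd1.differentiableAt (hopen.mem_nhds hz)).hasDerivAt)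
    (fun z hz => (hd2.differentiableAt (hopen.mem_nhds hz)).hasDerivAt)
    (fun z hz => (hall z hz.1 hz.2).2.1) (fun z hz => (hall z hz.1 hz.2).2.2)
    (fun z hz => by rw [← e3]; exact (hall z hz.1 hz.2).1.2)
  have hb : ball c (ρ / 2) ∈ 𝓝 c := ball_mem_nhds c (half_pos hρ)
  have hsub : ball c (ρ / 2) ⊆ ball c ρ := ball_subset_ball (by linarith)
  have hg : DifferentiableOn ℂ (fun z => (z - c) ^ N * f z) (ball c (ρ / 2) \ {c}) :=
    DifferentiableOn.fun_mul (by fun_prop) (hd0.mono (sdiff_subset_sdiff_left hsub))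
  -- Riemann's removable singularity theorem for `(z - c)^N f`.
  have hup := Complex.differentiableOn_update_limUnder_of_bddAbove hb hg ⟨C, by
    rintro _ ⟨z, hz, rfl⟩
    exact hNC z hz⟩
  have hmer := (hup.analyticAt hb).meromorphicAt
  have hmer2 : MeromorphicAt (fun z => (z - c) ^ N * f z) c := by
    refine hmer.congr ?_
    filter_upwards [self_mem_nhdsWithin] with z hz
    exact Function.update_of_ne hz _ _
  have hpow : MeromorphicAt (fun z => (z - c) ^ N) c := by
    have : AnalyticAt ℂ (fun z => (z - c) ^ N) c := by fun_prop
    exact this.meromorphicAt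
  refine (hpow.inv.mul hmer2).congr ?_
  filter_upwards [self_mem_nhdsWithin] with z hz
  have : (z - c) ^ N ≠ 0 := pow_ne_zero _ (sub_ne_zero.2 hz)
  simp [this]

/-- Differentiation lowers the exponent by one and multiplies the leading coefficient by `k`. Three
applications produce the factor `k (k - 1) (k - 2)` of the indicial polynomial. -/
theorem deriv_eventuallyEq_zpow_mul {f g : ℂ → ℂ} {c : ℂ} {k : ℤ} (hg : AnalyticAt ℂ g c)
    (h : ∀ᶠ z in 𝓝[≠] c, f z = (z - c) ^ k * g z) :
    ∃ g₁ : ℂ → ℂ, AnalyticAt ℂ g₁ c ∧ g₁ c = k * g c ∧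
      ∀ᶠ z in 𝓝[≠] c, deriv f z = (z - c) ^ (k - 1) * g₁ z := by
  refine ⟨fun z => k * g z + (z - c) * deriv g z,
    (analyticAt_const.fun_mul hg).fun_add ((by fun_prop : AnalyticAt ℂ (fun z => z - c) c).fun_mul
      hg.deriv), by simp, ?_⟩
  filter_upwards [eventually_nhds_of_eventually_nhdsNE h, self_mem_nhdsWithin,
    (hg.eventually_analyticAt).filter_mono nhdsWithin_le_nhds] with z hz hzc hgz
  have hne : z - c ≠ 0 := sub_ne_zero.2 hzc
  have e : f =ᶠ[𝓝 z] fun z => (z - c) ^ k * g z := hz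
  rw [e.deriv_eq]
  have h1 : HasDerivAt (fun z => (z - c) ^ k) (k * (z - c) ^ (k - 1)) z := by
    have h2 : HasDerivAt (fun z => (z - c) ^ k) (k * (z - c) ^ (k - 1) * 1) z :=
      HasDerivAt.comp (h₂ := fun x : ℂ => x ^ k) z (hasDerivAt_zpow k (z - c) (Or.inl hne))
        ((hasDerivAt_id' z).sub_const c)
    simpa using h2
  rw [(h1.fun_mul hgz.differentiableAt.hasDerivAt).deriv]
  have : (z - c) ^ k = (z - c) ^ (k - 1) * (z - c) := by
    rw [← zpow_add_one₀ hne]; congr 1; ring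
  rw [this]; ring

/-- The indicial equation of the symmetric square of `y'' = I y` at a double pole of `I`. -/
theorem indicial_equation {f J L : ℂ → ℂ} {c α : ℂ} (hf : MeromorphicAt f c) {k : ℤ}
    (hk : meromorphicOrderAt f c = k) (hJ : ContinuousAt J c) (hL : ContinuousAt L c)
    (hJc : J c = 4 * α) (hLc : L c = -4 * α)
    (heq : ∀ᶠ z in 𝓝[≠] c,
      (z - c) ^ 3 * iteratedDeriv 3 f z = J z * ((z - c) * deriv f z) + L z * f z) :
    ((k : ℂ) - 1) * (k * (k - 2) - 4 * α) = 0 := by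
  obtain ⟨g, hg, hg0, hfg⟩ := (meromorphicOrderAt_eq_int_iff hf).1 hk
  simp only [smul_eq_mul] at hfg
  obtain ⟨g₁, hg₁, e₁, h₁⟩ := deriv_eventuallyEq_zpow_mul hg hfg
  obtain ⟨g₂, hg₂, e₂, h₂⟩ := deriv_eventuallyEq_zpow_mul hg₁ h₁
  obtain ⟨g₃, hg₃, e₃, h₃⟩ := deriv_eventuallyEq_zpow_mul hg₂ h₂
  have e4 : iteratedDeriv 3 f = deriv (deriv (deriv f)) := by
    rw [iteratedDeriv_succ, iteratedDeriv_succ, iteratedDeriv_one]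
  have key : ∀ᶠ z in 𝓝[≠] c, g₃ z = J z * g₁ z + L z * g z := by
    filter_upwards [heq, hfg, h₁, h₃, self_mem_nhdsWithin] with z k0 k1 k2 k3 hzc
    have hne : z - c ≠ 0 := sub_ne_zero.2 hzc
    rw [e4, k3, k2, k1] at k0
    have p1 : (z - c) ^ k = (z - c) ^ (k - 1) * (z - c) := by
      rw [← zpow_add_one₀ hne]; congr 1; ring
    have p2 : (z - c) ^ (k - 1) = (z - c) ^ (k - 1 - 1 - 1) * (z - c) ^ 2 := by
      rw [← zpow_natCast, ← zpow_add₀ hne]; congr 1; push_cast; ring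
    rw [p1, p2] at k0
    have hq : (z - c) ^ (k - 1 - 1 - 1) * (z - c) ^ 3 ≠ 0 :=
      mul_ne_zero (zpow_ne_zero _ hne) (pow_ne_zero _ hne)
    apply mul_left_cancel₀ hq
    linear_combination k0
  -- After cancelling the common power, the limit reads `k(k-1)(k-2) = 4αk - 4α` up to the factor `g
  -- c`; the root `k = 1` splits off.
  have hlim : g₃ c = J c * g₁ c + L c * g c := by
    have t1 : Tendsto g₃ (𝓝[≠] c) (𝓝 (g₃ c)) := hg₃.continuousAt.continuousWithinAt
    have t2 : Tendsto (fun z => J z * g₁ z + L z * g z) (𝓝[≠] c) (𝓝 (J c * g₁ c + L c * g c)) :=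
      ((hJ.mul hg₁.continuousAt).add (hL.mul hg.continuousAt)).continuousWithinAt
    exact tendsto_nhds_unique_of_eventuallyEq t1 t2 key
  rw [e₃, e₂, e₁, hJc, hLc] at hlim
  push_cast at hlim
  apply mul_right_cancel₀ hg0
  linear_combination hlim

/-- A function that is odd about `c` has odd order at `c`. -/
theorem odd_meromorphicOrderAt {f : ℂ → ℂ} {c : ℂ} (hf : MeromorphicAt f c) {k : ℤ}
    (hk : meromorphicOrderAt f c = k) (hodd : ∀ᶠ z in 𝓝[≠] c, f (2 * c - z) = -f z) : Odd k := by
  obtain ⟨g, hg, hg0, hfg⟩ := (meromorphicOrderAt_eq_int_iff hf).1 hk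
  simp only [smul_eq_mul] at hfg
  have href : Tendsto (fun z => 2 * c - z) (𝓝[≠] c) (𝓝[≠] c) := by
    refine tendsto_nhdsWithin_of_tendsto_nhds_of_eventually_within _ ?_ ?_
    · have : ContinuousAt (fun z => 2 * c - z) c := by fun_prop
      have h : Tendsto (fun z => 2 * c - z) (𝓝 c) (𝓝 (2 * c - c)) := this
      rw [show 2 * c - c = c by ring] at h
      exact h.mono_left nhdsWithin_le_nhds
    · filter_upwards [self_mem_nhdsWithin] with z hz h
      refine hz ?_
      have h' : 2 * c - z = c := h
      change z = c
      linear_combination -h'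
  -- Reflection in `c` multiplies `(z - c)^k` by `(-1)^k`, so an even `k` would force `g c = -g c`.
  have key : ∀ᶠ z in 𝓝[≠] c, (-1) ^ k * g (2 * c - z) = -g z := by
    filter_upwards [hodd, hfg, href.eventually hfg, self_mem_nhdsWithin] with z k0 k1 k2 hzc
    have hne : z - c ≠ 0 := sub_ne_zero.2 hzc
    rw [k1, k2, show 2 * c - z - c = -1 * (z - c) by ring, mul_zpow] at k0
    apply mul_left_cancel₀ (zpow_ne_zero k hne)
    linear_combination k0
  have t1 : Tendsto (fun z => (-1) ^ k * g (2 * c - z)) (𝓝[≠] c) (𝓝 ((-1) ^ k * g c)) :=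
    (((hg.continuousAt.tendsto.mono_left nhdsWithin_le_nhds).comp href)).const_mul _
  have t2 : Tendsto (fun z => -g z) (𝓝[≠] c) (𝓝 (-g c)) :=
    (hg.continuousAt.neg).tendsto.mono_left nhdsWithin_le_nhds
  have hlim := tendsto_nhds_unique_of_eventuallyEq t1 t2 key
  by_contra hno
  rw [Int.not_odd_iff_even] at hno
  rw [hno.neg_one_zpow, one_mul] at hlim
  exact hg0 (self_eq_neg.1 hlim)

/-! ### Vanishing of odd elliptic solutions of the symmetric square equation. -/

/-- An elliptic function without poles is constant. -/
theorem elliptic_eventually_const {τ : ℂ} (hτ : 0 < τ.im) {h : ℂ → ℂ} (hm : ∀ z, MeromorphicAt h z)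
    (ho : ∀ z, 0 ≤ meromorphicOrderAt h z) (h1 : ∀ z, ∀ᶠ w in 𝓝[≠] z, h (w + 1) = h w)
    (hτ' : ∀ z, ∀ᶠ w in 𝓝[≠] z, h (w + τ) = h w) :
    ∃ C, ∀ z, ∀ᶠ w in 𝓝[≠] z, h w = C := by
  have hmo : MeromorphicOn h univ := fun z _ => hm z
  -- Values of `h` at isolated points are arbitrary; the normal form repairs them and is entire.
  set H := toMeromorphicNFOn h univ
  have hHh : ∀ z, H =ᶠ[𝓝[≠] z] h := fun z => hmo.toMeromorphicNFOn_eq_self_on_nhdsNE (mem_univ z)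
  have hHa : ∀ z, AnalyticAt ℂ H z := fun z => by
    have hnf := meromorphicNFOn_toMeromorphicNFOn h univ (mem_univ z)
    rw [← hnf.meromorphicOrderAt_nonneg_iff_analyticAt,
      meromorphicOrderAt_toMeromorphicNFOn hmo (mem_univ z)]
    exact ho z
  have hper : ∀ l, (∀ z, ∀ᶠ w in 𝓝[≠] z, h (w + l) = h w) → ∀ z, H (z + l) = H z := by
    intro l hl z
    have hsh : Tendsto (fun w => w + l) (𝓝[≠] z) (𝓝[≠] (z + l)) := by
      refine tendsto_nhdsWithin_of_tendsto_nhds_of_eventually_within _ ?_ ?_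
      · have : ContinuousAt (fun w => w + l) z := by fun_prop
        exact this.tendsto.mono_left nhdsWithin_le_nhds
      · filter_upwards [self_mem_nhdsWithin] with w hw h
        exact hw (add_right_cancel h)
    have e : (fun w => H (w + l)) =ᶠ[𝓝[≠] z] H := by
      filter_upwards [hl z, hHh z, hsh.eventually (hHh (z + l))] with w k1 k2 k3
      rw [k3, k1, k2]
    have t1 : Tendsto (fun w => H (w + l)) (𝓝[≠] z) (𝓝 (H (z + l))) :=
      ((hHa (z + l)).continuousAt.tendsto.mono_left nhdsWithin_le_nhds).comp hsh
    have t2 : Tendsto H (𝓝[≠] z) (𝓝 (H z)) :=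
      (hHa z).continuousAt.tendsto.mono_left nhdsWithin_le_nhds
    exact tendsto_nhds_unique_of_eventuallyEq t1 t2 e
  have p1 := hper 1 h1
  have p2 := hper τ hτ'
  have hd : Differentiable ℂ H := fun z => (hHa z).differentiableAt
  have q1 : Function.Periodic H 1 := p1
  have q2 : Function.Periodic H τ := p2
  have hpz : ∀ (m n : ℤ) z, H (z - m - n * τ) = H z := fun m n z => by
    have a1 := (q2.int_mul n).sub_eq (z - m)
    have a2 := (q1.int_mul m).sub_eq z
    rw [a1, ← a2, mul_one]
  -- This ball contains the period parallelogram with coordinates in `[0, 1)`, to which every point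
  -- is reduced by subtracting integer parts. Liouville's theorem then applies.
  obtain ⟨B, hB⟩ := (isCompact_closedBall (0 : ℂ) (1 + ‖τ‖)).exists_bound_of_continuousOn
    hd.continuous.continuousOn
  have hbdd : Bornology.IsBounded (range H) := by
    rw [isBounded_iff_forall_norm_le]
    refine ⟨B, ?_⟩
    rintro _ ⟨z, rfl⟩
    set b := z.im / τ.im with hb
    set a := z.re - b * τ.re with ha
    rw [← hpz ⌊a⌋ ⌊b⌋ z]
    refine hB _ ?_
    have e : z - ⌊a⌋ - ⌊b⌋ * τ = ((Int.fract a : ℝ) : ℂ) + ((Int.fract b : ℝ) : ℂ) * τ := by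
      have hz : z = a + b * τ := by
        apply Complex.ext
        · simp [ha]
        · simp [hb]; field_simp
      conv_lhs => rw [hz]
      unfold Int.fract
      push_cast
      ring
    rw [mem_closedBall, dist_zero_right, e]
    refine (norm_add_le _ _).trans ?_
    rw [norm_mul, Complex.norm_real, Complex.norm_real, Real.norm_of_nonneg (Int.fract_nonneg _),
      Real.norm_of_nonneg (Int.fract_nonneg _)]
    have f1 := (Int.fract_lt_one a).le
    have f2 := (Int.fract_lt_one b).le
    have := norm_nonneg τ
    nlinarith
  obtain ⟨C, hC⟩ := hd.exists_const_forall_eq_of_bounded hbdd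
  refine ⟨C, fun z => ?_⟩
  filter_upwards [hHh z] with w hw
  rw [← hw, hC]

namespace GenLame.LameData

variable (D : LameData) {τ z : ℂ}

theorem isTwoTorsion_iff_two_mul_mem (hτ : 0 < τ.im) :
    IsTwoTorsion z τ ↔ 2 * z ∈ (periods τ).lattice := by
  refine ⟨fun ⟨k, hk⟩ => ?_, isTwoTorsion_of_two_mul_mem hτ⟩
  have := add_mem (add_mem hk hk) (omega_mem_lattice k hτ)
  rwa [show z - omega k τ / 2 + (z - omega k τ / 2) + omega k τ = 2 * z by ring] at this

theorem eventually_not_isSingular (c τ : ℂ) : ∀ᶠ z in 𝓝[≠] c, ¬ D.IsSingular z τ := by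
  have key : ∀ a : ℂ, ∀ᶠ z in 𝓝[≠] c, z - a ∉ (periods τ).lattice := by
    intro a
    have h1 : Tendsto (fun z => z - a) (𝓝 c) (𝓝 (c - a)) :=
      (by fun_prop : ContinuousAt (fun z : ℂ => z - a) c)
    have h2 := h1.eventually ((periods τ).compl_lattice_sdiff_singleton_mem_nhds (c - a))
    filter_upwards [h2.filter_mono nhdsWithin_le_nhds, self_mem_nhdsWithin] with z hz hzc hm
    exact hz ⟨hm, fun h => hzc (sub_left_injective h)⟩
  have h3 := key (-D.p τ)
  simp only [sub_neg_eq_add] at h3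
  filter_upwards [eventually_all.2 fun k => key (omega k τ / 2), key (D.p τ), h3] with z k0 k1 k2
  rintro (⟨k, hk⟩ | h | h)
  exacts [k0 k hk, k1 h, k2 h]

variable {f : ℂ → ℂ}

/-- At a singular point, a solution of the symmetric square equation is meromorphic, and its order
solves the indicial equation. -/
theorem exists_indicial (hτ : 0 < τ.im) (hp2 : ¬ IsTwoTorsion (D.p τ) τ)
    (hd : ∀ z, ¬ D.IsSingular z τ → DifferentiableAt ℂ f z)
    (heq : ∀ z, ¬ D.IsSingular z τ → iteratedDeriv 3 f z =
      4 * D.potential z τ * deriv f z + 2 * deriv (fun w => D.potential w τ) z * f z)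
    {c : ℂ} (hc : D.IsSingular c τ) : MeromorphicAt f c ∧ ∃ α : ℂ,
      (IsTwoTorsion c τ → ∃ k, α = D.n k * (D.n k + 1)) ∧ (¬ IsTwoTorsion c τ → α = 3 / 4) ∧
      ∀ k : ℤ, meromorphicOrderAt f c = k → ((k : ℂ) - 1) * (k * (k - 2) - 4 * α) = 0 := by
  obtain ⟨α, β, R, hR, hI, ht, hp⟩ := exists_potential_eq_near D hτ hp2 hc
  -- `J₀ = (z - c)² I` is analytic at `c`. Multiplying the equation by `(z - c)³` puts it in
  -- Fuchsian form with coefficients `J` and `L`, whose values at `c` are `4α` and `-4α`.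
  set J₀ : ℂ → ℂ := fun z => α + β * (z - c) + (z - c) ^ 2 * R z with hJ₀
  have hJa : AnalyticAt ℂ J₀ c := by
    have : AnalyticAt ℂ (fun z => α + β * (z - c)) c := by fun_prop
    exact this.fun_add ((by fun_prop : AnalyticAt ℂ (fun z => (z - c) ^ 2) c).fun_mul hR)
  have hJc : J₀ c = α := by simp [hJ₀]
  set J : ℂ → ℂ := fun z => 4 * J₀ z with hJ
  set L : ℂ → ℂ := fun z => 2 * ((z - c) * deriv J₀ z - 2 * J₀ z) with hL
  have hJcont : ContinuousAt J c := hJa.continuousAt.const_mul 4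
  have hLcont : ContinuousAt L c :=
    (((by fun_prop : ContinuousAt (fun z => z - c) c).fun_mul hJa.deriv.continuousAt).fun_sub
      (hJa.continuousAt.const_mul 2)).const_mul 2
  have hII : ∀ z, z ≠ c → D.potential z τ = J₀ z / (z - c) ^ 2 := fun z hz => by
    have : z - c ≠ 0 := sub_ne_zero.2 hz
    rw [hI, hJ₀]; field_simp
  have heq' : ∀ᶠ z in 𝓝[≠] c,
      (z - c) ^ 3 * iteratedDeriv 3 f z = J z * ((z - c) * deriv f z) + L z * f z := by
    filter_upwards [D.eventually_not_isSingular c τ, self_mem_nhdsWithin,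
      hJa.eventually_analyticAt.filter_mono nhdsWithin_le_nhds] with z hz hzc hJz
    have hne : z - c ≠ 0 := sub_ne_zero.2 hzc
    have hdI : deriv (fun w => D.potential w τ) z
        = (deriv J₀ z * (z - c) ^ 2 - J₀ z * (2 * (z - c))) / ((z - c) ^ 2) ^ 2 := by
      have e : (fun w => D.potential w τ) =ᶠ[𝓝 z] fun w => J₀ w / (w - c) ^ 2 := by
        filter_upwards [isOpen_compl_singleton.mem_nhds hzc] with w hw
        exact hII w hw
      rw [e.deriv_eq]
      have h2 : HasDerivAt (fun w => (w - c) ^ 2) (2 * (z - c)) z := by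
        simpa using ((hasDerivAt_id' z).sub_const c).fun_pow 2
      exact (hJz.differentiableAt.hasDerivAt.fun_div h2 (pow_ne_zero 2 hne)).deriv
    rw [heq z hz, hdI, hII z hzc, hJ, hL]
    field_simp
  have hd' : ∀ᶠ z in 𝓝[≠] c, DifferentiableAt ℂ f z :=
    (D.eventually_not_isSingular c τ).mono fun z hz => hd z hz
  have hm := meromorphicAt_of_fuchsian hd' hJcont hLcont heq'
  exact ⟨hm, α, ht, hp, fun k hk => indicial_equation hm hk hJcont hLcont
    (by rw [hJ, ← hJc]) (by simp [hL, hJc]; ring) heq'⟩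

theorem analyticAt_of_not_isSingular (hd : ∀ z, ¬ D.IsSingular z τ → DifferentiableAt ℂ f z)
    {c : ℂ} (hc : ¬ D.IsSingular c τ) : AnalyticAt ℂ f c := by
  rw [Complex.analyticAt_iff_eventually_differentiableAt]
  have h1 := (D.eventually_not_isSingular c τ).mono fun z hz => hd z hz
  rw [eventually_nhdsWithin_iff] at h1
  filter_upwards [h1] with z hz
  by_cases h : z = c
  · rw [h]; exact hd c hc
  · exact hz h

theorem meromorphicAt_of_solution (hτ : 0 < τ.im) (hp2 : ¬ IsTwoTorsion (D.p τ) τ)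
    (hd : ∀ z, ¬ D.IsSingular z τ → DifferentiableAt ℂ f z)
    (heq : ∀ z, ¬ D.IsSingular z τ → iteratedDeriv 3 f z =
      4 * D.potential z τ * deriv f z + 2 * deriv (fun w => D.potential w τ) z * f z)
    (c : ℂ) : MeromorphicAt f c := by
  by_cases hc : D.IsSingular c τ
  · exact (D.exists_indicial hτ hp2 hd heq hc).1
  · exact (D.analyticAt_of_not_isSingular hd hc).meromorphicAt

theorem periodic_of_lattice (hτ : 0 < τ.im)
    (h1 : ∀ z, ¬ D.IsSingular z τ → f (z + 1) = f z)
    (h2 : ∀ z, ¬ D.IsSingular z τ → f (z + τ) = f z) {l : ℂ} (hl : l ∈ (periods τ).lattice)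
    (hz : ¬ D.IsSingular z τ) : f (z + l) = f z := by
  have key : ∀ a : ℂ, a ∈ (periods τ).lattice →
      (∀ z, ¬ D.IsSingular z τ → f (z + a) = f z) → ∀ (n : ℤ) z, ¬ D.IsSingular z τ →
      f (z + n * a) = f z := by
    intro a ha h n
    have hm : ∀ n : ℤ, (n : ℂ) * a ∈ (periods τ).lattice := fun n => by
      rw [← zsmul_eq_mul]; exact zsmul_mem ha n
    induction n using Int.induction_on with
    | zero => simp
    | succ n ih =>
      intro z hz
      have e : z + ((n + 1 : ℤ) : ℂ) * a = z + (n : ℤ) * a + a := by push_cast; ring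
      rw [e, h _ (by rwa [isSingular_add_iff D (hm n)]), ih z hz]
    | pred n ih =>
      intro z hz
      rw [← h, ← ih z hz]
      · congr 1; push_cast; ring
      · rwa [isSingular_add_iff D (hm _)]
  obtain ⟨⟨m, n⟩, rfl⟩ := (mem_lattice_iff hτ).1 hl
  have e1 := key 1 (one_mem_lattice τ) h1 m z hz
  have e2 := key τ (self_mem_lattice hτ) h2 n (z + m * 1) (by
    rw [isSingular_add_iff D]
    · exact hz
    · rw [← zsmul_eq_mul]; exact zsmul_mem (one_mem_lattice τ) m)
  rw [← e1, ← e2]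
  congr 1
  simp only [latticePoint]; ring

/-- An odd single-valued elliptic solution of the symmetric square equation vanishes to first order
at the two-torsion points, provided the exponents are not half-integral. -/
theorem one_le_order_of_isTwoTorsion (hτ : 0 < τ.im) (hp2 : ¬ IsTwoTorsion (D.p τ) τ)
    (hn : ∀ (k : Fin 4) (m : ℤ), D.n k ≠ 1 / 2 + (m : ℂ))
    (hd : ∀ z, ¬ D.IsSingular z τ → DifferentiableAt ℂ f z)
    (heq : ∀ z, ¬ D.IsSingular z τ → iteratedDeriv 3 f z =
      4 * D.potential z τ * deriv f z + 2 * deriv (fun w => D.potential w τ) z * f z)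
    (h1 : ∀ z, ¬ D.IsSingular z τ → f (z + 1) = f z)
    (h2 : ∀ z, ¬ D.IsSingular z τ → f (z + τ) = f z)
    (hodd : ∀ z, ¬ D.IsSingular z τ → f (-z) = -f z)
    {c : ℂ} (hc : IsTwoTorsion c τ) : 1 ≤ meromorphicOrderAt f c := by
  obtain ⟨hm, α, ht, -, hind⟩ := D.exists_indicial hτ hp2 hd heq (c := c) (Or.inl hc)
  cases hk : meromorphicOrderAt f c with
  | top => exact le_top
  | coe k =>
    obtain ⟨j, rfl⟩ := ht hc
    -- Since `2c` is a period, oddness about `0` implies oddness about `c`.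
    have hk2 : Odd k := odd_meromorphicOrderAt hm hk (by
      filter_upwards [D.eventually_not_isSingular c τ] with z hz
      rw [← hodd z hz, show 2 * c - z = -z + 2 * c by ring]
      exact D.periodic_of_lattice hτ h1 h2 ((isTwoTorsion_iff_two_mul_mem hτ).1 hc)
        (by rwa [isSingular_neg_iff D hτ]))
    obtain ⟨m, rfl⟩ := hk2
    rcases mul_eq_zero.1 (hind _ hk) with h | h
    · have : ((2 * m + 1 : ℤ) : ℂ) = (1 : ℤ) := by push_cast at h ⊢; linear_combination h
      rw [Int.cast_injective this]
      exact le_rfl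
    · exfalso
      -- The other exponents at this point are `-2n` and `2n + 2`; either one being an odd integer
      -- would make `n` half-integral.
      have : (((2 * m + 1 : ℤ) : ℂ) + 2 * D.n j) * ((2 * m + 1 : ℤ) - 2 * D.n j - 2) = 0 := by
        linear_combination h
      rcases mul_eq_zero.1 this with h | h
      · refine hn j (-m - 1) ?_
        push_cast at h ⊢
        linear_combination h / 2
      · refine hn j (m - 1) ?_
        push_cast at h ⊢
        linear_combination -h / 2

/-- For `α = 3/4` the indicial polynomial is `(k - 1)(k - 3)(k + 1)`. -/
theorem neg_one_le_order_of_isSingular (hτ : 0 < τ.im) (hp2 : ¬ IsTwoTorsion (D.p τ) τ)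
    (hd : ∀ z, ¬ D.IsSingular z τ → DifferentiableAt ℂ f z)
    (heq : ∀ z, ¬ D.IsSingular z τ → iteratedDeriv 3 f z =
      4 * D.potential z τ * deriv f z + 2 * deriv (fun w => D.potential w τ) z * f z)
    {c : ℂ} (hs : D.IsSingular c τ) (hc : ¬ IsTwoTorsion c τ) : -1 ≤ meromorphicOrderAt f c := by
  obtain ⟨hm, α, -, hp, hind⟩ := D.exists_indicial hτ hp2 hd heq hs
  cases hk : meromorphicOrderAt f c with
  | top => exact le_top
  | coe k =>
    obtain rfl := hp hc
    have h : (k - 1) * ((k - 3) * (k + 1)) = 0 := by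
      have h := hind k hk
      have : (((k - 1) * ((k - 3) * (k + 1)) : ℤ) : ℂ) = 0 := by push_cast; linear_combination h
      exact_mod_cast this
    have hk' : -1 ≤ k := by
      rcases mul_eq_zero.1 h with h | h
      · omega
      · rcases mul_eq_zero.1 h with h | h <;> omega
    exact WithTop.coe_le_coe.2 hk'

/-- An odd elliptic function that solves the symmetric square of `y'' = I(z;τ) y` on the complement
of the singular points vanishes identically. -/
theorem eq_zero_of_odd_elliptic_solution (hτ : 0 < τ.im) (hp2 : ¬ IsTwoTorsion (D.p τ) τ)
    (hn : ∀ (k : Fin 4) (m : ℤ), D.n k ≠ 1 / 2 + (m : ℂ))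
    (hd : ∀ z, ¬ D.IsSingular z τ → DifferentiableAt ℂ f z)
    (heq : ∀ z, ¬ D.IsSingular z τ → iteratedDeriv 3 f z =
      4 * D.potential z τ * deriv f z + 2 * deriv (fun w => D.potential w τ) z * f z)
    (h1 : ∀ z, ¬ D.IsSingular z τ → f (z + 1) = f z)
    (h2 : ∀ z, ¬ D.IsSingular z τ → f (z + τ) = f z)
    (hodd : ∀ z, ¬ D.IsSingular z τ → f (-z) = -f z)
    (hz : ¬ D.IsSingular z τ) : f z = 0 := by
  set L := (periods τ).lattice
  have hf : ∀ c, MeromorphicAt f c := D.meromorphicAt_of_solution hτ hp2 hd heq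
  -- This factor removes the possible simple poles of `f` at `±p`. Its double pole at the periods is
  -- reduced to at most a simple one by the zero of `f` there.
  set φ : ℂ → ℂ := fun z => wp z τ - wp (D.p τ) τ with hφdef
  have hφ : ∀ c, MeromorphicAt φ c := fun c =>
    ((periods τ).meromorphic_weierstrassP c).fun_sub (MeromorphicAt.const _ _)
  have hLt : ∀ c ∈ L, IsTwoTorsion c τ := fun c hc =>
    (isTwoTorsion_iff_two_mul_mem hτ).2 (by rw [two_mul]; exact add_mem hc hc)
  have hφL : ∀ c ∈ L, meromorphicOrderAt φ c = -2 := by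
    intro c hc
    have ho : meromorphicOrderAt (fun z => wp z τ) c = -2 := (periods τ).order_weierstrassP c hc
    have e : φ = (fun z => wp z τ) + fun _ => -wp (D.p τ) τ := by
      funext z; simp [hφdef, sub_eq_add_neg]
    have ha : AnalyticAt ℂ (fun _ : ℂ => -wp (D.p τ) τ) c := analyticAt_const
    rw [e, meromorphicOrderAt_add_eq_left_of_lt ha.meromorphicAt, ho]
    rw [ho]
    exact lt_of_lt_of_le (by decide) ha.meromorphicOrderAt_nonneg
  have hφa : ∀ c ∉ L, AnalyticAt ℂ φ c := fun c hc =>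
    (wp_analyticAt hc).fun_sub analyticAt_const
  have hφp : ∀ c, D.IsSingular c τ → ¬ IsTwoTorsion c τ → 1 ≤ meromorphicOrderAt φ c := by
    intro c hs hc
    have hcL : c ∉ L := fun h => hc (hLt c h)
    have h0 : φ c = 0 := by
      rw [hφdef]
      rcases hs with h | h | h
      · exact absurd h hc
      · have := wp_add h (D.p τ)
        rw [show D.p τ + (c - D.p τ) = c by ring] at this
        simp [this]
      · have := wp_add h (-D.p τ)
        rw [show -D.p τ + (c + D.p τ) = c by ring, wp_neg] at this
        simp [this]
    have hpos : 0 < meromorphicOrderAt φ c := by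
      rw [← tendsto_zero_iff_meromorphicOrderAt_pos (hφ c), ← h0]
      exact (hφa c hcL).continuousAt.tendsto.mono_left nhdsWithin_le_nhds
    cases hk : meromorphicOrderAt φ c with
    | top => exact le_top
    | coe k =>
      rw [hk] at hpos
      exact WithTop.coe_le_coe.2 (Int.add_one_le_of_lt (WithTop.coe_lt_coe.1 hpos))
  have hφtop : ∀ c, meromorphicOrderAt φ c ≠ ⊤ := fun c =>
    MeromorphicOn.meromorphicOrderAt_ne_top_of_isPreconnected (U := univ) (fun z _ => hφ z)
      isPreconnected_univ (mem_univ 0) (mem_univ c) (by rw [hφL 0 (zero_mem _)]; decide)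
  set g : ℂ → ℂ := fun z => f z * φ z with hgdef
  have hg : ∀ c, MeromorphicAt g c := fun c => (hf c).fun_mul (hφ c)
  have hgo : ∀ c, meromorphicOrderAt g c = meromorphicOrderAt f c + meromorphicOrderAt φ c :=
    fun c => meromorphicOrderAt_mul (hf c) (hφ c)
  have hft : ∀ c, IsTwoTorsion c τ → 1 ≤ meromorphicOrderAt f c := fun c hc =>
    D.one_le_order_of_isTwoTorsion hτ hp2 hn hd heq h1 h2 hodd hc
  have hg1 : ∀ c ∈ L, -1 ≤ meromorphicOrderAt g c := fun c hc => by
    rw [hgo, hφL c hc]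
    calc (-1 : WithTop ℤ) = 1 + -2 := by decide
      _ ≤ _ := by gcongr; exact hft c (hLt c hc)
  have hg2 : ∀ c ∉ L, IsTwoTorsion c τ → 1 ≤ meromorphicOrderAt g c := fun c hc ht => by
    rw [hgo]
    calc (1 : WithTop ℤ) = 1 + 0 := by decide
      _ ≤ _ := add_le_add (hft c ht) (hφa c hc).meromorphicOrderAt_nonneg
  have hg3 : ∀ c ∉ L, 0 ≤ meromorphicOrderAt g c := fun c hc => by
    by_cases ht : IsTwoTorsion c τ
    · exact le_trans (by decide) (hg2 c hc ht)
    rw [hgo]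
    by_cases hs : D.IsSingular c τ
    · calc (0 : WithTop ℤ) = -1 + 1 := by decide
        _ ≤ _ := add_le_add (D.neg_one_le_order_of_isSingular hτ hp2 hd heq hs ht) (hφp c hs ht)
    · exact add_nonneg (D.analyticAt_of_not_isSingular hd hs).meromorphicOrderAt_nonneg
        (hφa c hc).meromorphicOrderAt_nonneg
  have hh1 : (1 / 2 : ℂ) ∉ L := fun h => by
    have := eq_of_sub_half_mem_lattice (j := 1) (k := 0) hτ (by simpa [omega] using h)
    exact absurd this (by decide)
  have hh2 : τ / 2 ∉ L := fun h => by
    have := eq_of_sub_half_mem_lattice (j := 2) (k := 0) hτ (by simpa [omega] using h)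
    exact absurd this (by decide)
  have hh3 : τ / 2 + 1 / 2 ∉ L := fun h => by
    have := eq_of_sub_half_mem_lattice (j := 3) (k := 0) hτ (by
      simp only [omega, Matrix.cons_val, zero_div, sub_zero]
      rwa [show (1 + τ) / 2 = τ / 2 + 1 / 2 by ring])
    exact absurd this (by decide)
  have hτ2 : IsTwoTorsion (τ / 2) τ := (isTwoTorsion_iff_two_mul_mem hτ).2 (by
    rw [show 2 * (τ / 2) = τ by ring]; exact self_mem_lattice hτ)
  have hshift : ∀ c, IsTwoTorsion c τ → IsTwoTorsion (c + 1 / 2) τ := fun c hc => by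
    rw [isTwoTorsion_iff_two_mul_mem hτ] at hc ⊢
    rw [show 2 * (c + 1 / 2) = 2 * c + 1 by ring]
    exact add_mem hc (one_mem_lattice τ)
  -- Translation by `1/2` matches each possible simple pole of `g` at a period with a zero at a
  -- two-torsion point. This excludes a lone simple pole without residues.
  set h : ℂ → ℂ := fun z => g z * g (z + 1 / 2) with hhdef
  have hgs : ∀ c, MeromorphicAt (fun z => g (z + 1 / 2)) c := fun c =>
    MeromorphicAt.comp_analyticAt (f := g) (g := fun z : ℂ => z + 1 / 2) (hg (c + 1 / 2))
      (by fun_prop : AnalyticAt ℂ (fun z : ℂ => z + 1 / 2) c)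
  have hm : ∀ c, MeromorphicAt h c := fun c => (hg c).fun_mul (hgs c)
  have hho : ∀ c, meromorphicOrderAt h c
      = meromorphicOrderAt g c + meromorphicOrderAt g (c + 1 / 2) := fun c => by
    have e := meromorphicOrderAt_mul (hg c) (hgs c)
    have e2 : meromorphicOrderAt (fun z => g (z + 1 / 2)) c = meromorphicOrderAt g (c + 1 / 2) :=
      meromorphicOrderAt_comp_of_deriv_ne_zero (f := g) (g := fun z : ℂ => z + 1 / 2)
        (by fun_prop) (by simp)
    rw [← e2]; exact e
  have hpos : ∀ c, 0 ≤ meromorphicOrderAt h c := by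
    intro c
    rw [hho]
    by_cases hc : c ∈ L
    · have hc' : c + 1 / 2 ∉ L := fun h => hh1 (by
        have := sub_mem h hc; rwa [add_sub_cancel_left] at this)
      calc (0 : WithTop ℤ) = -1 + 1 := by decide
        _ ≤ _ := add_le_add (hg1 c hc) (hg2 _ hc' (hshift c (hLt c hc)))
    · by_cases hc' : c + 1 / 2 ∈ L
      · have ht : IsTwoTorsion c τ := by
          rw [isTwoTorsion_iff_two_mul_mem hτ,
            show 2 * c = (c + 1 / 2) + (c + 1 / 2) - 1 by ring]
          exact sub_mem (add_mem hc' hc') (one_mem_lattice τ)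
        calc (0 : WithTop ℤ) = 1 + -1 := by decide
          _ ≤ _ := add_le_add (hg2 _ hc ht) (hg1 _ hc')
      · exact add_nonneg (hg3 c hc) (hg3 _ hc')
  have hgper : ∀ l ∈ L, ∀ z, ¬ D.IsSingular z τ → g (z + l) = g z := fun l hl z hz => by
    simp only [hgdef, hφdef]
    rw [D.periodic_of_lattice hτ h1 h2 hl hz, wp_add hl]
  have hhper : ∀ l ∈ L, ∀ c, ∀ᶠ w in 𝓝[≠] c, h (w + l) = h w := by
    intro l hl c
    have hsh : Tendsto (fun w : ℂ => w + 1 / 2) (𝓝[≠] c) (𝓝[≠] (c + 1 / 2)) := by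
      refine tendsto_nhdsWithin_of_tendsto_nhds_of_eventually_within _ ?_ ?_
      · have : ContinuousAt (fun w : ℂ => w + 1 / 2) c := by fun_prop
        exact this.tendsto.mono_left nhdsWithin_le_nhds
      · filter_upwards [self_mem_nhdsWithin] with w hw h
        exact hw (add_right_cancel h)
    filter_upwards [D.eventually_not_isSingular c τ,
      hsh.eventually (D.eventually_not_isSingular (c + 1 / 2) τ)] with w k1 k2
    simp only [hhdef]
    rw [hgper l hl w k1, ← hgper l hl (w + 1 / 2) k2, show w + l + 1 / 2 = w + 1 / 2 + l by ring]
  obtain ⟨C, hC⟩ := elliptic_eventually_const hτ hm hpos (hhper 1 (one_mem_lattice τ))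
    (hhper τ (self_mem_lattice hτ))
  -- Neither `τ/2` nor `τ/2 + 1/2` is a period, so both factors vanish there and the constant is
  -- zero.
  have hlim : Tendsto h (𝓝[≠] (τ / 2)) (𝓝 0) := by
    apply tendsto_zero_of_meromorphicOrderAt_pos
    rw [hho]
    calc (0 : WithTop ℤ) < 1 + 1 := by decide
      _ ≤ _ := add_le_add (hg2 _ hh2 hτ2) (hg2 _ hh3 (hshift _ hτ2))
  have hC0 : C = 0 := by
    have : Tendsto h (𝓝[≠] (τ / 2)) (𝓝 C) :=
      tendsto_const_nhds.congr' ((hC (τ / 2)).mono fun w hw => hw.symm)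
    exact tendsto_nhds_unique this hlim
  have htop : meromorphicOrderAt h (τ / 2) = ⊤ := by
    rw [meromorphicOrderAt_eq_top_iff]
    simpa [hC0] using hC (τ / 2)
  -- As `φ` never vanishes identically, some germ of `f` does; the identity theorem for meromorphic
  -- functions spreads this everywhere.
  have hex : ∃ c, meromorphicOrderAt f c = ⊤ := by
    rw [hho, WithTop.add_eq_top, hgo, hgo, WithTop.add_eq_top, WithTop.add_eq_top] at htop
    rcases htop with (h | h) | (h | h)
    exacts [⟨_, h⟩, absurd h (hφtop _), ⟨_, h⟩, absurd h (hφtop _)]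
  obtain ⟨c, hc⟩ := hex
  have hftop : meromorphicOrderAt f z = ⊤ := by
    by_contra hne
    exact MeromorphicOn.meromorphicOrderAt_ne_top_of_isPreconnected (U := univ) (fun z _ => hf z)
      isPreconnected_univ (mem_univ z) (mem_univ c) hne hc
  rw [meromorphicOrderAt_eq_top_iff] at hftop
  have t1 : Tendsto f (𝓝[≠] z) (𝓝 (f z)) :=
    (hd z hz).continuousAt.tendsto.mono_left nhdsWithin_le_nhds
  exact tendsto_nhds_unique_of_eventuallyEq t1 tendsto_const_nhds hftop

end GenLame.LameData

/-! ### Analytic continuation along paths, with parameters. -/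

/-- Uniqueness of analytic continuation along a path. -/
theorem eventuallyEq_of_continuation {γ : unitInterval → ℂ} (hγ : Continuous γ)
    {A B : unitInterval → ℂ → ℂ} (hA : ∀ s, AnalyticAt ℂ (A s) (γ s))
    (hB : ∀ s, AnalyticAt ℂ (B s) (γ s)) (hA' : ∀ s, ∀ᶠ s' in 𝓝 s, A s' =ᶠ[𝓝 (γ s')] A s)
    (hB' : ∀ s, ∀ᶠ s' in 𝓝 s, B s' =ᶠ[𝓝 (γ s')] B s) (h0 : A 0 =ᶠ[𝓝 (γ 0)] B 0)
    (s : unitInterval) : A s =ᶠ[𝓝 (γ s)] B s := by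
  have key : {s | A s =ᶠ[𝓝 (γ s)] B s} = univ := by
    refine IsClopen.eq_univ ⟨?_, ?_⟩ ⟨0, h0⟩
    -- If the germs agree at a nearby parameter, the identity theorem on a disc about `γ s`
    -- transports the agreement back to `s`.
    · rw [← isOpen_compl_iff, isOpen_iff_eventually]
      intro s hs
      obtain ⟨ρ, hρ, hball⟩ := Metric.eventually_nhds_iff_ball.1
        ((hA s).eventually_analyticAt.and (hB s).eventually_analyticAt)
      filter_upwards [hA' s, hB' s, hγ.continuousAt.eventually (ball_mem_nhds (γ s) hρ)]
        with s' k1 k2 k3 k4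
      refine hs ?_
      have h1 : A s =ᶠ[𝓝 (γ s')] B s := k1.symm.trans (k4.trans k2)
      have h2 := AnalyticOnNhd.eqOn_of_preconnected_of_eventuallyEq
        (fun z hz => (hball z hz).1) (fun z hz => (hball z hz).2)
        (convex_ball (γ s) ρ).isPreconnected k3 h1
      exact h2.eventuallyEq_of_mem (ball_mem_nhds (γ s) hρ)
    · rw [isOpen_iff_eventually]
      intro s hs
      have h1 : ∀ᶠ z in 𝓝 (γ s), A s =ᶠ[𝓝 z] B s := eventually_eventually_nhds.2 hs
      filter_upwards [hA' s, hB' s, hγ.continuousAt.eventually h1] with s' k1 k2 k3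
      exact k1.trans (k3.trans k2.symm)
  exact key.ge (mem_univ s)

/-- Compactness of `K` replaces the local radii by a single one, valid for the discs about points of
`K` and for the parameter. -/
theorem exists_uniform_fundamental {M : ℂ → ℂ → Matrix (Fin 2) (Fin 2) ℂ} {W : Set (ℂ × ℂ)}
    (hW : IsOpen W) (hM : MatHolOn M W) {K : Set ℂ} (hK : IsCompact K) {b : ℂ}
    (hKW : ∀ z ∈ K, (z, b) ∈ W) :
    ∃ ε > 0, ∀ x ∈ K, ball x ε ×ˢ ball b ε ⊆ W ∧ ∃ Φ : ℂ → ℂ → Matrix (Fin 2) (Fin 2) ℂ,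
      MatHolOn Φ (ball x ε ×ˢ ball b ε) ∧
      ∀ z ∈ ball x ε, ∀ τ ∈ ball b ε, (Φ z τ).det ≠ 0 ∧
        ∀ i j, HasDerivAt (fun w => Φ w τ i j) ((M z τ * Φ z τ) i j) z := by
  have shrink : ∀ {x y : ℂ} {ε δ : ℝ}, ball y δ ⊆ ball x ε → δ ≤ ε →
      (ball x ε ×ˢ ball b ε ⊆ W ∧ ∃ Φ : ℂ → ℂ → Matrix (Fin 2) (Fin 2) ℂ,
        MatHolOn Φ (ball x ε ×ˢ ball b ε) ∧ ∀ z ∈ ball x ε, ∀ τ ∈ ball b ε, (Φ z τ).det ≠ 0 ∧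
          ∀ i j, HasDerivAt (fun w => Φ w τ i j) ((M z τ * Φ z τ) i j) z) →
      (ball y δ ×ˢ ball b δ ⊆ W ∧ ∃ Φ : ℂ → ℂ → Matrix (Fin 2) (Fin 2) ℂ,
        MatHolOn Φ (ball y δ ×ˢ ball b δ) ∧ ∀ z ∈ ball y δ, ∀ τ ∈ ball b δ, (Φ z τ).det ≠ 0 ∧
          ∀ i j, HasDerivAt (fun w => Φ w τ i j) ((M z τ * Φ z τ) i j) z) := by
    rintro x y ε δ h1 h2 ⟨hb, Φ, hΦ, hΦ'⟩
    have hs := prod_mono h1 (ball_subset_ball (x := b) h2)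
    exact ⟨hs.trans hb, Φ, hΦ.mono hs, fun z hz τ hτ => hΦ' z (h1 hz) τ (ball_subset_ball h2 hτ)⟩
  refine hK.induction_on (p := fun S => ∃ ε > 0, ∀ x ∈ S, ball x ε ×ˢ ball b ε ⊆ W ∧
    ∃ Φ : ℂ → ℂ → Matrix (Fin 2) (Fin 2) ℂ, MatHolOn Φ (ball x ε ×ˢ ball b ε) ∧
      ∀ z ∈ ball x ε, ∀ τ ∈ ball b ε, (Φ z τ).det ≠ 0 ∧
        ∀ i j, HasDerivAt (fun w => Φ w τ i j) ((M z τ * Φ z τ) i j) z)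
    ⟨1, one_pos, by simp⟩ ?_ ?_ ?_
  · rintro S T hST ⟨ε, hε, h⟩
    exact ⟨ε, hε, fun x hx => h x (hST hx)⟩
  · rintro S T ⟨ε, hε, h⟩ ⟨δ, hδ, h'⟩
    refine ⟨min ε δ, lt_min hε hδ, ?_⟩
    rintro x (hx | hx)
    · exact shrink (ball_subset_ball (min_le_left _ _)) (min_le_left _ _) (h x hx)
    · exact shrink (ball_subset_ball (min_le_right _ _)) (min_le_right _ _) (h' x hx)
  · intro x hx
    obtain ⟨r, hr, hrW, Φ, h1, -, h3⟩ := exists_fundamental hW hM (hKW x hx)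
    refine ⟨ball x (r / 2), mem_nhdsWithin_of_mem_nhds (ball_mem_nhds x (half_pos hr)), r / 2,
      half_pos hr, fun y hy => shrink (x := x) (ε := r) ?_ (by linarith) ⟨hrW, Φ, h1, h3⟩⟩
    refine ball_subset_ball' ?_
    have := (mem_ball.1 hy).le
    linarith

/-- A continuation, along the path `γ` and holomorphic in a parameter in `N`, of a solution of
`∂Y/∂z = M Y`, by solutions on the discs of radius `ε` about the points of the path. -/
structure IsContinuation (M : ℂ → ℂ → Matrix (Fin 2) (Fin 2) ℂ) (X : Set (ℂ × ℂ))
    (γ : unitInterval → ℂ) (ε : ℝ) (N : Set ℂ)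
    (F : unitInterval → ℂ → ℂ → Matrix (Fin 2) (Fin 2) ℂ) : Prop where
  continuous : Continuous γ
  pos : 0 < ε
  isOpen : IsOpen N
  subset : ∀ s, ball (γ s) ε ×ˢ N ⊆ X
  holOn : ∀ s, MatHolOn (F s) (ball (γ s) ε ×ˢ N)
  solves : ∀ s, ∀ z ∈ ball (γ s) ε, ∀ τ ∈ N, ∀ i j,
    HasDerivAt (fun w => F s w τ i j) ((M z τ * F s z τ) i j) z
  compat : ∀ s, ∀ᶠ s' in 𝓝 s, ∀ z ∈ ball (γ s) ε ∩ ball (γ s') ε, ∀ τ ∈ N,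
    F s' z τ = F s z τ

/-- `Y⁻¹ F` has zero derivative. A relation `F = Y C` at one point therefore holds throughout the
convex set. -/
theorem eq_mul_of_solves {M Y F : ℂ → Matrix (Fin 2) (Fin 2) ℂ} {S : Set ℂ} (hS : IsOpen S)
    (hSc : Convex ℝ S)
    (hY : ∀ z ∈ S, ∀ i j, HasDerivAt (fun s => Y s i j) ((M z * Y z) i j) z)
    (hF : ∀ z ∈ S, ∀ i j, HasDerivAt (fun s => F s i j) ((M z * F z) i j) z)
    (hd : ∀ z ∈ S, (Y z).det ≠ 0) {z w : ℂ} (hz : z ∈ S) (hw : w ∈ S)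
    {C : Matrix (Fin 2) (Fin 2) ℂ} (hC : F w = Y w * C) : F z = Y z * C := by
  have h1 : (Y z)⁻¹ * F z = (Y w)⁻¹ * F w := by
    ext i j
    have h := fun x hx => hasDerivAt_inv_mul (hY x hx) (hF x hx) (hd x hx) i j
    exact hS.is_const_of_deriv_eq_zero hSc.isPreconnected
      (fun x hx => (h x hx).differentiableAt.differentiableWithinAt) (fun x hx => (h x hx).deriv)
      hz hw
  have hu : ∀ z ∈ S, IsUnit (Y z).det := fun z hz => (hd z hz).isUnit
  rw [hC, Matrix.nonsing_inv_mul_cancel_left _ _ (hu w hw)] at h1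
  rw [← h1, Matrix.mul_nonsing_inv_cancel_left _ _ (hu z hz)]

/-- Solutions of linear systems continue along every path in the regular set. On a fine subdivision
each disc contains the next node, where the value is handed over to the next fundamental solution;
the value at the node is holomorphic in the parameter, so this dependence survives every step. -/
theorem exists_continuation {M Y : ℂ → ℂ → Matrix (Fin 2) (Fin 2) ℂ} {X : Set (ℂ × ℂ)}
    (hX : IsOpen X) (hM : MatHolOn M X) {γ : unitInterval → ℂ} (hγ : Continuous γ) 
    {b : ℂ} {δ : ℝ} (hδ : 0 < δ) (hγX : ∀ s, (γ s, b) ∈ X)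
    (hY : MatHolOn Y (ball (γ 0) δ ×ˢ ball b δ))
    (hYs : ∀ z ∈ ball (γ 0) δ, ∀ τ ∈ ball b δ, ∀ i j,
      HasDerivAt (fun w => Y w τ i j) ((M z τ * Y z τ) i j) z) :
    ∃ ε F, ε ≤ δ ∧ IsContinuation M X γ ε (ball b ε) F ∧
      ∀ z ∈ ball (γ 0) ε, ∀ τ ∈ ball b ε, F 0 z τ = Y z τ := by
  obtain ⟨η₀, hη₀, hfund⟩ := exists_uniform_fundamental hX hM (isCompact_range hγ) (b := b)
    (by rintro _ ⟨s, rfl⟩; exact hγX s)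
  set η := min η₀ δ with hη
  have hη0 : 0 < η := lt_min hη₀ hδ
  choose! Φ hΦ hΦ' using fun s => (hfund (γ s) (mem_range_self s)).2
  have hbη : ∀ x : ℂ, ball x η ⊆ ball x η₀ := fun x => ball_subset_ball (min_le_left _ _)
  have hbδ : ∀ x : ℂ, ball x η ⊆ ball x δ := fun x => ball_subset_ball (min_le_right _ _)
  obtain ⟨θ, hθ, hunif⟩ := Metric.uniformContinuous_iff.1
    (CompactSpace.uniformContinuous_of_continuous hγ) (η / 2) (half_pos hη0)
  obtain ⟨K, hK⟩ := exists_nat_gt (1 / θ)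
  have hK0 : (0 : ℝ) < K := lt_trans (by positivity) hK
  have hKθ : 1 / (K : ℝ) < θ := by
    rw [div_lt_iff₀ hK0]; rw [div_lt_iff₀ hθ] at hK; linarith
  -- Nodes `i / K`, clamped to `1` for `i > K`, so that the recursion below needs no upper bound.
  set t : ℕ → unitInterval := fun i => projIcc 0 1 zero_le_one (i / K : ℝ) with ht
  have ht0 : t 0 = 0 := by simp [ht]
  have hdist : ∀ x y : ℝ, dist (projIcc 0 1 zero_le_one x : unitInterval)
      (projIcc 0 1 zero_le_one y) ≤ |x - y| := fun x y => by
    have := LipschitzWith.projIcc (zero_le_one (α := ℝ)) |>.dist_le_mul x y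
    simpa [Real.dist_eq] using this
  have htt : ∀ i, dist (γ (t i)) (γ (t (i + 1))) < η / 2 := fun i => by
    refine hunif (lt_of_le_of_lt (hdist _ _) ?_)
    rw [abs_sub_comm, abs_of_nonneg]
    · push_cast; rw [← sub_div, add_sub_cancel_left]; exact hKθ
    · push_cast; rw [← sub_div, add_sub_cancel_left]; positivity
  set P : ℕ → ℂ → ℂ → Matrix (Fin 2) (Fin 2) ℂ := fun i z τ => Φ (t i) z τ with hP
  -- `G (i + 1)` is the solution on the disc about node `i + 1` whose value at that node is the one
  -- of `G i`.
  let G : ℕ → ℂ → ℂ → Matrix (Fin 2) (Fin 2) ℂ := fun n => Nat.rec Y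
    (fun i G z τ => P (i + 1) z τ * ((P (i + 1) (γ (t (i + 1))) τ)⁻¹ * G (γ (t (i + 1))) τ)) n
  have hGs : ∀ i z τ, G (i + 1) z τ =
      P (i + 1) z τ * ((P (i + 1) (γ (t (i + 1))) τ)⁻¹ * G i (γ (t (i + 1))) τ) :=
    fun i z τ => rfl
  have hslice : ∀ {H : ℂ → ℂ → Matrix (Fin 2) (Fin 2) ℂ} {x y : ℂ},
      MatHolOn H (ball x η ×ˢ ball b η) → y ∈ ball x η →
        ∀ S, MatHolOn (fun _ τ => H y τ) (S ×ˢ ball b η) := by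
    intro H x y hH hy S i j
    refine DifferentiableOn.comp (g := fun x : ℂ × ℂ => H x.1 x.2 i j)
      (f := fun x : ℂ × ℂ => (y, x.2)) (hH i j) (by fun_prop) ?_
    rintro ⟨u, v⟩ ⟨-, hv⟩
    exact ⟨hy, hv⟩
  have hG : ∀ i, MatHolOn (G i) (ball (γ (t i)) η ×ˢ ball b η) ∧
      ∀ z ∈ ball (γ (t i)) η, ∀ τ ∈ ball b η, ∀ k l,
        HasDerivAt (fun w => G i w τ k l) ((M z τ * G i z τ) k l) z := by
    intro i
    induction i with
    | zero =>
      rw [ht0]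
      exact ⟨hY.mono (prod_mono (hbδ _) (hbδ _)),
        fun z hz τ hτ => hYs z (hbδ _ hz) τ (hbδ _ hτ)⟩
    | succ i ih =>
      have hPh : MatHolOn (P (i + 1)) (ball (γ (t (i + 1))) η ×ˢ ball b η) :=
        (hΦ (t (i + 1))).mono (prod_mono (hbη _) (hbη _))
      have hm : γ (t (i + 1)) ∈ ball (γ (t i)) η := by
        rw [mem_ball, dist_comm]; linarith [htt i]
      refine ⟨?_, fun z hz τ hτ => ?_⟩
      · have h1 := hslice hPh (mem_ball_self hη0) (ball (γ (t (i + 1))) η)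
        have h2 := h1.inv (fun x hx =>
          (hΦ' (t (i + 1)) _ (mem_ball_self hη₀) x.2 (hbη _ hx.2)).1)
        exact hPh.mul (h2.mul (hslice ih.1 hm _))
      · have h1 := (hΦ' (t (i + 1)) z (hbη _ hz) τ (hbη _ hτ)).2
        intro k l
        have := hasDerivAt_matrix_mul_const h1
          ((P (i + 1) (γ (t (i + 1))) τ)⁻¹ * G i (γ (t (i + 1))) τ) k l
        rw [Matrix.mul_assoc] at this
        exact this
  have hGG : ∀ i, ∀ z ∈ ball (γ (t i)) η ∩ ball (γ (t (i + 1))) η, ∀ τ ∈ ball b η,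
      G (i + 1) z τ = G i z τ := by
    intro i z hz τ hτ
    have hm : γ (t (i + 1)) ∈ ball (γ (t i)) η ∩ ball (γ (t (i + 1))) η := by
      refine ⟨?_, mem_ball_self hη0⟩
      rw [mem_ball, dist_comm]; linarith [htt i]
    rw [hGs]
    symm
    refine eq_mul_of_solves (M := fun z => M z τ) (Y := fun z => P (i + 1) z τ)
      (F := fun z => G i z τ) (isOpen_ball.inter isOpen_ball)
      ((convex_ball _ _).inter (convex_ball _ _))
      (fun z hz => (hΦ' (t (i + 1)) z (hbη _ hz.2) τ (hbη _ hτ)).2)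
      (fun z hz => (hG i).2 z hz.1 τ hτ)
      (fun z hz => (hΦ' (t (i + 1)) z (hbη _ hz.2) τ (hbη _ hτ)).1) hz hm ?_
    rw [Matrix.mul_nonsing_inv_cancel_left]
    exact (hΦ' (t (i + 1)) _ (mem_ball_self hη₀) τ (hbη _ hτ)).1.isUnit
  -- The last node before `s`; its disc of radius `η` contains the disc of radius `η / 2` about `γ
  -- s`.
  set idx : unitInterval → ℕ := fun s => ⌊(s : ℝ) * K⌋₊ with hidx
  have hfl : ∀ s : unitInterval, (idx s : ℝ) ≤ s * K ∧ (s : ℝ) * K < idx s + 1 := fun s =>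
    ⟨Nat.floor_le (mul_nonneg s.2.1 hK0.le), Nat.lt_floor_add_one _⟩
  have hsub : ∀ s, ball (γ s) (η / 2) ⊆ ball (γ (t (idx s))) η := by
    intro s
    refine ball_subset_ball' ?_
    have : dist (γ s) (γ (t (idx s))) < η / 2 := by
      refine hunif ?_
      have e : s = projIcc 0 1 zero_le_one (s : ℝ) := (projIcc_val _ s).symm
      rw [e]
      refine lt_of_le_of_lt (hdist _ _) ?_
      rw [projIcc_val]
      refine lt_of_le_of_lt ?_ hKθ
      obtain ⟨f1, f2⟩ := hfl s
      rw [abs_of_nonneg, sub_le_iff_le_add, ← add_div, le_div_iff₀ hK0]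
      · linarith
      · rw [sub_nonneg, div_le_iff₀ hK0]; exact f1
    linarith
  have hb2 : ball b (η / 2) ⊆ ball b η := ball_subset_ball (by linarith)
  refine ⟨η / 2, fun s => G (idx s), by have := min_le_right η₀ δ; linarith,
    ⟨hγ, half_pos hη0, isOpen_ball, fun s => ?_, fun s => ?_, fun s z hz τ hτ => ?_, fun s => ?_⟩,
    fun z hz τ hτ => ?_⟩
  · refine Subset.trans (prod_mono ?_ ?_) (hfund (γ s) (mem_range_self s)).1
    · exact (ball_subset_ball (by linarith)).trans (hbη _)
    · exact hb2.trans (hbη _)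
  · exact (hG _).1.mono (prod_mono (hsub s) hb2)
  · exact (hG _).2 z (hsub s hz) τ (hb2 hτ)
  · filter_upwards [ball_mem_nhds s (by positivity : (0 : ℝ) < 1 / K)] with s' hs' z hz τ hτ
    have z1 := hsub s hz.1
    have z2 := hsub s' hz.2
    have hd : |(s' : ℝ) - s| < 1 / K := by simpa [Subtype.dist_eq, Real.dist_eq] using hs'
    replace hd : |((s' : ℝ) - s) * K| < 1 := by
      rwa [abs_mul, abs_of_pos hK0, ← lt_div_iff₀ hK0]
    rw [abs_lt, sub_mul] at hd
    obtain ⟨f1, f2⟩ := hfl s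
    obtain ⟨f3, f4⟩ := hfl s'
    have l1 : idx s' < idx s + 2 := by
      have : (idx s' : ℝ) < (idx s + 2 : ℕ) := by push_cast; linarith
      exact_mod_cast this
    have l2 : idx s < idx s' + 2 := by
      have : (idx s : ℝ) < (idx s' + 2 : ℕ) := by push_cast; linarith
      exact_mod_cast this
    -- Parameters closer than `1 / K` have equal or adjacent nodes, and solutions at adjacent nodes
    -- agree on the overlap.
    obtain h | h | h : idx s' = idx s ∨ idx s' = idx s + 1 ∨ idx s = idx s' + 1 := by omega
    · rw [h]
    · rw [h] at z2 ⊢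
      exact hGG _ z ⟨z1, z2⟩ τ (hb2 hτ)
    · rw [h] at z1 ⊢
      exact (hGG _ z ⟨z2, z1⟩ τ (hb2 hτ)).symm
  · have : idx 0 = 0 := by simp [hidx]
    change G (idx 0) z τ = _
    rw [this]
    rfl

namespace IsContinuation

variable {M : ℂ → ℂ → Matrix (Fin 2) (Fin 2) ℂ} {X : Set (ℂ × ℂ)} {γ : unitInterval → ℂ} {ε : ℝ}
  {N : Set ℂ} {F : unitInterval → ℂ → ℂ → Matrix (Fin 2) (Fin 2) ℂ}

theorem isOpen_prod (_h : IsContinuation M X γ ε N F) (s : unitInterval) :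
    IsOpen (ball (γ s) ε ×ˢ N) := isOpen_ball.prod _h.isOpen

theorem analyticAt (h : IsContinuation M X γ ε N F) {s : unitInterval} {z τ : ℂ}
    (hz : z ∈ ball (γ s) ε) (hτ : τ ∈ N) (i j : Fin 2) :
    AnalyticAt ℂ (fun w => F s w τ i j) z :=
  DifferentiableOn.analyticAt (s := ball (γ s) ε)
    (fun w hw => (h.solves s w hw τ hτ i j).differentiableAt.differentiableWithinAt)
    (isOpen_ball.mem_nhds hz)

theorem compat_near (h : IsContinuation M X γ ε N F) {γ' : unitInterval → ℂ}
    (hγ' : Continuous γ') (hclose : ∀ s, γ' s ∈ ball (γ s) ε) (s : unitInterval) :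
    ∀ᶠ s' in 𝓝 s, ∀ᶠ z in 𝓝 (γ' s'), ∀ τ ∈ N, F s' z τ = F s z τ := by
  filter_upwards [h.compat s, hγ'.continuousAt.eventually (isOpen_ball.mem_nhds (hclose s))]
    with s' k1 k2
  filter_upwards [isOpen_ball.mem_nhds (hclose s'), isOpen_ball.mem_nhds k2] with z z1 z2 τ hτ
  exact k1 z ⟨z2, z1⟩ τ hτ

/-- A continuation along `γ` restricts to a continuation along nearby paths. -/
theorem isAnalyticContinuation (h : IsContinuation M X γ ε N F) {γ' : unitInterval → ℂ}
    (hγ' : Continuous γ') (hclose : ∀ s, γ' s ∈ ball (γ s) ε) {τ : ℂ} (hτ : τ ∈ N)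
    {f g : ℂ → Matrix (Fin 2) (Fin 2) ℂ} (hf : (fun z => F 0 z τ) =ᶠ[𝓝 (γ' 0)] f)
    (hg : (fun z => F 1 z τ) =ᶠ[𝓝 (γ' 1)] g) : GenLame.IsAnalyticContinuation γ' f g := by
  refine ⟨fun s z => F s z τ, fun s i j => h.analyticAt (hclose s) hτ i j, fun s => ?_, hf, hg⟩
  filter_upwards [h.compat_near hγ' hclose s] with s' hs'
  filter_upwards [hs'] with z hz
  exact hz τ hτ

end IsContinuation

/-- Liouville's formula `(det Y)' = tr M · det Y`. It keeps branches invertible and puts the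
monodromy in `SL(2)`. -/
theorem hasDerivAt_det_of_trace_eq_zero {Y : ℂ → Matrix (Fin 2) (Fin 2) ℂ}
    {M : Matrix (Fin 2) (Fin 2) ℂ} {t : ℂ} (hM : M.trace = 0)
    (hY : ∀ i j, HasDerivAt (fun s => Y s i j) ((M * Y t) i j) t) :
    HasDerivAt (fun s => (Y s).det) 0 t := by
  have hdet := ((hY 0 0).fun_mul (hY 1 1)).fun_sub ((hY 0 1).fun_mul (hY 1 0))
  simp only [Matrix.det_fin_two]
  refine hdet.congr_deriv ?_
  rw [Matrix.trace_fin_two] at hM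
  simp only [Matrix.mul_apply, Fin.sum_univ_two]
  linear_combination (Y t 0 0 * Y t 1 1 - Y t 0 1 * Y t 1 0) * hM

/-- The determinant is preserved by continuation of solutions of a traceless system. -/
theorem IsContinuation.det_eq {M : ℂ → ℂ → Matrix (Fin 2) (Fin 2) ℂ} {X : Set (ℂ × ℂ)}
    {γ : unitInterval → ℂ} {ε : ℝ} {N : Set ℂ}
    {F : unitInterval → ℂ → ℂ → Matrix (Fin 2) (Fin 2) ℂ} (h : IsContinuation M X γ ε N F)
    (hM : ∀ z τ, (M z τ).trace = 0) {s : unitInterval} {z τ : ℂ} (hz : z ∈ ball (γ s) ε)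
    (hτ : τ ∈ N) : (F s z τ).det = (F 0 (γ 0) τ).det := by
  have hd : ∀ s, ∀ z ∈ ball (γ s) ε, HasDerivAt (fun w => (F s w τ).det) 0 z := fun s z hz =>
    hasDerivAt_det_of_trace_eq_zero (hM z τ) (h.solves s z hz τ hτ)
  have hself : ∀ s, γ s ∈ ball (γ s) ε := fun s => mem_ball_self h.pos
  have key := eventuallyEq_of_continuation h.continuous
    (A := fun s z => (F s z τ).det) (B := fun _ _ => (F 0 (γ 0) τ).det)
    (fun s => DifferentiableOn.analyticAt (s := ball (γ s) ε)
      (fun w hw => (hd s w hw).differentiableAt.differentiableWithinAt)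
      (isOpen_ball.mem_nhds (hself s))) (fun s => analyticAt_const) (fun s => by
        filter_upwards [h.compat_near h.continuous hself s] with s' hs'
        filter_upwards [hs'] with z hz
        rw [hz τ hτ]) (fun s => Eventually.of_forall fun _ => EventuallyEq.rfl) (by
        filter_upwards [isOpen_ball.mem_nhds (hself 0)] with z hz
        exact eq_of_hasDerivAt_zero_on_ball (hd 0) hz (hself 0)) s
  rw [← key.eq_of_nhds]
  exact eq_of_hasDerivAt_zero_on_ball (hd s) hz (hself s)

/-- The chain rule along a curve `t ↦ (u t, t)`. -/
theorem HolOn₂.hasDerivAt_comp_graph {f : ℂ → ℂ → ℂ} {W : Set (ℂ × ℂ)} (hf : HolOn₂ f W)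
    (hW : IsOpen W) {u : ℂ → ℂ} {b p s u' : ℂ} (h : (u b, b) ∈ W)
    (hp : HasDerivAt (fun w => f w b) p (u b)) (hs : HasDerivAt (fun t => f (u b) t) s b)
    (hu : HasDerivAt u u' b) : HasDerivAt (fun t => f (u t) t) (u' * p + s) b := by
  have hF := (hf.differentiableAt (hW.mem_nhds h)).hasFDerivAt
  set L := fderiv ℂ (fun x : ℂ × ℂ => f x.1 x.2) (u b, b)
  have e1 : L (1, 0) = p := by
    have h1 : HasDerivAt (fun w : ℂ => (w, b)) ((1 : ℂ), (0 : ℂ)) (u b) :=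
      (hasDerivAt_id' _).prodMk (hasDerivAt_const _ _)
    have h2 : HasDerivAt (fun w => f w b) (L (1, 0)) (u b) :=
      HasFDerivAt.comp_hasDerivAt (f := fun w : ℂ => (w, b)) (u b) hF h1
    exact h2.unique hp
  have e2 : L (0, 1) = s := by
    have h1 : HasDerivAt (fun t : ℂ => (u b, t)) ((0 : ℂ), (1 : ℂ)) b :=
      (hasDerivAt_const _ _).prodMk (hasDerivAt_id' _)
    have h2 : HasDerivAt (fun t => f (u b) t) (L (0, 1)) b :=
      HasFDerivAt.comp_hasDerivAt (f := fun t : ℂ => (u b, t)) b hF h1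
    exact h2.unique hs
  have h1 : HasDerivAt (fun t : ℂ => (u t, t)) (u', (1 : ℂ)) b := hu.prodMk (hasDerivAt_id' _)
  have h2 : HasDerivAt (fun t => f (u t) t) (L (u', 1)) b :=
    HasFDerivAt.comp_hasDerivAt (f := fun t : ℂ => (u t, t)) b hF h1
  have e3 : L (u', 1) = u' * p + s := by
    rw [← e1, ← e2, ← smul_eq_mul, ← map_smul, ← map_add]
    simp
  rw [e3] at h2
  exact h2

theorem GenLame.IsAnalyticContinuation.unique {γ : unitInterval → ℂ} (hγ : Continuous γ)
    {f g₁ g₂ : ℂ → Matrix (Fin 2) (Fin 2) ℂ} (h₁ : GenLame.IsAnalyticContinuation γ f g₁)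
    (h₂ : GenLame.IsAnalyticContinuation γ f g₂) : g₁ =ᶠ[𝓝 (γ 1)] g₂ := by
  obtain ⟨A, a1, a2, a3, a4⟩ := h₁
  obtain ⟨B, b1, b2, b3, b4⟩ := h₂
  have key : ∀ i j, (fun z => A 1 z i j) =ᶠ[𝓝 (γ 1)] fun z => B 1 z i j := fun i j =>
    eventuallyEq_of_continuation hγ (A := fun s z => A s z i j) (B := fun s z => B s z i j)
      (fun s => a1 s i j) (fun s => b1 s i j)
      (fun s => (a2 s).mono fun s' h => h.mono fun z hz => by simp only [hz])
      (fun s => (b2 s).mono fun s' h => h.mono fun z hz => by simp only [hz])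
      ((a3.trans b3.symm).mono fun z hz => by simp only [hz]) 1
  filter_upwards [a4, b4, eventually_all.2 fun i => eventually_all.2 fun j => key i j]
    with z k1 k2 k3
  rw [← k1, ← k2]
  ext i j
  exact k3 i j

/-- A continuation of a solution of a Pfaffian system solves the Pfaffian system. -/
theorem IsContinuation.hasDerivAt_snd {M Ω : ℂ → ℂ → Matrix (Fin 2) (Fin 2) ℂ}
    {X : Set (ℂ × ℂ)} {γ : unitInterval → ℂ} {ε : ℝ} {N : Set ℂ}
    {F : unitInterval → ℂ → ℂ → Matrix (Fin 2) (Fin 2) ℂ} (h : IsContinuation M X γ ε N F)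
    (hΩ : MatHolOn Ω X) (h0 : ∀ z ∈ ball (γ 0) ε, ∀ τ ∈ N, ∀ i j,
      HasDerivAt (fun t => F 0 z t i j) ((Ω z τ * F 0 z τ) i j) τ)
    {s : unitInterval} {z τ : ℂ} (hz : z ∈ ball (γ s) ε) (hτ : τ ∈ N) (i j : Fin 2) :
    HasDerivAt (fun t => F s z t i j) ((Ω z τ * F s z τ) i j) τ := by
  have hself : ∀ s, γ s ∈ ball (γ s) ε := fun s => mem_ball_self h.pos
  -- The defect `∂_τF - ΩF` is analytic in `z` and is itself continued along the path. It vanishes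
  -- at the start, hence everywhere.
  set R : unitInterval → ℂ → ℂ := fun s z =>
    deriv (fun t => F s z t i j) τ - (Ω z τ * F s z τ) i j with hR
  have hRa : ∀ s, AnalyticOnNhd ℂ (R s) (ball (γ s) ε) := fun s => by
    refine DifferentiableOn.analyticOnNhd (fun w hw => ?_) isOpen_ball
    have h1 := HolOn₂.deriv_snd (f := fun z τ => F s z τ i j) (h.holOn s i j) (h.isOpen_prod s)
    have h2 := (hΩ.mono (h.subset s)).mul (h.holOn s) i j
    have hm : (w, τ) ∈ ball (γ s) ε ×ˢ N := ⟨hw, hτ⟩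
    exact ((h1.differentiableAt_fst (h.isOpen_prod s) hm).fun_sub
      (HolOn₂.differentiableAt_fst (f := fun z τ => (Ω z τ * F s z τ) i j) h2
        (h.isOpen_prod s) hm)).differentiableWithinAt
  have key := eventuallyEq_of_continuation h.continuous (A := R) (B := fun _ _ => 0)
    (fun s => hRa s _ (hself s)) (fun s => analyticAt_const) (fun s => by
      filter_upwards [h.compat_near h.continuous hself s] with s' hs'
      filter_upwards [hs'] with z hz
      have e : (fun t => F s' z t i j) =ᶠ[𝓝 τ] fun t => F s z t i j := by
        filter_upwards [h.isOpen.mem_nhds hτ] with t ht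
        rw [hz t ht]
      simp only [hR]
      rw [e.deriv_eq, hz τ hτ]) (fun s => Eventually.of_forall fun _ => EventuallyEq.rfl) (by
      filter_upwards [isOpen_ball.mem_nhds (hself 0)] with z hz
      simp only [hR]
      rw [(h0 z hz τ hτ i j).deriv, sub_self]) s
  have h1 := (hRa s).eqOn_of_preconnected_of_eventuallyEq (fun z _ => analyticAt_const)
    (convex_ball _ _).isPreconnected (hself s) key hz
  have hm : (z, τ) ∈ ball (γ s) ε ×ˢ N := ⟨hz, hτ⟩
  have h2 := (HolOn₂.differentiableAt_snd (f := fun z τ => F s z τ i j) (h.holOn s i j)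
    (h.isOpen_prod s) hm).hasDerivAt
  exact h2.congr_deriv (sub_eq_zero.1 h1)

/-! ### From an integrable Pfaffian system to constant monodromy. -/

namespace GenLame.LameData

variable (D : LameData) {τ z : ℂ} {V : Set ℂ}

theorem Q_add (hτ : 0 < τ.im) {l : ℂ} (hl : l ∈ (periods τ).lattice) (hz : ¬ D.IsSingular z τ) :
    D.Q (z + l) τ = D.Q z τ := by
  simp only [Q, D.potential_add hτ hl hz]

theorem Q_trace (z τ : ℂ) : (D.Q z τ).trace = 0 := by
  simp [Q, Matrix.trace_fin_two]

/-- The behaviour of a quasi-periodic matrix under a general translation by a lattice point. -/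
theorem add_lattice_of_quasiperiodic {G : ℂ → Matrix (Fin 2) (Fin 2) ℂ} (hτ : 0 < τ.im)
    (h1 : ∀ z, ¬ D.IsSingular z τ → G (z + 1) = G z)
    (h2 : ∀ z, ¬ D.IsSingular z τ → G (z + τ) = G z - D.Q z τ) (m n : ℤ)
    (hz : ¬ D.IsSingular z τ) : G (z + (m + n * τ)) = G z - (n : ℂ) • D.Q z τ := by
  have key : ∀ a c : ℂ, a ∈ (periods τ).lattice →
      (∀ z, ¬ D.IsSingular z τ → G (z + a) = G z - c • D.Q z τ) → ∀ (n : ℤ) z,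
      ¬ D.IsSingular z τ → G (z + n * a) = G z - (n * c) • D.Q z τ := by
    intro a c ha h n
    have hm : ∀ n : ℤ, (n : ℂ) * a ∈ (periods τ).lattice := fun n => by
      rw [← zsmul_eq_mul]; exact zsmul_mem ha n
    induction n using Int.induction_on with
    | zero => simp
    | succ n ih =>
      intro z hz
      have e : z + ((n + 1 : ℤ) : ℂ) * a = z + (n : ℤ) * a + a := by push_cast; ring
      rw [e, h _ (by rwa [isSingular_add_iff D (hm n)]), ih z hz, D.Q_add hτ (hm n) hz]
      push_cast
      module
    | pred n ih =>
      intro z hz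
      have hz' : ¬ D.IsSingular (z + ((-n - 1 : ℤ) : ℂ) * a) τ := by
        rwa [isSingular_add_iff D (hm _)]
      have e : z + ((-n - 1 : ℤ) : ℂ) * a + a = z + (-n : ℤ) * a := by push_cast; ring
      have h3 := h _ hz'
      rw [e, ih z hz, D.Q_add hτ (hm _) hz] at h3
      rw [eq_add_of_sub_eq h3.symm]
      push_cast
      module
  have e1 := key 1 0 (one_mem_lattice τ) (fun z hz => by simpa using h1 z hz) m z hz
  have hm : (m : ℂ) * 1 ∈ (periods τ).lattice := by
    rw [← zsmul_eq_mul]; exact zsmul_mem (one_mem_lattice τ) m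
  have e2 := key τ 1 (self_mem_lattice hτ) (fun z hz => by simpa using h2 z hz) n (z + m * 1) (by
    rwa [isSingular_add_iff D hm])
  rw [e1, D.Q_add hτ hm hz] at e2
  rw [show z + (m + n * τ) = z + m * 1 + n * τ by ring, e2]
  simp

theorem mem_regularSet_add_iff (hVH : ∀ τ ∈ V, 0 < τ.im) (m n : ℤ) :
    (z + (m + n * τ), τ) ∈ D.regularSet V ↔ (z, τ) ∈ D.regularSet V :=
  and_congr_right fun h =>
    not_congr (isSingular_add_iff D (int_add_int_mul_mem_lattice (hVH τ h) m n))

variable {Ω : ℂ → ℂ → Matrix (Fin 2) (Fin 2) ℂ}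

/-- Continuation along the loops of a family multiplies a local solution of the Pfaffian system by
a matrix that is locally independent of the parameter. -/
theorem exists_local_monodromy (hV : IsOpen V) (hVH : ∀ τ ∈ V, 0 < τ.im)
    (hp : DifferentiableOn ℂ D.p V) (hA : DifferentiableOn ℂ D.A V) (hB : DifferentiableOn ℂ D.B V)
    (hΩ : MatHolOn Ω (D.regularSet V))
    (hper : ∀ z τ : ℂ, (z, τ) ∈ D.regularSet V →
      Ω (z + 1) τ = Ω z τ ∧ Ω (z + τ) τ = Ω z τ - D.Q z τ)
    {q τ₀ : ℂ} {r : ℝ} {Y : ℂ → ℂ → Matrix (Fin 2) (Fin 2) ℂ}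
    (hsub : ball q r ×ˢ ball τ₀ r ⊆ D.regularSet V) (hY : MatHolOn Y (ball q r ×ˢ ball τ₀ r))
    (hdet : ∀ z ∈ ball q r, ∀ τ ∈ ball τ₀ r, (Y z τ).det ≠ 0)
    (hYz : ∀ z ∈ ball q r, ∀ τ ∈ ball τ₀ r, ∀ i j,
      HasDerivAt (fun w => Y w τ i j) ((D.Q z τ * Y z τ) i j) z)
    (hYτ : ∀ z ∈ ball q r, ∀ τ ∈ ball τ₀ r, ∀ i j,
      HasDerivAt (fun t => Y z t i j) ((Ω z τ * Y z τ) i j) τ)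
    (hr : 0 < r) {V₁ : Set ℂ} (hV₁ : IsOpen V₁) (hV₁r : V₁ ⊆ ball τ₀ r) {m n : ℤ}
    {γ : ℂ → unitInterval → ℂ} (hγ : D.IsLoopFamily V₁ q m n γ) {τ₁ : ℂ} (hτ₁ : τ₁ ∈ V₁) :
    ∃ ρ : Matrix (Fin 2) (Fin 2) ℂ, ρ.det = 1 ∧ ∀ᶠ τ in 𝓝 τ₁,
      IsAnalyticContinuation (γ τ) (fun z => Y z τ) (fun z => Y (z - (m + n * τ)) τ * ρ) := by
  have hXo := D.isOpen_regularSet hV hVH hp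
  have hWo : IsOpen (ball q r ×ˢ ball τ₀ r) := isOpen_ball.prod isOpen_ball
  have hV₁V : V₁ ⊆ V := fun τ hτ => (hsub ⟨mem_ball_self hr, hV₁r hτ⟩ : (q, τ) ∈ D.regularSet V).1
  have hγc : ∀ τ ∈ V₁, Continuous (γ τ) := fun τ hτ =>
    hγ.1.comp_continuous (f := fun s : unitInterval => (τ, s)) (by fun_prop)
      (fun s => ⟨hτ, mem_univ _⟩)
  obtain ⟨δ₀, hδ₀, hδ₀b⟩ := Metric.isOpen_iff.1 hV₁ τ₁ hτ₁
  set δ := min δ₀ r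
  have hδ : 0 < δ := lt_min hδ₀ hr
  have hδV : ball τ₁ δ ⊆ V₁ := (ball_subset_ball (min_le_left _ _)).trans hδ₀b
  have hδq : ball q δ ⊆ ball q r := ball_subset_ball (min_le_right _ _)
  obtain ⟨hγ0, hγ1, hγs⟩ := hγ.2 τ₁ hτ₁
  obtain ⟨ε, F, hεδ, hF, hF0⟩ := exists_continuation hXo (D.holOn_Q hVH hp hA hB) (hγc τ₁ hτ₁)
    (Y := Y) (b := τ₁) hδ (fun s => ⟨hV₁V hτ₁, hγs s⟩)
    (by rw [hγ0]; exact hY.mono (prod_mono hδq (hδV.trans hV₁r)))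
    (by rw [hγ0]; exact fun z hz τ hτ => hYz z (hδq hz) τ (hV₁r (hδV hτ)))
  have hε := hF.pos
  have hN : ball τ₁ ε ⊆ V₁ := (ball_subset_ball hεδ).trans hδV
  rw [hγ0] at hF0
  have hFτ : ∀ s, ∀ z ∈ ball (γ τ₁ s) ε, ∀ τ ∈ ball τ₁ ε, ∀ i j,
      HasDerivAt (fun t => F s z t i j) ((Ω z τ * F s z τ) i j) τ := fun s z hz τ hτ =>
    hF.hasDerivAt_snd hΩ (by
      rw [hγ0]
      intro z hz τ hτ i j
      have e : (fun t => F 0 z t i j) =ᶠ[𝓝 τ] fun t => Y z t i j := by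
        filter_upwards [isOpen_ball.mem_nhds hτ] with t ht
        rw [hF0 z hz t ht]
      rw [hF0 z hz τ hτ]
      exact (hYτ z (hδq (ball_subset_ball hεδ hz)) τ (hV₁r (hN hτ)) i j).congr_of_eventuallyEq e)
      hz hτ
  set c := q + m + n * τ₁ with hc
  have hcont : ContinuousAt (fun x : ℂ × ℂ => x.1 - (m + n * x.2)) (c, τ₁) := by fun_prop
  have hball : ∀ᶠ x : ℂ × ℂ in 𝓝 (c, τ₁), x.1 - (m + n * x.2) ∈ ball q r := by
    refine hcont.eventually (isOpen_ball.mem_nhds ?_)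
    simp only [hc]
    rw [show q + m + n * τ₁ - (m + n * τ₁) = q by ring]
    exact mem_ball_self hr
  obtain ⟨ε₂, hε₂, hb₂⟩ := Metric.eventually_nhds_iff_ball.1 hball
  set ε₁ := min ε₂ ε
  have hε₁ : 0 < ε₁ := lt_min hε₂ hε
  have hle : ∀ x : ℂ, ball x ε₁ ⊆ ball x ε := fun x => ball_subset_ball (min_le_right _ _)
  have hmem : ∀ z ∈ ball c ε₁, ∀ t ∈ ball τ₁ ε₁, z - (m + n * t) ∈ ball q r := fun z hz t ht =>
    hb₂ (z, t) (by
      rw [← ball_prod_same]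
      exact ⟨ball_subset_ball (min_le_left _ _) hz, ball_subset_ball (min_le_left _ _) ht⟩)
  have hτr : ball τ₁ ε₁ ⊆ ball τ₀ r := (hle τ₁).trans (hN.trans hV₁r)
  -- The translate of `Y` to the moving endpoint again solves the Pfaffian system: differentiating
  -- the shift in `t` gives `-n Q T`, which cancels the extra `n Q` from the quasi-periodicity of
  -- `Ω`.
  set T : ℂ → ℂ → Matrix (Fin 2) (Fin 2) ℂ := fun z t => Y (z - (m + n * t)) t with hT
  have hreg : ∀ z ∈ ball c ε₁, ∀ t ∈ ball τ₁ ε₁, (z - (m + n * t), t) ∈ D.regularSet V :=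
    fun z hz t ht => hsub ⟨hmem z hz t ht, hτr ht⟩
  have hQ : ∀ z ∈ ball c ε₁, ∀ t ∈ ball τ₁ ε₁, D.Q (z - (m + n * t)) t = D.Q z t := by
    intro z hz t ht
    have h := hreg z hz t ht
    have := D.Q_add (hVH t h.1) (int_add_int_mul_mem_lattice (hVH t h.1) m n) h.2
    rw [← this, sub_add_cancel]
  have hΩ' : ∀ z ∈ ball c ε₁, ∀ t ∈ ball τ₁ ε₁,
      Ω (z - (m + n * t)) t = Ω z t + (n : ℂ) • D.Q z t := by
    intro z hz t ht
    have h := hreg z hz t ht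
    have := D.add_lattice_of_quasiperiodic (G := fun z => Ω z t) (hVH t h.1)
      (fun z hz => (hper z t ⟨h.1, hz⟩).1) (fun z hz => (hper z t ⟨h.1, hz⟩).2) m n h.2
    rw [sub_add_cancel, hQ z hz t ht] at this
    rw [this, sub_add_cancel]
  have hTz : ∀ z ∈ ball c ε₁, ∀ t ∈ ball τ₁ ε₁, ∀ i j,
      HasDerivAt (fun w => T w t i j) ((D.Q z t * T z t) i j) z := by
    intro z hz t ht i j
    have := hYz _ (hmem z hz t ht) t (hτr ht) i j
    rw [hQ z hz t ht] at this
    exact this.comp_sub_const z _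
  have hTτ : ∀ z ∈ ball c ε₁, ∀ t ∈ ball τ₁ ε₁, ∀ i j,
      HasDerivAt (fun s => T z s i j) ((Ω z t * T z t) i j) t := by
    intro z hz t ht i j
    have hu : HasDerivAt (fun s : ℂ => z - (m + n * s)) (-n : ℂ) t := by
      simpa using (((hasDerivAt_id' t).const_mul (n : ℂ)).const_add (m : ℂ)).const_sub z
    have hm := hmem z hz t ht
    have := HolOn₂.hasDerivAt_comp_graph (f := fun z τ => Y z τ i j) (hY i j) hWo
      (u := fun s => z - (m + n * s)) ⟨hm, hτr ht⟩ (hYz _ hm t (hτr ht) i j)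
      (hYτ _ hm t (hτr ht) i j) hu
    refine this.congr_deriv ?_
    rw [hQ z hz t ht, hΩ' z hz t ht, Matrix.add_mul, Matrix.smul_mul]
    simp only [Matrix.add_apply, Matrix.smul_apply, smul_eq_mul, hT]
    ring
  have hTdet : ∀ z ∈ ball c ε₁, ∀ t ∈ ball τ₁ ε₁, (T z t).det ≠ 0 := fun z hz t ht =>
    hdet _ (hmem z hz t ht) t (hτr ht)
  have hcc : c ∈ ball c ε₁ := mem_ball_self hε₁
  have htt : τ₁ ∈ ball τ₁ ε₁ := mem_ball_self hε₁
  set ρ := (T c τ₁)⁻¹ * F 1 c τ₁ with hρ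
  have hγ1' : γ τ₁ 1 = c := hγ1
  have hc1 : ball c ε₁ ⊆ ball (γ τ₁ 1) ε := by rw [hγ1']; exact hle c
  -- Comparison first in the parameter at the fixed point `c`, then in `z` for each parameter; so
  -- one matrix `ρ` serves the whole bidisc.
  have e1 : ∀ t ∈ ball τ₁ ε₁, F 1 c t = T c t * ρ := fun t ht =>
    eq_mul_of_solves (M := fun t => Ω c t) (Y := fun t => T c t) (F := fun t => F 1 c t)
      isOpen_ball (convex_ball _ _) (hTτ c hcc)
      (fun t ht => hFτ 1 c (hc1 hcc) t (hle _ ht)) (hTdet c hcc) ht htt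
      (by rw [hρ, Matrix.mul_nonsing_inv_cancel_left _ _ (hTdet c hcc τ₁ htt).isUnit])
  have e2 : ∀ t ∈ ball τ₁ ε₁, ∀ z ∈ ball c ε₁, F 1 z t = T z t * ρ := fun t ht z hz =>
    eq_mul_of_solves (M := fun z => D.Q z t) (Y := fun z => T z t) (F := fun z => F 1 z t)
      isOpen_ball (convex_ball _ _) (fun z hz => hTz z hz t ht)
      (fun z hz => hF.solves 1 z (hc1 hz) t (hle _ ht)) (fun z hz => hTdet z hz t ht) hz hcc
      (e1 t ht)
  refine ⟨ρ, ?_, ?_⟩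
  -- Both determinants at the endpoint equal `det Y` at `q`: one by translation, the other because
  -- `Q` is traceless.
  · have d1 := congrArg Matrix.det (e1 τ₁ htt)
    have hT0 : T c τ₁ = Y q τ₁ := by
      simp only [hT, hc]; congr 1; ring
    rw [Matrix.det_mul, hF.det_eq D.Q_trace (hc1 hcc) (mem_ball_self hε), hγ0,
      hF0 q (mem_ball_self hε) τ₁ (mem_ball_self hε), hT0] at d1
    have := hdet q (mem_ball_self hr) τ₁ (hV₁r hτ₁)
    exact (mul_eq_left₀ this).1 d1.symm
  -- By compactness of the unit interval, the loops for nearby `τ` stay in the `ε`-tube about `γ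
  -- τ₁`, on which the continuation `F` is defined.
  · have hclose : ∀ᶠ τ in 𝓝 τ₁, ∀ s ∈ (univ : Set unitInterval), γ τ s ∈ ball (γ τ₁ s) ε := by
      refine isCompact_univ.eventually_forall_of_forall_eventually fun s _ => ?_
      have h1 : ContinuousAt (fun x : ℂ × unitInterval => γ x.1 x.2) (τ₁, s) :=
        hγ.1.continuousAt ((hV₁.prod isOpen_univ).mem_nhds ⟨hτ₁, mem_univ _⟩)
      have h2 : ContinuousAt (fun x : ℂ × unitInterval => γ τ₁ x.2) (τ₁, s) :=
        (hγc τ₁ hτ₁).continuousAt.comp' continuousAt_snd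
      have h3 : Tendsto (fun x : ℂ × unitInterval => dist (γ x.1 x.2) (γ τ₁ x.2)) (𝓝 (τ₁, s))
          (𝓝 (dist (γ τ₁ s) (γ τ₁ s))) := h1.dist h2
      rw [dist_self] at h3
      exact h3.eventually_lt_const hε
    have hend : ∀ᶠ τ in 𝓝 τ₁, q + m + n * τ ∈ ball c ε₁ :=
      (by fun_prop : ContinuousAt (fun τ => q + m + n * τ) τ₁).eventually
        (isOpen_ball.mem_nhds hcc)
    filter_upwards [hclose, hend, ball_mem_nhds τ₁ hε₁] with τ k1 k2 k3
    have hτV := hN (hle _ k3)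
    obtain ⟨g0, g1, -⟩ := hγ.2 τ hτV
    refine hF.isAnalyticContinuation (hγc τ hτV) (fun s => k1 s (mem_univ s)) (hle _ k3) ?_ ?_
    · rw [g0]
      filter_upwards [ball_mem_nhds q hε] with z hz
      exact hF0 z hz τ (hle _ k3)
    · rw [g1]
      filter_upwards [isOpen_ball.mem_nhds k2] with z hz
      exact e2 τ k3 z hz

/-- A local solution of the Pfaffian system serves as the M-invariant solution. Its monodromy matrix
is determined uniquely by the loop because `Y` is invertible at `q`, and it is locally constant in
`τ`, so connectedness of the parameter set makes it constant. -/
theorem isMonodromyPreserving_of_isCompletelyIntegrable (hV : IsOpen V)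
    (hVH : ∀ τ ∈ V, 0 < τ.im) (hp : DifferentiableOn ℂ D.p V) (hA : DifferentiableOn ℂ D.A V)
    (hB : DifferentiableOn ℂ D.B V) (hΩ : MatHolOn Ω (D.regularSet V))
    (hper : ∀ z τ : ℂ, (z, τ) ∈ D.regularSet V →
      Ω (z + 1) τ = Ω z τ ∧ Ω (z + τ) τ = Ω z τ - D.Q z τ)
    (hint : D.IsCompletelyIntegrable Ω (D.regularSet V)) : D.IsMonodromyPreserving V := by
  intro τ₀ hτ₀
  obtain ⟨q, hq⟩ := (D.eventually_not_isSingular 0 τ₀).exists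
  obtain ⟨W, hWo, hqW, hWX, Y, hY, hYW⟩ := hint (q, τ₀) ⟨hτ₀, hq⟩
  obtain ⟨r, hr, hrW⟩ := exists_ball_prod_subset hWo hqW
  have hY' := fun z hz τ hτ => hYW z τ (hrW (⟨hz, hτ⟩ : (z, τ) ∈ ball q r ×ˢ ball τ₀ r))
  refine ⟨ball τ₀ r, isOpen_ball, mem_ball_self hr,
    fun τ hτ => (hWX (hrW (⟨mem_ball_self hr, hτ⟩ : (q, τ) ∈ ball q r ×ˢ ball τ₀ r))).1, q,
    ball q r, isOpen_ball, mem_ball_self hr, hrW.trans hWX, Y,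
    ⟨hY.mono hrW, fun z hz τ hτ => ⟨(hY' z hz τ hτ).1, (hY' z hz τ hτ).2.1⟩⟩, ?_⟩
  intro V₁ hV₁ hconn hV₁r m n γ hγ
  have hloc := fun τ₁ (hτ₁ : τ₁ ∈ V₁) => D.exists_local_monodromy hV hVH hp hA hB hΩ hper
    (hrW.trans hWX) (hY.mono hrW) (fun z hz τ hτ => (hY' z hz τ hτ).1)
    (fun z hz τ hτ => (hY' z hz τ hτ).2.1) (fun z hz τ hτ => (hY' z hz τ hτ).2.2) hr hV₁ hV₁r hγ
    hτ₁
  rcases V₁.eq_empty_or_nonempty with rfl | ⟨τ₁, hτ₁⟩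
  · exact ⟨1, fun τ hτ => hτ.elim⟩
  choose! ρ hρ hρc using hloc
  have hunique : ∀ τ ∈ V₁, ∀ A B : Matrix (Fin 2) (Fin 2) ℂ,
      IsAnalyticContinuation (γ τ) (fun z => Y z τ) (fun z => Y (z - (m + n * τ)) τ * A) →
      IsAnalyticContinuation (γ τ) (fun z => Y z τ) (fun z => Y (z - (m + n * τ)) τ * B) →
      A = B := by
    intro τ hτ A B hA hB
    have hc : Continuous (γ τ) := hγ.1.comp_continuous (f := fun s : unitInterval => (τ, s))
      (by fun_prop) (fun s => ⟨hτ, mem_univ _⟩)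
    have h1 := (hA.unique hc hB).eq_of_nhds
    simp only [(hγ.2 τ hτ).2.1] at h1
    rw [show q + m + n * τ - (m + n * τ) = q by ring] at h1
    have hu := (hY' q (mem_ball_self hr) τ (hV₁r hτ)).1.isUnit
    rw [← Matrix.nonsing_inv_mul_cancel_left (Y q τ) A hu, h1,
      Matrix.nonsing_inv_mul_cancel_left _ _ hu]
  have hconst : ∀ τ ∈ V₁, ∀ᶠ t in 𝓝 τ, ρ t = ρ τ := by
    intro τ hτ
    filter_upwards [hρc τ hτ, hV₁.mem_nhds hτ] with t h1 h2
    exact hunique t h2 _ _ (hρc t h2).self_of_nhds h1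
  have hall : ∀ τ ∈ V₁, ρ τ = ρ τ₁ := by
    intro τ hτ
    ext i j
    have hd : ∀ t ∈ V₁, HasDerivAt (fun t => ρ t i j) 0 t := fun t ht =>
      (hasDerivAt_const t (ρ t i j)).congr_of_eventuallyEq
        ((hconst t ht).mono fun s hs => congrFun (congrFun hs i) j)
    exact hV₁.is_const_of_deriv_eq_zero hconn
      (fun t ht => (hd t ht).differentiableAt.differentiableWithinAt) (fun t ht => (hd t ht).deriv)
      hτ hτ₁
  refine ⟨⟨ρ τ₁, hρ τ₁ hτ₁⟩, fun τ hτ => ?_⟩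
  have := (hρc τ hτ).self_of_nhds
  rw [hall τ hτ] at this
  exact this

end GenLame.LameData

/-! ### From an M-invariant solution to a single-valued Pfaffian system. -/

theorem hasDerivAt_matrix_mul {A B : ℂ → Matrix (Fin 2) (Fin 2) ℂ}
    {A' B' : Matrix (Fin 2) (Fin 2) ℂ} {t : ℂ} (hA : ∀ i j, HasDerivAt (fun s => A s i j) (A' i j) t)
    (hB : ∀ i j, HasDerivAt (fun s => B s i j) (B' i j) t) (i j : Fin 2) :
    HasDerivAt (fun s => (A s * B s) i j) ((A' * B t + A t * B') i j) t := by
  simp only [Matrix.add_apply, Matrix.mul_apply, Fin.sum_univ_two]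
  refine (((hA i 0).fun_mul (hB 0 j)).fun_add ((hA i 1).fun_mul (hB 1 j))).congr_deriv ?_
  ring

namespace GenLame.LameData

variable (D : LameData) {V : Set ℂ} {q : ℂ} {Y : ℂ → ℂ → Matrix (Fin 2) (Fin 2) ℂ}

/-- A branch, along a path starting at `q`, of the fundamental solution `Y`. -/
structure IsBranch (V : Set ℂ) (q : ℂ) (Y : ℂ → ℂ → Matrix (Fin 2) (Fin 2) ℂ)
    (γ : unitInterval → ℂ) (ε : ℝ) (N : Set ℂ)
    (F : unitInterval → ℂ → ℂ → Matrix (Fin 2) (Fin 2) ℂ) : Prop where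
  cont : IsContinuation D.Q (D.regularSet V) γ ε N F
  start : γ 0 = q
  subset : N ⊆ V
  init : ∀ z ∈ ball q ε, ∀ τ ∈ N, F 0 z τ = Y z τ
  det_init : ∀ τ ∈ N, (Y q τ).det ≠ 0

theorem isPathConnected_regular (τ : ℂ) : IsPathConnected {z | ¬ D.IsSingular z τ} := by
  have := (D.countable_isSingular τ).isPathConnected_compl_of_one_lt_rank (E := ℂ)
    (by rw [Complex.rank_real_complex]; exact Nat.one_lt_ofNat)
  exact this

theorem exists_isBranch (hV : IsOpen V) (hVH : ∀ τ ∈ V, 0 < τ.im)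
    (hp : DifferentiableOn ℂ D.p V) (hA : DifferentiableOn ℂ D.A V) (hB : DifferentiableOn ℂ D.B V)
    {U : Set ℂ} (hU : IsOpen U) (hq : q ∈ U) (hUX : U ×ˢ V ⊆ D.regularSet V)
    (hY : D.IsFundamentalSolution Y U V) {z τ : ℂ} (hz : (z, τ) ∈ D.regularSet V) :
    ∃ γ ε F, D.IsBranch V q Y γ ε (ball τ ε) F ∧ γ 1 = z := by
  have hτ : τ ∈ V := hz.1
  have hqX : (q, τ) ∈ D.regularSet V := hUX ⟨hq, hτ⟩
  obtain ⟨γ, hγ⟩ := (D.isPathConnected_regular τ).joinedIn q hqX.2 z hz.2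
  obtain ⟨δ₁, hδ₁, h1⟩ := Metric.isOpen_iff.1 hU q hq
  obtain ⟨δ₂, hδ₂, h2⟩ := Metric.isOpen_iff.1 hV τ hτ
  have s1 : ball q (min δ₁ δ₂) ⊆ U := (ball_subset_ball (min_le_left _ _)).trans h1
  have s2 : ball τ (min δ₁ δ₂) ⊆ V := (ball_subset_ball (min_le_right _ _)).trans h2
  obtain ⟨ε, F, hε, hF, hF0⟩ := exists_continuation (D.isOpen_regularSet hV hVH hp)
    (D.holOn_Q hVH hp hA hB) γ.continuous (Y := Y) (b := τ) (lt_min hδ₁ hδ₂)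
    (fun s => ⟨hτ, hγ s⟩) (by rw [γ.source]; exact hY.1.mono (prod_mono s1 s2))
    (by rw [γ.source]; exact fun z hz t ht => (hY.2 z (s1 hz) t (s2 ht)).2)
  have s3 : ball τ ε ⊆ V := (ball_subset_ball hε).trans s2
  refine ⟨γ, ε, F, ⟨hF, γ.source, s3, ?_, fun t ht => (hY.2 q hq t (s3 ht)).1⟩, γ.target⟩
  rw [γ.source] at hF0
  exact hF0

variable {D}

namespace IsBranch

variable {γ γ' : unitInterval → ℂ} {ε ε' : ℝ} {N N' : Set ℂ}
  {F F' : unitInterval → ℂ → ℂ → Matrix (Fin 2) (Fin 2) ℂ} {z τ : ℂ}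

theorem det_ne_zero (h : D.IsBranch V q Y γ ε N F) {s : unitInterval} (hz : z ∈ ball (γ s) ε)
    (hτ : τ ∈ N) : (F s z τ).det ≠ 0 := by
  rw [h.cont.det_eq D.Q_trace hz hτ, h.start, h.init q (mem_ball_self h.cont.pos) τ hτ]
  exact h.det_init τ hτ

/-- Two branches of an `M`-invariant solution, at points that are equal on the torus, differ by a
constant matrix. -/
theorem exists_transition (hinv : D.IsMInvariant Y q V) (hVH : ∀ τ ∈ V, 0 < τ.im)
    (h : D.IsBranch V q Y γ ε N F) (h' : D.IsBranch V q Y γ' ε' N' F') (hz : z ∈ ball (γ 1) ε)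
    (hτ : τ ∈ N) (hτ' : τ ∈ N') {m n : ℤ} (hz' : z + (m + n * τ) ∈ ball (γ' 1) ε') :
    ∃ ρ : Matrix (Fin 2) (Fin 2) ℂ, ∀ᶠ t in 𝓝 τ, F' 1 (z + (m + n * t)) t = F 1 z t * ρ := by
  have hev : ∀ᶠ t in 𝓝 τ, t ∈ N ∧ t ∈ N' ∧ z + (m + n * t) ∈ ball (γ' 1) ε' :=
    (h.cont.isOpen.eventually_mem hτ).and ((h'.cont.isOpen.eventually_mem hτ').and
      ((by fun_prop : ContinuousAt (fun t : ℂ => z + (m + n * t)) τ).eventually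
        (isOpen_ball.mem_nhds hz')))
  obtain ⟨r, hr, hball⟩ := Metric.eventually_nhds_iff_ball.1 hev
  -- Time changes for a loop in two halves: `u` rises from `0` to `1` and then rests, while `v`
  -- rests at `1` and then falls to `0`. One continuous formula thus covers both halves.
  set u : unitInterval → unitInterval := fun s => projIcc 0 1 zero_le_one (2 * (s : ℝ)) with hu
  set v : unitInterval → unitInterval := fun s => projIcc 0 1 zero_le_one (2 - 2 * (s : ℝ)) with hv
  have huc : Continuous u := continuous_projIcc.comp (by fun_prop)
  have hvc : Continuous v := continuous_projIcc.comp (by fun_prop)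
  have huv : ∀ s, u s = 1 ∨ v s = 1 := fun s => by
    rcases le_total (s : ℝ) (1 / 2) with hs | hs
    · right; exact projIcc_of_right_le _ (by linarith)
    · left; exact projIcc_of_right_le _ (by linarith)
  -- The loop follows `γ'` to `z + m + nt`, then returns along the translate of `γ` to `q + m + nt`.
  -- The linear corrections move the endpoints exactly onto these points without leaving the discs
  -- about the paths.
  set Γ : ℂ → unitInterval → ℂ := fun t s =>
    γ' (u s) + ((u s : ℝ) : ℂ) * (z + (m + n * t) - γ' 1)
      + (γ (v s) + ((v s : ℝ) : ℂ) * (z - γ 1)) - z with hΓ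
  have hγc := h.cont.continuous
  have hγc' := h'.cont.continuous
  have hΓv : ∀ t s, v s = 1 → Γ t s = γ' (u s) + ((u s : ℝ) : ℂ) * (z + (m + n * t) - γ' 1) := by
    intro t s hs
    simp only [hΓ, hs]; push_cast; simp
  have hΓu : ∀ t s, u s = 1 → Γ t s = γ (v s) + ((v s : ℝ) : ℂ) * (z - γ 1) + (m + n * t) := by
    intro t s hs
    simp only [hΓ, hs]; push_cast; simp; ring
  have hclose' : ∀ t ∈ ball τ r, ∀ s : unitInterval,
      γ' s + ((s : ℝ) : ℂ) * (z + (m + n * t) - γ' 1) ∈ ball (γ' s) ε' := by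
    intro t ht s
    have h1 := (hball t ht).2.2
    rw [mem_ball, dist_eq_norm] at h1 ⊢
    rw [add_sub_cancel_left, norm_mul, Complex.norm_real, Real.norm_of_nonneg s.2.1]
    exact lt_of_le_of_lt (mul_le_of_le_one_left (norm_nonneg _) s.2.2) h1
  have hclose : ∀ s : unitInterval, γ s + ((s : ℝ) : ℂ) * (z - γ 1) ∈ ball (γ s) ε := by
    intro s
    rw [mem_ball, dist_eq_norm] at hz ⊢
    rw [add_sub_cancel_left, norm_mul, Complex.norm_real, Real.norm_of_nonneg s.2.1]
    exact lt_of_le_of_lt (mul_le_of_le_one_left (norm_nonneg _) s.2.2) hz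
  have u0 : u 0 = 0 := by simp [hu]
  have u1 : u 1 = 1 := projIcc_of_right_le _ (by norm_num)
  have v0 : v 0 = 1 := projIcc_of_right_le _ (by norm_num)
  have v1 : v 1 = 0 := by simp [hv]
  have hΓ0 : ∀ t, Γ t 0 = q := fun t => by rw [hΓv t 0 v0, u0, h'.start]; simp
  have hΓ1 : ∀ t, Γ t 1 = q + (m + n * t) := fun t => by rw [hΓu t 1 u1, v1, h.start]; simp
  have hfam : D.IsLoopFamily (ball τ r) q m n Γ := by
    refine ⟨Continuous.continuousOn ?_, fun t ht => ⟨hΓ0 t, by rw [hΓ1]; ring, fun s => ?_⟩⟩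
    · simp only [hΓ]; fun_prop
    · rcases huv s with hs | hs
      · have hm : (γ (v s) + ((v s : ℝ) : ℂ) * (z - γ 1), t) ∈ D.regularSet V :=
          h.cont.subset (v s) ⟨hclose (v s), (hball t ht).1⟩
        rw [hΓu t s hs]
        exact ((mem_regularSet_add_iff D hVH m n).2 hm).2
      · rw [hΓv t s hs]
        exact (h'.cont.subset (u s) ⟨hclose' t ht (u s), (hball t ht).2.1⟩ :
          (_, t) ∈ D.regularSet V).2
  obtain ⟨ρ, hρ⟩ := hinv (ball τ r) isOpen_ball (convex_ball _ _).isPreconnected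
    (fun t ht => h.subset (hball t ht).1) m n Γ hfam
  refine ⟨ρ, ?_⟩
  filter_upwards [ball_mem_nhds τ hr] with t ht
  obtain ⟨H, H1, H2, H3, H4⟩ := hρ t ht
  obtain ⟨htN, htN', -⟩ := hball t ht
  rw [hΓ0] at H3
  rw [hΓ1] at H4
  -- The continuation `H` along the loop is read along `a` from its start to the midpoint, giving
  -- `F'`, and along `b` backwards from its end, giving `F ρ`. Both readings meet at the midpoint.
  set a : unitInterval → unitInterval := fun s => ⟨s / 2, by
    constructor <;> linarith [s.2.1, s.2.2]⟩ with ha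
  set b : unitInterval → unitInterval := fun s => ⟨1 - s / 2, by
    constructor <;> linarith [s.2.1, s.2.2]⟩ with hb
  have hac : Continuous a := Continuous.subtype_mk (by fun_prop) _
  have hbc : Continuous b := Continuous.subtype_mk (by fun_prop) _
  have hua : ∀ s, u (a s) = s := fun s => by
    simp only [hu, ha, mul_div_cancel₀ (s : ℝ) (two_ne_zero (α := ℝ)), projIcc_val]
  have hva : ∀ s, v (a s) = 1 := fun s => projIcc_of_right_le _ (by
    simp only [ha]; linarith [s.2.2])
  have hub : ∀ s, u (b s) = 1 := fun s => projIcc_of_right_le _ (by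
    simp only [hb]; linarith [s.2.2])
  have hvb : ∀ s, v (b s) = s := fun s => by
    have : (2 - 2 * (1 - (s : ℝ) / 2)) = s := by ring
    simp only [hv, hb, this, projIcc_val]
  have hab : a 1 = b 1 := by
    simp only [ha, hb]; norm_num
  have a0 : a 0 = 0 := by simp [ha]
  have b0 : b 0 = 1 := by simp [hb]
  set p' : unitInterval → ℂ := fun s => γ' s + ((s : ℝ) : ℂ) * (z + (m + n * t) - γ' 1) with hp'
  set p : unitInterval → ℂ := fun s => γ s + ((s : ℝ) : ℂ) * (z - γ 1) with hp
  have hp'c : Continuous p' := by simp only [hp']; fun_prop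
  have hpc : Continuous p := by simp only [hp]; fun_prop
  have e' : ∀ s, Γ t (a s) = p' s := fun s => by rw [hΓv t _ (hva s), hua]
  have e : ∀ s, Γ t (b s) = p s + (m + n * t) := fun s => by rw [hΓu t _ (hub s), hvb]
  have hsh : ∀ x : ℂ, Tendsto (fun w => w + (m + n * t)) (𝓝 x) (𝓝 (x + (m + n * t))) := fun x =>
    (by fun_prop : ContinuousAt (fun w : ℂ => w + (m + n * t)) x)
  have r1 : ∀ i j, H (a 1) (z + (m + n * t)) i j = F' 1 (z + (m + n * t)) t i j := by
    intro i j
    have := eventuallyEq_of_continuation hp'c (A := fun s w => H (a s) w i j)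
      (B := fun s w => F' s w t i j) (fun s => by rw [← e']; exact H1 (a s) i j)
      (fun s => h'.cont.analyticAt (hclose' t ht s) htN' i j)
      (fun s => by
        filter_upwards [hac.continuousAt.eventually (H2 (a s))] with s' hs'
        rw [e'] at hs'
        filter_upwards [hs'] with w hw
        rw [hw])
      (fun s => by
        filter_upwards [h'.cont.compat_near hp'c (hclose' t ht) s] with s' hs'
        filter_upwards [hs'] with w hw
        rw [hw t htN'])
      (by
        rw [← e', a0, hΓ0]
        filter_upwards [H3, ball_mem_nhds q h'.cont.pos] with w k1 k2
        rw [k1, h'.init w k2 t htN']) 1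
    have h1 := this.eq_of_nhds
    simpa [hp'] using h1
  have r2 : ∀ i j, H (b 1) (z + (m + n * t)) i j =
      (F 1 z t * (ρ : Matrix (Fin 2) (Fin 2) ℂ)) i j := by
    intro i j
    have := eventuallyEq_of_continuation hpc (A := fun s w => H (b s) (w + (m + n * t)) i j)
      (B := fun s w => (F s w t * (ρ : Matrix (Fin 2) (Fin 2) ℂ)) i j)
      (fun s => by
        have := H1 (b s) i j
        rw [e] at this
        exact AnalyticAt.fun_comp (g := fun w => H (b s) w i j)
          (f := fun w => w + (m + n * t)) this (by fun_prop))
      (fun s => by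
        simp only [Matrix.mul_apply, Fin.sum_univ_two]
        exact ((h.cont.analyticAt (hclose s) htN i 0).fun_mul analyticAt_const).fun_add
          ((h.cont.analyticAt (hclose s) htN i 1).fun_mul analyticAt_const))
      (fun s => by
        filter_upwards [hbc.continuousAt.eventually (H2 (b s))] with s' hs'
        rw [e] at hs'
        filter_upwards [(hsh (p s')).eventually hs'] with w hw
        rw [hw])
      (fun s => by
        filter_upwards [h.cont.compat_near hpc hclose s] with s' hs'
        filter_upwards [hs'] with w hw
        rw [hw t htN])
      (by
        have e0 := e 0
        rw [b0, hΓ1] at e0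
        have p0 : p 0 = q := (add_right_cancel e0).symm
        rw [p0, b0]
        filter_upwards [(hsh q).eventually H4, ball_mem_nhds q h.cont.pos] with w k1 k2
        rw [k1, h.init w k2 t htN, add_sub_cancel_right]) 1
    have h1 := this.eq_of_nhds
    simpa [hp] using h1
  ext i j
  rw [← r1, hab, r2]

end IsBranch

/-- The coefficient `∂_τ F · F⁻¹` of the second equation of the Pfaffian system solved by `F`. -/
noncomputable def tauCoeff (F : ℂ → ℂ → Matrix (Fin 2) (Fin 2) ℂ) (z τ : ℂ) :
    Matrix (Fin 2) (Fin 2) ℂ :=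
  (Matrix.of fun i j => deriv (fun t => F z t i j) τ) * (F z τ)⁻¹

theorem hasDerivAt_tauCoeff {F : ℂ → ℂ → Matrix (Fin 2) (Fin 2) ℂ} {W : Set (ℂ × ℂ)}
    (hW : IsOpen W) (hF : MatHolOn F W) {z τ : ℂ} (h : (z, τ) ∈ W) (hd : (F z τ).det ≠ 0)
    (i j : Fin 2) : HasDerivAt (fun t => F z t i j) ((tauCoeff F z τ * F z τ) i j) τ := by
  have h2 := (HolOn₂.differentiableAt_snd (f := fun z τ => F z τ i j) (hF i j) hW h).hasDerivAt
  refine h2.congr_deriv ?_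
  rw [tauCoeff, Matrix.nonsing_inv_mul_cancel_right _ _ hd.isUnit, Matrix.of_apply]

theorem holOn_tauCoeff {F : ℂ → ℂ → Matrix (Fin 2) (Fin 2) ℂ} {W : Set (ℂ × ℂ)}
    (hW : IsOpen W) (hF : MatHolOn F W) (hd : ∀ x ∈ W, (F x.1 x.2).det ≠ 0) :
    MatHolOn (tauCoeff F) W :=
  MatHolOn.mul (F := fun z τ => Matrix.of fun i j => deriv (fun t => F z t i j) τ)
    (fun i j => HolOn₂.deriv_snd (f := fun z τ => F z τ i j) (hF i j) hW) (hF.inv hd)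

variable {γ γ' : unitInterval → ℂ} {ε ε' : ℝ} {N N' : Set ℂ}
  {F F' : unitInterval → ℂ → ℂ → Matrix (Fin 2) (Fin 2) ℂ} {z τ : ℂ}

/-- The transition matrix is independent of the parameter and drops out of `∂_τF · F⁻¹`; the moving
translation contributes `-n ∂_zF · F⁻¹ = -n Q`. The case `m = n = 0` is independence of the branch.
-/
theorem IsBranch.tauCoeff_add (hinv : D.IsMInvariant Y q V) (hVH : ∀ τ ∈ V, 0 < τ.im)
    (h : D.IsBranch V q Y γ ε N F) (h' : D.IsBranch V q Y γ' ε' N' F') (hz : z ∈ ball (γ 1) ε)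
    (hτ : τ ∈ N) (hτ' : τ ∈ N') {m n : ℤ} (hz' : z + (m + n * τ) ∈ ball (γ' 1) ε') :
    tauCoeff (F' 1) (z + (m + n * τ)) τ = tauCoeff (F 1) z τ - (n : ℂ) • D.Q z τ := by
  obtain ⟨ρ, hρ⟩ := h.exists_transition hinv hVH h' hz hτ hτ' hz'
  have hm : (z, τ) ∈ D.regularSet V := h.cont.subset 1 ⟨hz, hτ⟩
  have hQ : D.Q (z + (m + n * τ)) τ = D.Q z τ :=
    D.Q_add (hVH τ hm.1) (int_add_int_mul_mem_lattice (hVH τ hm.1) m n) hm.2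
  have hd := h.det_ne_zero (s := 1) hz hτ
  have hd' := h'.det_ne_zero (s := 1) hz' hτ'
  set w := z + (m + n * τ) with hw
  have e0 : F' 1 w τ = F 1 z τ * ρ := hρ.self_of_nhds
  have key : (n : ℂ) • (D.Q z τ * F' 1 w τ) + tauCoeff (F' 1) w τ * F' 1 w τ
      = tauCoeff (F 1) z τ * F 1 z τ * ρ := by
    ext i j
    have hu : HasDerivAt (fun s : ℂ => z + (m + n * s)) (n : ℂ) τ := by
      simpa using (((hasDerivAt_id' τ).const_mul (n : ℂ)).const_add (m : ℂ)).const_add z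
    have d1 := HolOn₂.hasDerivAt_comp_graph (f := fun z τ => F' 1 z τ i j) (h'.cont.holOn 1 i j)
      (h'.cont.isOpen_prod 1) (u := fun s => z + (m + n * s)) ⟨hz', hτ'⟩
      (h'.cont.solves 1 w hz' τ hτ' i j)
      (hasDerivAt_tauCoeff (h'.cont.isOpen_prod 1) (h'.cont.holOn 1) ⟨hz', hτ'⟩ hd' i j) hu
    have d2 := hasDerivAt_matrix_mul_const
      (hasDerivAt_tauCoeff (h.cont.isOpen_prod 1) (h.cont.holOn 1) ⟨hz, hτ⟩ hd) ρ i j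
    have d3 := d2.congr_of_eventuallyEq
      (f₁ := fun t => F' 1 (z + (m + n * t)) t i j) (hρ.mono fun t ht => by
        simp only [ht])
    have := d1.unique d3
    rw [hQ] at this
    simpa [Matrix.add_apply, Matrix.smul_apply] using this
  rw [Matrix.mul_assoc, ← e0] at key
  have k2 : ((n : ℂ) • D.Q z τ + tauCoeff (F' 1) w τ) * F' 1 w τ
      = tauCoeff (F 1) z τ * F' 1 w τ := by
    rw [Matrix.add_mul, Matrix.smul_mul, key]
  have k3 := congrArg (fun A => A * (F' 1 w τ)⁻¹) k2
  simp only [Matrix.mul_nonsing_inv_cancel_right _ _ hd'.isUnit] at k3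
  rw [← k3, add_sub_cancel_left]

/-- An `M`-invariant fundamental solution yields a single-valued Pfaffian system. -/
theorem exists_pfaffian_of_isMInvariant (hV : IsOpen V) (hVH : ∀ τ ∈ V, 0 < τ.im)
    (hp : DifferentiableOn ℂ D.p V) (hA : DifferentiableOn ℂ D.A V) (hB : DifferentiableOn ℂ D.B V)
    {U : Set ℂ} (hU : IsOpen U) (hq : q ∈ U) (hUX : U ×ˢ V ⊆ D.regularSet V)
    (hY : D.IsFundamentalSolution Y U V) (hinv : D.IsMInvariant Y q V) :
    ∃ Ω : ℂ → ℂ → Matrix (Fin 2) (Fin 2) ℂ, MatHolOn Ω (D.regularSet V) ∧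
      (∀ z τ : ℂ, (z, τ) ∈ D.regularSet V →
        Ω (z + 1) τ = Ω z τ ∧ Ω (z + τ) τ = Ω z τ - D.Q z τ) ∧
      D.IsCompletelyIntegrable Ω (D.regularSet V) := by
  choose! γ ε F hbr hend using fun z τ (hz : (z, τ) ∈ D.regularSet V) =>
    D.exists_isBranch hV hVH hp hA hB hU hq hUX hY hz
  -- Each point uses its own chosen branch. Independence of the branch makes `Ω` agree locally with
  -- the coefficient of a single branch, hence holomorphic.
  set Ω : ℂ → ℂ → Matrix (Fin 2) (Fin 2) ℂ := fun z τ => tauCoeff (F z τ 1) z τ with hΩ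
  have hself : ∀ z τ, (z, τ) ∈ D.regularSet V → z ∈ ball (γ z τ 1) (ε z τ) ∧
      τ ∈ ball τ (ε z τ) := fun z τ hz => by
    have := (hbr z τ hz).cont.pos
    rw [hend z τ hz]
    exact ⟨mem_ball_self this, mem_ball_self this⟩
  have hloc : ∀ z₀ τ₀, (z₀, τ₀) ∈ D.regularSet V →
      ∀ z ∈ ball (γ z₀ τ₀ 1) (ε z₀ τ₀), ∀ τ ∈ ball τ₀ (ε z₀ τ₀),
        Ω z τ = tauCoeff (F z₀ τ₀ 1) z τ := by
    intro z₀ τ₀ h0 z hz τ hτ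
    have hX : (z, τ) ∈ D.regularSet V := (hbr z₀ τ₀ h0).cont.subset 1 ⟨hz, hτ⟩
    have := (hbr z τ hX).tauCoeff_add hinv hVH (hbr z₀ τ₀ h0) (hself z τ hX).1 (hself z τ hX).2 hτ
      (m := 0) (n := 0) (by simpa using hz)
    simpa using this.symm
  have hnb : ∀ z₀ τ₀, (z₀, τ₀) ∈ D.regularSet V →
      (z₀, τ₀) ∈ ball (γ z₀ τ₀ 1) (ε z₀ τ₀) ×ˢ ball τ₀ (ε z₀ τ₀) := fun z₀ τ₀ h0 => hself z₀ τ₀ h0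
  have hdet : ∀ z₀ τ₀, (z₀, τ₀) ∈ D.regularSet V →
      ∀ x ∈ ball (γ z₀ τ₀ 1) (ε z₀ τ₀) ×ˢ ball τ₀ (ε z₀ τ₀), (F z₀ τ₀ 1 x.1 x.2).det ≠ 0 :=
    fun z₀ τ₀ h0 x hx => (hbr z₀ τ₀ h0).det_ne_zero hx.1 hx.2
  have hper : ∀ (m n : ℤ) z τ, (z, τ) ∈ D.regularSet V →
      Ω (z + (m + n * τ)) τ = Ω z τ - (n : ℂ) • D.Q z τ := by
    intro m n z τ hX
    have hX' := (mem_regularSet_add_iff D hVH m n).2 hX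
    exact (hbr z τ hX).tauCoeff_add hinv hVH (hbr _ τ hX') (hself z τ hX).1 (hself z τ hX).2
      (hself _ τ hX').2 (hself _ τ hX').1
  refine ⟨Ω, fun i j => ?_, fun z τ hz => ⟨?_, ?_⟩, ?_⟩
  · rintro ⟨z₀, τ₀⟩ h0
    have hWo := (hbr z₀ τ₀ h0).cont.isOpen_prod 1
    have h1 := holOn_tauCoeff hWo ((hbr z₀ τ₀ h0).cont.holOn 1) (hdet z₀ τ₀ h0) i j
    have h2 := h1.differentiableAt (hWo.mem_nhds (hnb z₀ τ₀ h0))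
    refine (h2.congr_of_eventuallyEq ?_).differentiableWithinAt
    filter_upwards [hWo.mem_nhds (hnb z₀ τ₀ h0)] with x hx
    rw [hloc z₀ τ₀ h0 x.1 hx.1 x.2 hx.2]
  · simpa using hper 1 0 z τ hz
  · simpa using hper 0 1 z τ hz
  · rintro ⟨z₀, τ₀⟩ h0
    have hc := (hbr z₀ τ₀ h0).cont
    refine ⟨_, hc.isOpen_prod 1, hnb z₀ τ₀ h0, hc.subset 1, F z₀ τ₀ 1, hc.holOn 1,
      fun z τ hz => ⟨hdet z₀ τ₀ h0 (z, τ) hz, hc.solves 1 z hz.1 τ hz.2, ?_⟩⟩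
    rw [hloc z₀ τ₀ h0 z hz.1 τ hz.2]
    exact hasDerivAt_tauCoeff (hc.isOpen_prod 1) (hc.holOn 1) hz (hdet z₀ τ₀ h0 (z, τ) hz)

end GenLame.LameData

/-! ### Zero curvature, the deformation equation and gluing by oddness. -/

namespace GenLame.LameData

variable (D : LameData) {V : Set ℂ} {Ω : ℂ → ℂ → Matrix (Fin 2) (Fin 2) ℂ} {z τ : ℂ}

theorem hasDerivAt_Q_snd {i' : ℂ} (h : HasDerivAt (fun t => D.potential z t) i' τ) (i j : Fin 2) :
    HasDerivAt (fun t => D.Q z t i j) ((!![0, 0; i', 0] : Matrix (Fin 2) (Fin 2) ℂ) i j) τ := by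
  fin_cases i <;> fin_cases j <;> simp [Q, h, hasDerivAt_const]

/-- The integrability condition of the Pfaffian system. -/
theorem zero_curvature (hX : IsOpen (D.regularSet V)) (hI : HolOn₂ D.potential (D.regularSet V))
    (hΩ : MatHolOn Ω (D.regularSet V)) (hint : D.IsCompletelyIntegrable Ω (D.regularSet V))
    (hz : (z, τ) ∈ D.regularSet V) (i j : Fin 2) :
    HasDerivAt (fun w => Ω w τ i j) ((!![0, 0; deriv (fun t => D.potential z t) τ, 0]
      + D.Q z τ * Ω z τ - Ω z τ * D.Q z τ) i j) z := by
  obtain ⟨W, hWo, hzW, hWX, Y, hY, hYW⟩ := hint (z, τ) hz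
  set Q' : Matrix (Fin 2) (Fin 2) ℂ := !![0, 0; deriv (fun t => D.potential z t) τ, 0] with hQ'
  set Ω' : Matrix (Fin 2) (Fin 2) ℂ := Matrix.of fun i j => deriv (fun w => Ω w τ i j) z with hΩ'
  have hΩd : ∀ i j, HasDerivAt (fun w => Ω w τ i j) (Ω' i j) z := fun i j =>
    (HolOn₂.differentiableAt_fst (f := fun z τ => Ω z τ i j) (hΩ i j) hX hz).hasDerivAt
  obtain ⟨hdet, hYz, hYτ⟩ := hYW z τ hzW
  have hQd := D.hasDerivAt_Q_snd (hI.differentiableAt_snd hX hz).hasDerivAt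
  have d1 := hasDerivAt_matrix_mul hΩd hYz
  have d2 := hasDerivAt_matrix_mul hQd hYτ
  -- Equality of the mixed partials of `Y`; the invertible factor `Y` is cancelled afterwards.
  have key : Ω' * Y z τ + Ω z τ * (D.Q z τ * Y z τ)
      = Q' * Y z τ + D.Q z τ * (Ω z τ * Y z τ) := by
    ext i j
    have h := HolOn₂.hasDerivAt_fst_deriv_snd (f := fun z τ => Y z τ i j) (hY i j) hWo hzW
    have n1 : ∀ᶠ w in 𝓝 z, (w, τ) ∈ W :=
      (by fun_prop : ContinuousAt (fun w : ℂ => (w, τ)) z).eventually (hWo.mem_nhds hzW)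
    have n2 : ∀ᶠ t in 𝓝 τ, (z, t) ∈ W :=
      (by fun_prop : ContinuousAt (fun t : ℂ => (z, t)) τ).eventually (hWo.mem_nhds hzW)
    have e1 : (fun w => deriv (fun t => Y w t i j) τ) =ᶠ[𝓝 z] fun w => (Ω w τ * Y w τ) i j := by
      filter_upwards [n1] with w hw
      exact ((hYW w τ hw).2.2 i j).deriv
    have e2 : (fun t => deriv (fun w => Y w t i j) z) =ᶠ[𝓝 τ] fun t => (D.Q z t * Y z t) i j := by
      filter_upwards [n2] with t ht
      exact ((hYW z t ht).2.1 i j).deriv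
    rw [e2.deriv_eq, (d2 i j).deriv] at h
    exact ((d1 i j).congr_of_eventuallyEq e1).unique h
  have k2 : Ω' * Y z τ = (Q' + D.Q z τ * Ω z τ - Ω z τ * D.Q z τ) * Y z τ := by
    rw [Matrix.sub_mul, Matrix.add_mul, Matrix.mul_assoc, Matrix.mul_assoc, ← key,
      add_sub_cancel_right]
  have k3 := congrArg (fun A => A * (Y z τ)⁻¹) k2
  simp only [Matrix.mul_nonsing_inv_cancel_right _ _ hdet.isUnit] at k3
  rw [← k3]
  exact hΩd i j

/-- Zero curvature gives `Ω₁₂' = Ω₂₂ - Ω₁₁` and then `Ω₁₂'' = 2(I Ω₁₂ - Ω₂₁)`. One more derivative,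
with `Ω₂₁' = ∂_τI - I Ω₁₂'`, eliminates the other entries. -/
theorem solvesDeformationEquation_of_isCompletelyIntegrable (hX : IsOpen (D.regularSet V))
    (hI : HolOn₂ D.potential (D.regularSet V)) (hΩ : MatHolOn Ω (D.regularSet V))
    (hint : D.IsCompletelyIntegrable Ω (D.regularSet V)) :
    D.SolvesDeformationEquation (fun z τ => Ω z τ 0 1) (D.regularSet V) := by
  intro z τ hz
  have hcurv := fun z (hz : (z, τ) ∈ D.regularSet V) => D.zero_curvature hX hI hΩ hint hz
  have n1 : ∀ᶠ w in 𝓝 z, (w, τ) ∈ D.regularSet V :=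
    (by fun_prop : ContinuousAt (fun w : ℂ => (w, τ)) z).eventually (hX.mem_nhds hz)
  have ha : ∀ z, (z, τ) ∈ D.regularSet V → HasDerivAt (fun w => Ω w τ 0 0)
      (Ω z τ 1 0 - Ω z τ 0 1 * D.potential z τ) z := fun z hz =>
    (hcurv z hz 0 0).congr_deriv (by
      simp only [Matrix.sub_apply, Matrix.add_apply, Matrix.mul_apply, Fin.sum_univ_two]
      simp [Q])
  have hb : ∀ z, (z, τ) ∈ D.regularSet V → HasDerivAt (fun w => Ω w τ 0 1)
      (Ω z τ 1 1 - Ω z τ 0 0) z := fun z hz =>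
    (hcurv z hz 0 1).congr_deriv (by
      simp only [Matrix.sub_apply, Matrix.add_apply, Matrix.mul_apply, Fin.sum_univ_two]
      simp [Q])
  have hc : ∀ z, (z, τ) ∈ D.regularSet V → HasDerivAt (fun w => Ω w τ 1 0)
      (deriv (fun t => D.potential z t) τ + D.potential z τ * Ω z τ 0 0
        - Ω z τ 1 1 * D.potential z τ) z := fun z hz =>
    (hcurv z hz 1 0).congr_deriv (by
      simp only [Matrix.sub_apply, Matrix.add_apply, Matrix.mul_apply, Fin.sum_univ_two]
      simp [Q])
  have hd : ∀ z, (z, τ) ∈ D.regularSet V → HasDerivAt (fun w => Ω w τ 1 1)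
      (D.potential z τ * Ω z τ 0 1 - Ω z τ 1 0) z := fun z hz =>
    (hcurv z hz 1 1).congr_deriv (by
      simp only [Matrix.sub_apply, Matrix.add_apply, Matrix.mul_apply, Fin.sum_univ_two]
      simp [Q])
  have hIz := (hI.differentiableAt_fst hX hz).hasDerivAt
  have e1 : ∀ z, (z, τ) ∈ D.regularSet V → deriv (fun w => Ω w τ 0 1) =ᶠ[𝓝 z]
      fun w => Ω w τ 1 1 - Ω w τ 0 0 := fun z hz => by
    have n1 : ∀ᶠ w in 𝓝 z, (w, τ) ∈ D.regularSet V :=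
      (by fun_prop : ContinuousAt (fun w : ℂ => (w, τ)) z).eventually (hX.mem_nhds hz)
    filter_upwards [n1] with w hw
    exact (hb w hw).deriv
  have e2 : deriv (deriv (fun w => Ω w τ 0 1)) =ᶠ[𝓝 z]
      fun w => 2 * (D.potential w τ * Ω w τ 0 1 - Ω w τ 1 0) := by
    filter_upwards [n1] with w hw
    rw [(e1 w hw).deriv_eq, ((hd w hw).fun_sub (ha w hw)).deriv]
    ring
  rw [iteratedDeriv_succ, iteratedDeriv_succ, iteratedDeriv_one, e2.deriv_eq,
    (((hIz.fun_mul (hb z hz)).fun_sub (hc z hz)).const_mul 2).deriv, (hb z hz).deriv]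
  ring

/-- A single-valued solution of the deformation equation with the required quasi-periodicity. -/
structure IsDeformation (V : Set ℂ) (f : ℂ → ℂ → ℂ) : Prop where
  holOn : DifferentiableOn ℂ (fun x : ℂ × ℂ => f x.1 x.2) (D.regularSet V)
  solves : D.SolvesDeformationEquation f (D.regularSet V)
  periodic : ∀ z τ : ℂ, (z, τ) ∈ D.regularSet V → f (z + 1) τ = f z τ ∧ f (z + τ) τ = f z τ - 1

variable {D} {f g : ℂ → ℂ → ℂ}

theorem iteratedDeriv_three_comp_neg (h : ℂ → ℂ) (z : ℂ) :
    iteratedDeriv 3 (fun w => h (-w)) z = -iteratedDeriv 3 h (-z) := by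
  rw [iteratedDeriv_comp_neg]
  norm_num

theorem contDiffAt_of_holOn {n : ℕ} (hf : HolOn₂ f (D.regularSet V)) (hX : IsOpen (D.regularSet V))
    (hz : (z, τ) ∈ D.regularSet V) : ContDiffAt ℂ n (fun w => f w τ) z := by
  have : AnalyticAt ℂ (fun w => f w τ) z := by
    rw [Complex.analyticAt_iff_eventually_differentiableAt]
    have n1 : ∀ᶠ w in 𝓝 z, (w, τ) ∈ D.regularSet V :=
      (by fun_prop : ContinuousAt (fun w : ℂ => (w, τ)) z).eventually (hX.mem_nhds hz)
    filter_upwards [n1] with w hw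
    exact hf.differentiableAt_fst hX hw
  exact this.contDiffAt

theorem neg_mem_regularSet (hVH : ∀ τ ∈ V, 0 < τ.im) :
    (-z, τ) ∈ D.regularSet V ↔ (z, τ) ∈ D.regularSet V :=
  and_congr_right fun h => not_congr (isSingular_neg_iff D (hVH τ h))

theorem deriv_potential_neg (hVH : ∀ τ ∈ V, 0 < τ.im) (hτ : τ ∈ V) :
    deriv (fun w => D.potential w τ) (-z) = -deriv (fun w => D.potential w τ) z := by
  have h : (fun w => D.potential (-w) τ) = fun w => D.potential w τ :=
    funext fun w => D.potential_neg (hVH τ hτ) w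
  have := deriv_comp_neg (fun w => D.potential w τ) z
  rw [h] at this
  rw [this, neg_neg]

theorem deriv_potential_snd_neg (hV : IsOpen V) (hVH : ∀ τ ∈ V, 0 < τ.im) (hτ : τ ∈ V) :
    deriv (fun t => D.potential (-z) t) τ = deriv (fun t => D.potential z t) τ := by
  refine Filter.EventuallyEq.deriv_eq ?_
  filter_upwards [hV.mem_nhds hτ] with t ht
  exact D.potential_neg (hVH t ht) z

/-- The odd part of a deformation is a deformation. -/
theorem IsDeformation.oddPart (hV : IsOpen V) (hVH : ∀ τ ∈ V, 0 < τ.im)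
    (hX : IsOpen (D.regularSet V)) (hf : D.IsDeformation V f) :
    D.IsDeformation V (fun z τ => (f z τ - f (-z) τ) / 2) := by
  have hneg : HolOn₂ (fun z τ => f (-z) τ) (D.regularSet V) :=
    DifferentiableOn.comp (g := fun x : ℂ × ℂ => f x.1 x.2) hf.holOn
      (f := fun x : ℂ × ℂ => (-x.1, x.2)) (by fun_prop)
      (fun x hx => (neg_mem_regularSet hVH).2 hx)
  refine ⟨?_, fun z τ hz => ?_, fun z τ hz => ?_⟩
  · simp only [div_eq_mul_inv]
    exact DifferentiableOn.mul_const (hf.holOn.fun_sub hneg) (2⁻¹ : ℂ)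
  · have hz' := (neg_mem_regularSet hVH).2 hz
    have c1 := contDiffAt_of_holOn (n := 3) hf.holOn hX hz
    have c2 := contDiffAt_of_holOn (n := 3) hneg hX hz
    have e1 := hf.solves z τ hz
    -- As `I` and `∂_τI` are even in `z` and `I'` is odd, `-f(-z)` solves the same inhomogeneous
    -- equation as `f`.
    have e2 := hf.solves (-z) τ hz'
    rw [D.potential_neg (hVH τ hz.1), deriv_potential_neg hVH hz.1,
      deriv_potential_snd_neg hV hVH hz.1] at e2
    have i3 : iteratedDeriv 3 (fun w => (f w τ - f (-w) τ) / 2) z =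
        (iteratedDeriv 3 (fun w => f w τ) z + iteratedDeriv 3 (fun w => f w τ) (-z)) / 2 := by
      rw [iteratedDeriv_div_const, iteratedDeriv_fun_sub c1 c2,
        iteratedDeriv_three_comp_neg (fun w => f w τ)]
      ring
    have i1 : deriv (fun w => (f w τ - f (-w) τ) / 2) z =
        (deriv (fun w => f w τ) z + deriv (fun w => f w τ) (-z)) / 2 := by
      rw [deriv_div_const, deriv_fun_sub (c1.differentiableAt (by norm_num))
        (c2.differentiableAt (by norm_num)), deriv_comp_neg (fun w => f w τ)]
      ring
    rw [i3, i1]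
    linear_combination e1 / 2 + e2 / 2
  · have hz' := (neg_mem_regularSet hVH).2 hz
    obtain ⟨a1, a2⟩ := hf.periodic z τ hz
    have m1 : (-z - 1, τ) ∈ D.regularSet V := by
      have := (mem_regularSet_add_iff D hVH (z := -z) (-1) 0).2 hz'
      simpa [sub_eq_add_neg] using this
    have m2 : (-z - τ, τ) ∈ D.regularSet V := by
      have := (mem_regularSet_add_iff D hVH (z := -z) 0 (-1)).2 hz'
      simpa [sub_eq_add_neg] using this
    have b1 := (hf.periodic _ τ m1).1
    have b2 := (hf.periodic _ τ m2).2
    rw [sub_add_cancel] at b1 b2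
    rw [show -(z + 1) = -z - 1 by ring, show -(z + τ) = -z - τ by ring, a1, a2, ← b1]
    refine ⟨rfl, ?_⟩
    rw [b2]; ring

/-- Two odd deformations agree. -/
theorem IsDeformation.eq_of_odd {V' : Set ℂ} (hVH : ∀ τ ∈ V, 0 < τ.im)
    (hn : ∀ (k : Fin 4) (m : ℤ), D.n k ≠ 1 / 2 + (m : ℂ))
    (hp2 : ∀ τ ∈ V, ¬ IsTwoTorsion (D.p τ) τ)
    (hX : IsOpen (D.regularSet V)) (hX' : IsOpen (D.regularSet V')) (hf : D.IsDeformation V f)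
    (hg : D.IsDeformation V' g) (hfo : ∀ z τ, f (-z) τ = -f z τ) (hgo : ∀ z τ, g (-z) τ = -g z τ)
    (hz : (z, τ) ∈ D.regularSet V) (hτ' : τ ∈ V') : f z τ = g z τ := by
  have hτ := hz.1
  have hm : ∀ z, ¬ D.IsSingular z τ → (z, τ) ∈ D.regularSet V := fun z h => ⟨hτ, h⟩
  have hm' : ∀ z, ¬ D.IsSingular z τ → (z, τ) ∈ D.regularSet V' := fun z h => ⟨hτ', h⟩
  -- In the difference the inhomogeneous terms and the quasi-periods `-1` cancel, leaving an odd
  -- elliptic solution of the symmetric square equation.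
  have key := D.eq_zero_of_odd_elliptic_solution (f := fun z => f z τ - g z τ) (hVH τ hτ)
    (hp2 τ hτ) hn (fun z h => (HolOn₂.differentiableAt_fst hf.holOn hX (hm z h)).fun_sub
      (HolOn₂.differentiableAt_fst hg.holOn hX' (hm' z h))) (fun z h => by
      have c1 := contDiffAt_of_holOn (n := 3) hf.holOn hX (hm z h)
      have c2 := contDiffAt_of_holOn (n := 3) hg.holOn hX' (hm' z h)
      rw [iteratedDeriv_fun_sub c1 c2, deriv_fun_sub (c1.differentiableAt (by norm_num))
        (c2.differentiableAt (by norm_num))]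
      linear_combination hf.solves z τ (hm z h) - hg.solves z τ (hm' z h))
    (fun z h => by rw [(hf.periodic z τ (hm z h)).1, (hg.periodic z τ (hm' z h)).1])
    (fun z h => by
      rw [(hf.periodic z τ (hm z h)).2, (hg.periodic z τ (hm' z h)).2, sub_sub_sub_cancel_right])
    (fun z h => by rw [hfo, hgo]; ring) hz.2
  exact sub_eq_zero.1 key

theorem SolvesDeformationEquation.congr {X : Set (ℂ × ℂ)} (hX : IsOpen X)
    (hf : D.SolvesDeformationEquation f X) (h : ∀ x ∈ X, g x.1 x.2 = f x.1 x.2) :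
    D.SolvesDeformationEquation g X := by
  intro z τ hz
  have n1 : ∀ᶠ w in 𝓝 z, (w, τ) ∈ X :=
    (by fun_prop : ContinuousAt (fun w : ℂ => (w, τ)) z).eventually (hX.mem_nhds hz)
  have e : (fun w => g w τ) =ᶠ[𝓝 z] fun w => f w τ := n1.mono fun w hw => h _ hw
  rw [e.iteratedDeriv_eq, e.deriv_eq, h (z, τ) hz]
  exact hf z τ hz

/-- Each local M-invariant solution yields a deformation over a small parameter set, depending on
choices. Its odd part does not depend on them, so the local odd parts glue. -/
theorem exists_isDeformation_of_isMonodromyPreserving (hVH : ∀ τ ∈ V, 0 < τ.im)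
    (hn : ∀ (k : Fin 4) (m : ℤ), D.n k ≠ 1 / 2 + (m : ℂ))
    (hp : DifferentiableOn ℂ D.p V) (hA : DifferentiableOn ℂ D.A V) (hB : DifferentiableOn ℂ D.B V)
    (hp2 : ∀ τ ∈ V, ¬ IsTwoTorsion (D.p τ) τ) (h : D.IsMonodromyPreserving V) :
    ∃ f, D.IsDeformation V f := by
  have hloc : ∀ τ₀ ∈ V, ∃ (N : Set ℂ) (f : ℂ → ℂ → ℂ), IsOpen N ∧ τ₀ ∈ N ∧ N ⊆ V ∧
      D.IsDeformation N f ∧ ∀ z τ, f (-z) τ = -f z τ := by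
    intro τ₀ hτ₀
    obtain ⟨N, hN, hτN, hNV, q, U, hU, hq, hUX, Y, hY, hinv⟩ := h τ₀ hτ₀
    have hVH' : ∀ τ ∈ N, 0 < τ.im := fun τ hτ => hVH τ (hNV hτ)
    have hX := D.isOpen_regularSet hN hVH' (hp.mono hNV)
    have hI := D.holOn₂_potential hVH' (hp.mono hNV) (hA.mono hNV) (hB.mono hNV)
    obtain ⟨Ω, hΩ, hper, hint⟩ := exists_pfaffian_of_isMInvariant hN hVH' (hp.mono hNV)
      (hA.mono hNV) (hB.mono hNV) hU hq (fun x hx => ⟨hx.2, (hUX hx).2⟩) hY hinv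
    have hdef : D.IsDeformation N (fun z τ => Ω z τ 0 1) :=
      ⟨hΩ 0 1, D.solvesDeformationEquation_of_isCompletelyIntegrable hX hI hΩ hint,
        fun z τ hz => by
          obtain ⟨h1, h2⟩ := hper z τ hz
          rw [h1, h2]
          exact ⟨rfl, by simp [Q]⟩⟩
    refine ⟨N, _, hN, hτN, hNV, hdef.oddPart hN hVH' hX, fun z τ => ?_⟩
    simp only [neg_neg]; ring
  choose! N f hN hτN hNV hf hfo using hloc
  have hXN : ∀ τ₀ ∈ V, IsOpen (D.regularSet (N τ₀)) := fun τ₀ hτ₀ =>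
    D.isOpen_regularSet (hN τ₀ hτ₀) (fun τ hτ => hVH τ (hNV τ₀ hτ₀ hτ)) (hp.mono (hNV τ₀ hτ₀))
  -- At each `τ` the local solution centred at that same `τ` is used; uniqueness identifies it with
  -- any other local solution defined there.
  set g : ℂ → ℂ → ℂ := fun z τ => f τ z τ with hg
  have hgf : ∀ τ₀ ∈ V, ∀ x ∈ D.regularSet (N τ₀), g x.1 x.2 = f τ₀ x.1 x.2 := by
    rintro τ₀ hτ₀ ⟨z, τ⟩ hz
    have hτ := hNV τ₀ hτ₀ hz.1
    exact IsDeformation.eq_of_odd (f := f τ) (fun t ht => hVH t (hNV τ hτ ht)) hn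
      (fun t ht => hp2 t (hNV τ hτ ht)) (hXN τ hτ)
      (hXN τ₀ hτ₀) (hf τ hτ) (hf τ₀ hτ₀) (hfo τ hτ) (hfo τ₀ hτ₀) ⟨hτN τ hτ, hz.2⟩ hz.1
  refine ⟨g, ?_, fun z τ hz => ?_, fun z τ hz => ?_⟩
  · rintro ⟨z, τ⟩ hz
    have hm : (z, τ) ∈ D.regularSet (N τ) := ⟨hτN τ hz.1, hz.2⟩
    have hnb := (hXN τ hz.1).mem_nhds hm
    refine (((hf τ hz.1).holOn.differentiableAt hnb).congr_of_eventuallyEq ?_).differentiableWithinAt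
    filter_upwards [hnb] with x hx
    exact hgf τ hz.1 x hx
  · exact ((hf τ hz.1).solves.congr (hXN τ hz.1) (hgf τ hz.1)) z τ ⟨hτN τ hz.1, hz.2⟩
  · exact (hf τ hz.1).periodic z τ ⟨hτN τ hz.1, hz.2⟩

end GenLame.LameData

/-! ### From the deformation equation to an integrable Pfaffian system. -/

/-- Local solvability of a Pfaffian system of zero curvature. -/
theorem exists_pfaffian_solution {M Ω : ℂ → ℂ → Matrix (Fin 2) (Fin 2) ℂ}
    {M' : ℂ → ℂ → Matrix (Fin 2) (Fin 2) ℂ} {X : Set (ℂ × ℂ)} (hX : IsOpen X) (hM : MatHolOn M X)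
    (hΩ : MatHolOn Ω X)
    (hMτ : ∀ z τ, (z, τ) ∈ X → ∀ i j, HasDerivAt (fun t => M z t i j) (M' z τ i j) τ)
    (hcurv : ∀ z τ, (z, τ) ∈ X → ∀ i j, HasDerivAt (fun w => Ω w τ i j)
      ((M' z τ + M z τ * Ω z τ - Ω z τ * M z τ) i j) z) {z₀ τ₀ : ℂ} (h0 : (z₀, τ₀) ∈ X) :
    ∃ W : Set (ℂ × ℂ), IsOpen W ∧ (z₀, τ₀) ∈ W ∧ W ⊆ X ∧
      ∃ Y : ℂ → ℂ → Matrix (Fin 2) (Fin 2) ℂ, MatHolOn Y W ∧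
        ∀ z τ : ℂ, (z, τ) ∈ W → (Y z τ).det ≠ 0 ∧
          (∀ i j, HasDerivAt (fun w => Y w τ i j) ((M z τ * Y z τ) i j) z) ∧
          (∀ i j, HasDerivAt (fun t => Y z t i j) ((Ω z τ * Y z τ) i j) τ) := by
  obtain ⟨r₁, hr₁, hs₁, Φ, hΦ, hΦ0, hΦd⟩ := exists_fundamental hX hM h0
  obtain ⟨r₂, hr₂, hs₂, Ψ, hΨ, -, hΨd⟩ := exists_fundamental
    (M := fun s t => Ω t s) (W := Prod.swap ⁻¹' X) (hX.preimage continuous_swap)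
    (fun i j => HolOn₂.swap (f := fun z τ => Ω z τ i j) (hΩ i j)) (z₀ := τ₀) (τ₀ := z₀) h0
  set r := min r₁ r₂
  have hr : 0 < r := lt_min hr₁ hr₂
  have b1 : ∀ x : ℂ, ball x r ⊆ ball x r₁ := fun x => ball_subset_ball (min_le_left _ _)
  have b2 : ∀ x : ℂ, ball x r ⊆ ball x r₂ := fun x => ball_subset_ball (min_le_right _ _)
  set W := ball z₀ r ×ˢ ball τ₀ r with hW
  have hWo : IsOpen W := isOpen_ball.prod isOpen_ball
  have hWX : W ⊆ X := (prod_mono (b1 _) (b1 _)).trans hs₁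
  have hzz : z₀ ∈ ball z₀ r := mem_ball_self hr
  have hΨ' : MatHolOn (fun _ τ => Ψ τ z₀) W := by
    intro i j
    refine DifferentiableOn.comp (g := fun x : ℂ × ℂ => Ψ x.1 x.2 i j)
      (f := fun x : ℂ × ℂ => (x.2, z₀)) (hΨ i j) (by fun_prop) ?_
    rintro ⟨u, v⟩ ⟨-, hv⟩
    exact ⟨b2 _ hv, b2 _ hzz⟩
  have hΦ' : MatHolOn Φ W := hΦ.mono (prod_mono (b1 _) (b1 _))
  -- `Ψ` solves the `τ`-equation on the line `z = z₀`, and `Φ`, equal to `1` on that line, extends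
  -- it by the `z`-equation.
  set Y : ℂ → ℂ → Matrix (Fin 2) (Fin 2) ℂ := fun z τ => Φ z τ * Ψ τ z₀ with hYdef
  have hY : MatHolOn Y W := hΦ'.mul hΨ'
  have hYd : ∀ z ∈ ball z₀ r, ∀ τ ∈ ball τ₀ r, (Y z τ).det ≠ 0 := fun z hz τ hτ => by
    simp only [hYdef, Matrix.det_mul]
    exact mul_ne_zero (hΦd z (b1 _ hz) τ (b1 _ hτ)).1 (hΨd τ (b2 _ hτ) z₀ (b2 _ hzz)).1
  have hYz : ∀ z ∈ ball z₀ r, ∀ τ ∈ ball τ₀ r, ∀ i j,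
      HasDerivAt (fun w => Y w τ i j) ((M z τ * Y z τ) i j) z := fun z hz τ hτ i j => by
    have := hasDerivAt_matrix_mul_const (hΦd z (b1 _ hz) τ (b1 _ hτ)).2 (Ψ τ z₀) i j
    rwa [Matrix.mul_assoc] at this
  set T : ℂ → ℂ → Matrix (Fin 2) (Fin 2) ℂ := fun z τ =>
    Matrix.of fun i j => deriv (fun t => Y z t i j) τ with hT
  have hYT : ∀ z ∈ ball z₀ r, ∀ τ ∈ ball τ₀ r, ∀ i j,
      HasDerivAt (fun t => Y z t i j) (T z τ i j) τ := fun z hz τ hτ i j =>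
    (HolOn₂.differentiableAt_snd (f := fun z τ => Y z τ i j) (hY i j) hWo ⟨hz, hτ⟩).hasDerivAt
  -- The defect in the `τ`-equation. Zero curvature says exactly that it solves `∂_zR = M R`; it
  -- vanishes at `z₀`, hence everywhere.
  set R : ℂ → ℂ → Matrix (Fin 2) (Fin 2) ℂ := fun z τ => T z τ - Ω z τ * Y z τ with hR
  have hRz : ∀ z ∈ ball z₀ r, ∀ τ ∈ ball τ₀ r, ∀ i j,
      HasDerivAt (fun w => R w τ i j) ((M z τ * R z τ) i j) z := by
    intro z hz τ hτ i j
    have hm : (z, τ) ∈ W := ⟨hz, hτ⟩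
    have d1 := HolOn₂.hasDerivAt_fst_deriv_snd (f := fun z τ => Y z τ i j) (hY i j) hWo hm
    have e : (fun t => deriv (fun w => Y w t i j) z) =ᶠ[𝓝 τ] fun t => (M z t * Y z t) i j := by
      filter_upwards [isOpen_ball.mem_nhds hτ] with t ht
      exact (hYz z hz t ht i j).deriv
    rw [e.deriv_eq, (hasDerivAt_matrix_mul (hMτ z τ (hWX hm)) (hYT z hz τ hτ) i j).deriv] at d1
    have d2 := hasDerivAt_matrix_mul (hcurv z τ (hWX hm)) (hYz z hz τ hτ) i j
    refine (d1.fun_sub d2).congr_deriv ?_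
    rw [← Matrix.sub_apply]
    refine congrFun (congrFun ?_ i) j
    simp only [hR]
    noncomm_ring
  have hR0 : ∀ τ ∈ ball τ₀ r, R z₀ τ = 0 := by
    intro τ hτ
    simp only [hR]
    rw [sub_eq_zero]
    ext i j
    have e : (fun t => Y z₀ t i j) =ᶠ[𝓝 τ] fun t => Ψ t z₀ i j := by
      filter_upwards [isOpen_ball.mem_nhds hτ] with t ht
      simp only [hYdef, hΦ0 t (b1 _ ht), one_mul]
    have h1 := ((hΨd τ (b2 _ hτ) z₀ (b2 _ hzz)).2 i j).congr_of_eventuallyEq e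
    rw [(hYT z₀ hzz τ hτ i j).unique h1]
    simp only [hYdef, hΦ0 τ (b1 _ hτ), one_mul]
  have hRR : ∀ z ∈ ball z₀ r, ∀ τ ∈ ball τ₀ r, R z τ = 0 := by
    intro z hz τ hτ
    have := eq_mul_of_solves (M := fun z => M z τ) (Y := fun z => Y z τ) (F := fun z => R z τ)
      isOpen_ball (convex_ball _ _) (fun z hz => hYz z hz τ hτ) (fun z hz => hRz z hz τ hτ)
      (fun z hz => hYd z hz τ hτ) hz hzz (C := 0) (by rw [hR0 τ hτ, Matrix.mul_zero])
    rw [this, Matrix.mul_zero]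
  refine ⟨W, hWo, ⟨hzz, mem_ball_self hr⟩, hWX, Y, hY, fun z τ hm =>
    ⟨hYd z hm.1 τ hm.2, hYz z hm.1 τ hm.2, fun i j => ?_⟩⟩
  have := hRR z hm.1 τ hm.2
  rw [← sub_eq_zero.1 this]
  exact hYT z hm.1 τ hm.2 i j

namespace GenLame.LameData

variable {D : LameData} {V : Set ℂ} {f : ℂ → ℂ → ℂ}

/-- A deformation is the `(1, 2)` entry of the coefficient of a Pfaffian system. -/
theorem IsDeformation.exists_isCompletelyIntegrable (hVH : ∀ τ ∈ V, 0 < τ.im)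
    (hX : IsOpen (D.regularSet V)) (hQ : MatHolOn D.Q (D.regularSet V))
    (hI : HolOn₂ D.potential (D.regularSet V)) (hf : D.IsDeformation V f) :
    ∃ Ω : ℂ → ℂ → Matrix (Fin 2) (Fin 2) ℂ, MatHolOn Ω (D.regularSet V) ∧
      (∀ z τ : ℂ, (z, τ) ∈ D.regularSet V →
        Ω (z + 1) τ = Ω z τ ∧ Ω (z + τ) τ = Ω z τ - D.Q z τ) ∧
      D.IsCompletelyIntegrable Ω (D.regularSet V) := by
  have h0 : HolOn₂ f (D.regularSet V) := hf.holOn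
  set f₁ : ℂ → ℂ → ℂ := fun z τ => deriv (fun w => f w τ) z with hf₁
  have h1 : HolOn₂ f₁ (D.regularSet V) := h0.deriv_fst hX
  set f₂ : ℂ → ℂ → ℂ := fun z τ => deriv (fun w => f₁ w τ) z with hf₂
  have h2 : HolOn₂ f₂ (D.regularSet V) := h1.deriv_fst hX
  -- The traceless matrix forced by zero curvature: `Ω₂₂ - Ω₁₁ = f'` and `Ω₂₁ = I f - f''/2`.
  set Ω : ℂ → ℂ → Matrix (Fin 2) (Fin 2) ℂ := fun z τ =>
    !![-(1 / 2) * f₁ z τ, f z τ; -(1 / 2) * f₂ z τ + f z τ * D.potential z τ, 1 / 2 * f₁ z τ]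
    with hΩdef
  have hΩ : MatHolOn Ω (D.regularSet V) := by
    have c : ∀ c : ℂ, HolOn₂ (fun _ _ => c) (D.regularSet V) := fun c => differentiableOn_const c
    intro i j
    fin_cases i <;> fin_cases j
    · exact (c (-(1 / 2))).mul h1
    · exact h0
    · exact ((c (-(1 / 2))).mul h2).add (h0.mul hI)
    · exact (c (1 / 2)).mul h1
  have hderiv : ∀ {g : ℂ → ℂ → ℂ} {l τ c : ℂ}, (∀ z, (z, τ) ∈ D.regularSet V →
      g (z + l) τ = g z τ - c) → ∀ z, (z, τ) ∈ D.regularSet V →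
      deriv (fun w => g w τ) (z + l) = deriv (fun w => g w τ) z - 0 := by
    intro g l τ c h z hz
    have n1 : ∀ᶠ w in 𝓝 z, (w, τ) ∈ D.regularSet V :=
      (by fun_prop : ContinuousAt (fun w : ℂ => (w, τ)) z).eventually (hX.mem_nhds hz)
    have e : (fun w => g (w + l) τ) =ᶠ[𝓝 z] fun w => g w τ - c := n1.mono fun w hw => h w hw
    rw [← deriv_comp_add_const (fun w => g w τ), e.deriv_eq, deriv_sub_const, sub_zero]
  -- The derivatives of `f` are periodic, so a shift `-c` of `f` changes only the entries `f` and `I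
  -- f`, that is, changes `Ω` by `-c Q`.
  have hper : ∀ (l c τ : ℂ), l ∈ (periods τ).lattice →
      (∀ z, (z, τ) ∈ D.regularSet V → f (z + l) τ = f z τ - c) → ∀ z, (z, τ) ∈ D.regularSet V →
      Ω (z + l) τ = Ω z τ - c • D.Q z τ := by
    intro l c τ hl h z hz
    have k1 := hderiv h
    have k2 := hderiv (g := f₁) k1
    have e1 : f₁ (z + l) τ = f₁ z τ := by rw [← sub_zero (f₁ z τ)]; exact k1 z hz
    have e2 : f₂ (z + l) τ = f₂ z τ := by rw [← sub_zero (f₂ z τ)]; exact k2 z hz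
    simp only [hΩdef, Q, e1, e2, h z hz, D.potential_add (hVH τ hz.1) hl hz.2]
    ext i j
    fin_cases i <;> fin_cases j <;> simp
    ring
  refine ⟨Ω, hΩ, fun z τ hz => ⟨?_, ?_⟩, ?_⟩
  · have := hper 1 0 τ (one_mem_lattice τ)
      (fun z hz => by rw [sub_zero]; exact (hf.periodic z τ hz).1) z hz
    simpa using this
  · have := hper τ 1 τ (self_mem_lattice (hVH τ hz.1)) (fun z hz => (hf.periodic z τ hz).2) z hz
    simpa using this
  · rintro ⟨z₀, τ₀⟩ hx₀
    refine exists_pfaffian_solution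
      (M' := fun z τ => !![0, 0; deriv (fun t => D.potential z t) τ, 0]) hX hQ hΩ
      (fun z τ hz => D.hasDerivAt_Q_snd (hI.differentiableAt_snd hX hz).hasDerivAt)
      (fun z τ hz => ?_) hx₀
    have d0 : HasDerivAt (fun w => f w τ) (f₁ z τ) z := (h0.differentiableAt_fst hX hz).hasDerivAt
    have d1 : HasDerivAt (fun w => f₁ w τ) (f₂ z τ) z := (h1.differentiableAt_fst hX hz).hasDerivAt
    have d2 : HasDerivAt (fun w => f₂ w τ) (deriv (fun w => f₂ w τ) z) z :=
      (h2.differentiableAt_fst hX hz).hasDerivAt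
    have dI := (hI.differentiableAt_fst hX hz).hasDerivAt
    have e3 : iteratedDeriv 3 (fun w => f w τ) z = deriv (fun w => f₂ w τ) z := by
      rw [iteratedDeriv_succ, iteratedDeriv_succ, iteratedDeriv_one]
    have heq := hf.solves z τ hz
    rw [e3] at heq
    change _ - 4 * D.potential z τ * f₁ z τ - _ + _ = 0 at heq
    intro i j
    fin_cases i <;> fin_cases j <;>
      simp only [Fin.zero_eta, Fin.mk_one, Matrix.sub_apply, Matrix.add_apply, Matrix.mul_apply,
        Fin.sum_univ_two]
    · refine (d1.const_mul (-(1 / 2) : ℂ)).congr_deriv ?_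
      simp [hΩdef, Q]
    · refine d0.congr_deriv ?_
      simp [hΩdef, Q]
      ring
    -- The lower left entry is the only one that uses the deformation equation, multiplied by
    -- `-1/2`; the other three hold by the choice of `Ω`.
    · refine ((d2.const_mul (-(1 / 2) : ℂ)).fun_add (d0.fun_mul dI)).congr_deriv ?_
      simp [hΩdef, Q]
      linear_combination (-1 / 2) * heq
    · refine (d1.const_mul (1 / 2 : ℂ)).congr_deriv ?_
      simp [hΩdef, Q]
      ring

end GenLame.LameData

end

theorem theorem2p2 (D : GenLame.LameData) (V : Set ℂ) (hV : IsOpen V)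
    (hVH : ∀ τ ∈ V, 0 < τ.im)
    (hn : ∀ (k : Fin 4) (m : ℤ), D.n k ≠ 1 / 2 + (m : ℂ))
    (hp : DifferentiableOn ℂ D.p V) (hA : DifferentiableOn ℂ D.A V)
    (hB : DifferentiableOn ℂ D.B V)
    (hp2 : ∀ τ ∈ V, ¬ GenLame.IsTwoTorsion (D.p τ) τ) :
    (D.IsMonodromyPreserving V ↔
      ∃ Ω₁₂ : ℂ → ℂ → ℂ,
        DifferentiableOn ℂ (fun x : ℂ × ℂ => Ω₁₂ x.1 x.2) (D.regularSet V) ∧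
        D.SolvesDeformationEquation Ω₁₂ (D.regularSet V) ∧
        ∀ z τ : ℂ, (z, τ) ∈ D.regularSet V →
          Ω₁₂ (z + 1) τ = Ω₁₂ z τ ∧ Ω₁₂ (z + τ) τ = Ω₁₂ z τ - 1) ∧
    (D.IsMonodromyPreserving V ↔
      ∃ Ω : ℂ → ℂ → Matrix (Fin 2) (Fin 2) ℂ,
        GenLame.MatHolOn Ω (D.regularSet V) ∧
        (∀ z τ : ℂ, (z, τ) ∈ D.regularSet V →
          Ω (z + 1) τ = Ω z τ ∧ Ω (z + τ) τ = Ω z τ - D.Q z τ) ∧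
        D.IsCompletelyIntegrable Ω (D.regularSet V)) := by
  -- The three arrows of the cycle; each of the four implications is a composite of them.
  have hdef : D.IsMonodromyPreserving V → ∃ f, D.IsDeformation V f := fun h =>
    GenLame.LameData.exists_isDeformation_of_isMonodromyPreserving hVH hn hp hA hB hp2 h
  have hint := fun f (hf : D.IsDeformation V f) =>
    hf.exists_isCompletelyIntegrable hVH (D.isOpen_regularSet hV hVH hp)
      (D.holOn_Q hVH hp hA hB) (D.holOn₂_potential hVH hp hA hB)
  have hpres := fun Ω h1 h2 h3 => D.isMonodromyPreserving_of_isCompletelyIntegrable (Ω := Ω)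
    hV hVH hp hA hB h1 h2 h3
  refine ⟨⟨fun h => ?_, ?_⟩, ⟨fun h => ?_, ?_⟩⟩
  · obtain ⟨f, hf⟩ := hdef h
    exact ⟨f, hf.holOn, hf.solves, hf.periodic⟩
  · rintro ⟨f, h1, h2, h3⟩
    obtain ⟨Ω, k1, k2, k3⟩ := hint f ⟨h1, h2, h3⟩
    exact hpres Ω k1 k2 k3
  · obtain ⟨f, hf⟩ := hdef h
    exact hint f hf
  · rintro ⟨Ω, k1, k2, k3⟩
    exact hpres Ω k1 k2 k3
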